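/- \textbf{Model.} In the massively parallel computation (MPC) model, $p$ machines with a memory of $s$ words of $O(\log n)$ bits each work in synchronous rounds. The input is an undirected graph $G$ with $n$ vertices and $m$ edges, whose edges are initially distributed arbitrarily over the machines, at most $s$ edges on each machine; the number of machines is such that the total memory is linear in the input size, i.e. $p=\lceil C(n+m)/s\rceil$ for a constant $C\ge 1$. In each round every machine performs a (randomized, otherwise unrestricted) local computation and sends messages to the machines (data that it keeps counts as a message to itself); the total length of the messages that a machine sends in a round is at most $s$ words, and so is the total length of the messages that it receives in a round. At the end, each machine outputs at most $s$ vertices, and the solution is the union of these outputs. \textbf{Theorem.} There is a constant $K$ such that for every constant $\varepsilon>0$ there is a randomized MPC algorithm such that, for all sufficiently large $n$, every memory size $s\ge n^{\varepsilon}$, every graph $G$ on $n$ vertices and every initial distribution of its edges, the algorithm never exceeds the memory of $s$ words per machine, uses $O_\varepsilon\big(\log\log n+\max\{0,\log(n/s)\}\big)$ rounds, and with probability at least $1-1/n$ outputs a vertex cover of $G$ of size at most $K\log n\cdot\mathsf{opt}(G)$, where $\mathsf{opt}(G)$ is the minimum size of a vertex cover of $G$. -/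

import Mathlib

/-- A randomized algorithm in the massively parallel computation (MPC) model, with `p` machines, for
problems whose input is a set of edges on the vertex set `Fin n` and whose output is a set of
vertices.  Memory and messages consist of words, numbers below `W`.

The rounds are numbered `0, …, lastRound`.  In each round every machine performs a local
computation, which determines the messages that it sends; the messages are delivered at the end
of the round.  A machine has no memory besides the messages that it receives: what it wants
to keep for the next round, it sends to itself, so that this is counted as well.
In every round each machine draws a fresh uniformly random element of `Fin (coin + 1)`. -/
structure MPCAlgorithm (n p W : ℕ) where
  /-- The index of the last round. -/
  lastRound : ℕ
  /-- In each round each machine draws a uniformly random element of `Fin (coin + 1)`. -/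
  coin : ℕ
  /-- `start i E r j` is the message that machine `i` sends to machine `j` in round `0`, if its share
  of the input is `E` and its random draw is `r`. -/
  start : Fin p → Finset (Sym2 (Fin n)) → Fin (coin + 1) → Fin p → List (Fin W)
  /-- `step t i M r j` is the message that machine `i` sends to machine `j` in round `t + 1`, if it
  received the message `M k` from each machine `k` in round `t` and its random draw is `r`. -/
  step : ℕ → Fin p → (Fin p → List (Fin W)) → Fin (coin + 1) → Fin p → List (Fin W)
  /-- `output i M` is the part of the solution that machine `i` outputs at the end, if it
  received the message `M k` from each machine `k` in the last round. -/
  output : Fin p → (Fin p → List (Fin W)) → Finset (Fin n)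

namespace MPCAlgorithm

variable {n p W : ℕ} (A : MPCAlgorithm n p W)

/-- The number of rounds. -/
def rounds : ℕ := A.lastRound + 1

/-- The outcomes of all random draws: one for each round and each machine. -/
abbrev Randomness : Type := Fin A.rounds → Fin p → Fin (A.coin + 1)

/-- `A.message input ω t ht i j` is the message that machine `i` sends to machine `j` in round `t`, if
machine `k` initially holds the edges `input k` and the random draws are `ω`. -/
def message (input : Fin p → Finset (Sym2 (Fin n))) (ω : A.Randomness) :
    (t : ℕ) → t < A.rounds → Fin p → Fin p → List (Fin W)
  | 0, h, i => A.start i (input i) (ω ⟨0, h⟩ i)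
  | t + 1, h, i =>
      A.step t i (fun k => message input ω t (Nat.lt_of_succ_lt h) k i) (ω ⟨t + 1, h⟩ i)

/-- The part of the solution that machine `i` outputs. -/
def machineOutput (input : Fin p → Finset (Sym2 (Fin n))) (ω : A.Randomness) (i : Fin p) :
    Finset (Fin n) :=
  A.output i fun k => A.message input ω A.lastRound (Nat.lt_succ_self _) k i

/-- The solution that the machines collectively output. -/
def solution (input : Fin p → Finset (Sym2 (Fin n))) (ω : A.Randomness) : Finset (Fin n) :=
  Finset.univ.biUnion (A.machineOutput input ω)

/-- The run fits into machines with a memory of `s` words: in each round, whatever a machine sends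
(including what it keeps) has total length at most `s`, whatever it receives (including what it
kept) has total length at most `s`, and the data output by each machine has size at most `s`. -/
def FitsMemory (s : ℕ) (input : Fin p → Finset (Sym2 (Fin n))) (ω : A.Randomness) : Prop :=
  (∀ (t : ℕ) (ht : t < A.rounds) (i : Fin p),
    ∑ j, (A.message input ω t ht i j).length ≤ s ∧
    ∑ j, (A.message input ω t ht j i).length ≤ s) ∧
  ∀ i : Fin p, (A.machineOutput input ω i).card ≤ s

/-- The probability of an event, over the independent uniform draws of all machines in all rounds. -/
noncomputable def prob (S : Set A.Randomness) : ℝ :=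
  (S.ncard : ℝ) / (Fintype.card A.Randomness : ℝ)

end MPCAlgorithm

/-- The input size of a graph, in words of `O(log n)` bits: the number of vertices plus the number
of edges. -/
noncomputable def graphSize {n : ℕ} (G : SimpleGraph (Fin n)) : ℕ := n + G.edgeSet.ncard

/-- `input` is a distribution of the edges of `G` over `p` machines in which no machine holds more
than `s` edges. -/
def IsInputDistribution {n p : ℕ} (G : SimpleGraph (Fin n)) (s : ℕ)
    (input : Fin p → Finset (Sym2 (Fin n))) : Prop :=
  (∀ i, ∀ e ∈ input i, e ∈ G.edgeSet) ∧ (∀ e ∈ G.edgeSet, ∃! i, e ∈ input i) ∧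
    ∀ i, (input i).card ≤ s

open Finset

set_option linter.unusedSectionVars false
set_option linter.unusedFintypeInType false
set_option linter.unusedDecidableInType false

/-! Peeling gives the approximation. Suppose that all remaining degrees are below `2θ` and put every
vertex of degree at least `θ` into the cover. Let `O` be an optimal cover. A removed vertex outside
`O` has all its remaining neighbours in `O`, so counting the edges between both sides bounds the
number of such vertices by `2 * #O` (`card_thresh_removed_le`, `card_direct_removed_le`). Halving
the degree about `log n` times yields a cover of size `O(log n) * #O`, but this takes about `log n`
rounds.

Rounds are saved by performing many halvings at once. A phase that begins with degrees below `2 ^ a`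
colours the vertices at random with `2 ^ κ` colours and peels inside each colour class, with
thresholds scaled by `2 ^ (-κ)`. The edges inside one class fit on one machine, which simulates all
steps locally. The set that is left depends on the colouring, so concentration cannot be applied to
it directly. The process `ideal` depends only on `O` and the initial set: it removes vertices of `O`
at a high threshold and vertices outside `O` at a threshold lower by a factor of four. Chernoff
bounds for its fixed sets (`card_not_good_le`) imply that the coloured process removes all vertices
of `O`, and only those vertices outside `O`, that `ideal` removes (`card_phase_removed_le`). A
halving now costs `8 * #O`.

The choice `κ ≈ (a + d) / 2`, where `2 ^ d` is about `n / s`, makes the edges of a class fit into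
the memory. A phase takes `a` to about `(a + d) / 2` plus `O(log log n)`, so after `log log n`
phases the exponent is `d + O(log log n)` (`degExp_le_add_div`). The remaining halvings are
performed exactly. The number of rounds per phase and per exact halving depends only on `ε`, because
sorting and prefix sums over all machines take constantly many rounds when `s ≥ n ^ ε`.

Feasibility of the cover and the memory bounds do not depend on luck: each phase ends with an exact
threshold, and overfull colour classes are not processed. All machines need the same colouring,
which is too long to send. As there are only `2 ^ (n * n)` graphs to consider, a fixed list of
polynomially many colouring sequences works for all of them (`exists_seeds`,
`exists_coloring_seeds`), so the first machine broadcasts an index into this list.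

Since local computation is unrestricted, the implementation only tracks information: a quantity is
available to a machine if it is a function of what the machine received (`MPC.Det`), and storing it
costs the logarithm of its number of values (`MPC.Small`). Actual local functions are chosen only at
the end (`MPC.Env.Know.exists_algorithm`). -/

/-! ### Chernoff bounds by counting functions, and short lists of random outcomes. -/

theorem sum_pow_card_hits {ι Ω : Type*} [Fintype ι] [DecidableEq ι] [Fintype Ω] [DecidableEq Ω]
    (S : Finset ι) (B : Finset Ω) (y : ℝ) :
    ∑ f : ι → Ω, y ^ #{i ∈ S | f i ∈ B} =
      ((Fintype.card Ω : ℝ) + (y - 1) * #B) ^ #S *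
        (Fintype.card Ω : ℝ) ^ (Fintype.card ι - #S) := by
  have h1 : ∀ f : ι → Ω, y ^ #{i ∈ S | f i ∈ B} =
      ∏ i, (if i ∈ S then (if f i ∈ B then y else 1) else 1) := by
    intro f
    rw [Finset.prod_ite_mem, Finset.univ_inter, Finset.prod_ite]
    simp
  simp_rw [h1]
  rw [← Fintype.piFinset_univ,
    Finset.sum_prod_piFinset (Finset.univ : Finset Ω)
      (fun i x => if i ∈ S then (if x ∈ B then y else 1) else 1)]
  have h2 : ∀ i, ∑ x : Ω, (if i ∈ S then (if x ∈ B then y else 1) else 1) =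
      if i ∈ S then ((Fintype.card Ω : ℝ) + (y - 1) * #B) else (Fintype.card Ω : ℝ) := by
    intro i
    split_ifs
    · have : ∀ x, (if x ∈ B then y else 1) = 1 + (if x ∈ B then y - 1 else 0) := by
        intro x; split_ifs <;> ring
      simp_rw [this, Finset.sum_add_distrib, Finset.sum_ite_mem]
      simp only [sum_const, Finset.card_univ, nsmul_eq_mul, mul_one, Finset.univ_inter]
      ring
    · simp
  simp_rw [h2, Finset.prod_ite]
  simp only [Finset.filter_mem_eq_inter, Finset.univ_inter, Finset.prod_const]
  congr 2
  rw [Finset.filter_not, Finset.filter_mem_eq_inter, Finset.univ_inter,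
    ← Finset.compl_eq_univ_sdiff, Finset.card_compl]

/-- The images of different points are independent, so the generating function is a product with
factors `1 + (y - 1) * #B / card Ω`; `1 + t ≤ exp t` bounds each factor for `y` above and below `1`
alike. -/
theorem mgf_bound {ι Ω : Type*} [Fintype ι] [DecidableEq ι] [Fintype Ω] [DecidableEq Ω] [Nonempty Ω]
    (S : Finset ι) (B : Finset Ω) (y : ℝ) (hy : 0 ≤ y) :
    ∑ f : ι → Ω, y ^ #{i ∈ S | f i ∈ B} ≤
      Real.exp ((y - 1) * #S * #B / Fintype.card Ω) * (Fintype.card Ω : ℝ) ^ Fintype.card ι := by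
  rw [sum_pow_card_hits]
  have hΩ : (0 : ℝ) < Fintype.card Ω := by exact_mod_cast Fintype.card_pos
  have hB : (#B : ℝ) ≤ Fintype.card Ω := by exact_mod_cast Finset.card_le_univ B
  have hS : #S ≤ Fintype.card ι := Finset.card_le_univ S
  have e1 : (Fintype.card Ω : ℝ) + (y - 1) * #B =
      (1 + (y - 1) * #B / Fintype.card Ω) * Fintype.card Ω := by
    field_simp
  have e0 : 0 ≤ (Fintype.card Ω : ℝ) + (y - 1) * #B := by
    nlinarith [mul_nonneg hy (Nat.cast_nonneg (α := ℝ) #B)]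
  have e2 : (Fintype.card Ω : ℝ) + (y - 1) * #B ≤
      Real.exp ((y - 1) * #B / Fintype.card Ω) * Fintype.card Ω := by
    rw [e1]
    gcongr
    linarith [Real.add_one_le_exp ((y - 1) * #B / Fintype.card Ω)]
  calc _ ≤ (Real.exp ((y - 1) * #B / Fintype.card Ω) * Fintype.card Ω) ^ #S *
        (Fintype.card Ω : ℝ) ^ (Fintype.card ι - #S) := by gcongr
    _ = _ := by
      rw [mul_pow, ← Real.exp_nat_mul, mul_assoc, ← pow_add, Nat.add_sub_cancel' hS]
      congr 2
      ring

/-- Markov's inequality for `2 ^ hits`. The mean is at most `τ / 2`, and `exp (1 / 2) / 2 ≤ 5 / 6`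
because `exp 1 ≤ 25 / 9`. -/
theorem chernoff_upper {ι Ω : Type*} [Fintype ι] [DecidableEq ι] [Fintype Ω] [DecidableEq Ω]
    [Nonempty Ω] (S : Finset ι) (B : Finset Ω) (τ : ℕ) (h : 2 * (#S * #B) ≤ τ * Fintype.card Ω) :
    (#{f : ι → Ω | τ ≤ #{i ∈ S | f i ∈ B}} : ℝ) ≤
      (5 / 6) ^ τ * (Fintype.card Ω : ℝ) ^ Fintype.card ι := by
  have hΩ : (0 : ℝ) < Fintype.card Ω := by exact_mod_cast Fintype.card_pos
  have h1 : (#{f : ι → Ω | τ ≤ #{i ∈ S | f i ∈ B}} : ℝ) * 2 ^ τ ≤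
      ∑ f : ι → Ω, (2 : ℝ) ^ #{i ∈ S | f i ∈ B} := by
    rw [← nsmul_eq_mul]
    refine (Finset.card_nsmul_le_sum _ _ _ ?_).trans
      (Finset.sum_le_sum_of_subset_of_nonneg (Finset.subset_univ _) fun _ _ _ => by positivity)
    intro f hf
    exact pow_le_pow_right₀ (by norm_num) (by simpa using hf)
  have h2 := h1.trans (mgf_bound S B 2 (by norm_num))
  have h3 : Real.exp ((2 - 1) * #S * #B / Fintype.card Ω) ≤ (5 / 3) ^ τ := by
    have : ((2 - 1) * #S * #B / Fintype.card Ω : ℝ) ≤ τ * (1 / 2) := by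
      rw [div_le_iff₀ hΩ]
      have : (2 * (#S * #B) : ℝ) ≤ τ * Fintype.card Ω := by exact_mod_cast h
      linarith
    refine (Real.exp_le_exp.2 this).trans ?_
    rw [Real.exp_nat_mul]
    gcongr
    have h4 : Real.exp (1 / 2) ^ 2 = Real.exp 1 := by rw [← Real.exp_nat_mul]; norm_num
    have := Real.exp_one_lt_d9
    nlinarith [Real.exp_pos (1 / 2)]
  have h5 : (5 / 6 : ℝ) ^ τ * 2 ^ τ = (5 / 3) ^ τ := by rw [← mul_pow]; norm_num
  have h6 : (0 : ℝ) < 2 ^ τ := by positivity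
  refine le_of_mul_le_mul_right ?_ h6
  calc _ ≤ _ := h2
    _ ≤ (5 / 3) ^ τ * (Fintype.card Ω : ℝ) ^ Fintype.card ι := by gcongr
    _ = _ := by rw [← h5]; ring

/-- Markov's inequality for `(1 / 2) ^ hits`. The mean is at least `2 * τ`, and `2 * exp (-1) ≤ 5 /
6`. -/
theorem chernoff_lower {ι Ω : Type*} [Fintype ι] [DecidableEq ι] [Fintype Ω] [DecidableEq Ω]
    [Nonempty Ω] (S : Finset ι) (B : Finset Ω) (τ : ℕ) (h : 2 * τ * Fintype.card Ω ≤ #S * #B) :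
    (#{f : ι → Ω | #{i ∈ S | f i ∈ B} < τ} : ℝ) ≤
      (5 / 6) ^ τ * (Fintype.card Ω : ℝ) ^ Fintype.card ι := by
  have hΩ : (0 : ℝ) < Fintype.card Ω := by exact_mod_cast Fintype.card_pos
  have h1 : (#{f : ι → Ω | #{i ∈ S | f i ∈ B} < τ} : ℝ) * (1 / 2) ^ τ ≤
      ∑ f : ι → Ω, (1 / 2 : ℝ) ^ #{i ∈ S | f i ∈ B} := by
    rw [← nsmul_eq_mul]
    refine (Finset.card_nsmul_le_sum _ _ _ ?_).trans
      (Finset.sum_le_sum_of_subset_of_nonneg (Finset.subset_univ _) fun _ _ _ => by positivity)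
    intro f hf
    exact pow_le_pow_of_le_one (by norm_num) (by norm_num) (le_of_lt (by simpa using hf))
  have h2 := h1.trans (mgf_bound S B (1 / 2) (by norm_num))
  have h3 : Real.exp ((1 / 2 - 1) * #S * #B / Fintype.card Ω) ≤ (5 / 12) ^ τ := by
    have : ((1 / 2 - 1) * #S * #B / Fintype.card Ω : ℝ) ≤ τ * (-1) := by
      rw [div_le_iff₀ hΩ]
      have : (2 * τ * Fintype.card Ω : ℝ) ≤ #S * #B := by exact_mod_cast h
      linarith
    refine (Real.exp_le_exp.2 this).trans ?_
    rw [Real.exp_nat_mul]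
    gcongr
    rw [Real.exp_neg, inv_le_comm₀ (Real.exp_pos _) (by norm_num)]
    have := Real.exp_one_gt_d9
    linarith
  have h5 : (5 / 6 : ℝ) ^ τ * (1 / 2) ^ τ = (5 / 12) ^ τ := by rw [← mul_pow]; norm_num
  have h6 : (0 : ℝ) < (1 / 2) ^ τ := by positivity
  refine le_of_mul_le_mul_right ?_ h6
  calc _ ≤ _ := h2
    _ ≤ (5 / 12) ^ τ * (Fintype.card Ω : ℝ) ^ Fintype.card ι := by gcongr
    _ = _ := by rw [← h5]; ring

/-- Few random bits suffice: if every `g` has a small fraction of bad outcomes, then some short list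
of outcomes has few bad entries for every `g` at once. -/
theorem exists_seeds {Ω 𝒢 : Type*} [Fintype Ω] [DecidableEq Ω] [Nonempty Ω] [Fintype 𝒢]
    (bad : 𝒢 → Finset Ω) (n τ : ℕ) (hbad : ∀ g, 2 * n * #(bad g) ≤ Fintype.card Ω)
    (hcard : (Fintype.card 𝒢 : ℝ) * (5 / 6) ^ τ < 1) :
    ∃ h : Fin (τ * n) → Ω, ∀ g, #{i | h i ∈ bad g} < τ := by
  by_contra hcon
  push Not at hcon
  have hΩ : (0 : ℝ) < Fintype.card Ω := by exact_mod_cast Fintype.card_pos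
  -- Probabilistic method: in a uniformly random list of length `τ * n`, the expected number of bad
  -- entries for a fixed `g` is at most `τ / 2`. The upper tail bound and a union bound over `𝒢`
  -- leave a list without an overfull `g`.
  have h1 : (Finset.univ : Finset (Fin (τ * n) → Ω)) ⊆
      Finset.univ.biUnion fun g => {f : Fin (τ * n) → Ω | τ ≤ #{i ∈ Finset.univ | f i ∈ bad g}} := by
    intro f _
    obtain ⟨g, hg⟩ := hcon f
    simpa using ⟨g, hg⟩
  have h2 : (Fintype.card (Fin (τ * n) → Ω) : ℝ) ≤
      ∑ g : 𝒢, (5 / 6 : ℝ) ^ τ * (Fintype.card Ω : ℝ) ^ Fintype.card (Fin (τ * n)) := by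
    calc _ ≤ ((#(Finset.univ.biUnion fun g =>
            {f : Fin (τ * n) → Ω | τ ≤ #{i ∈ Finset.univ | f i ∈ bad g}}) : ℕ) : ℝ) := by
          exact_mod_cast Finset.card_le_card h1
      _ ≤ ((∑ g, #{f : Fin (τ * n) → Ω | τ ≤ #{i ∈ Finset.univ | f i ∈ bad g}} : ℕ) : ℝ) := by
          exact_mod_cast Finset.card_biUnion_le
      _ ≤ _ := by
          rw [Nat.cast_sum]
          refine Finset.sum_le_sum fun g _ => ?_
          refine chernoff_upper _ _ _ ?_
          rw [Finset.card_univ, Fintype.card_fin]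
          calc _ = τ * (2 * n * #(bad g)) := by ring
            _ ≤ _ := Nat.mul_le_mul_left _ (hbad g)
  rw [Finset.sum_const, Finset.card_univ, nsmul_eq_mul, Fintype.card_fun, Fintype.card_fin] at h2
  push_cast at h2
  have h3 : (0 : ℝ) < (Fintype.card Ω : ℝ) ^ (τ * n) := by positivity
  nlinarith

/-- Fubini: if for every choice of the other coordinates at most a `1 / D` fraction of the values of
coordinate `i` is bad, then at most a `1 / D` fraction of all tuples is bad. This permits `E` to
depend on coordinates that were drawn earlier. -/
theorem card_pi_le_of_update {T : ℕ} {β : Fin T → Type*} [∀ i, Fintype (β i)]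
    (E : (∀ i, β i) → Prop) [DecidablePred E] (i : Fin T) (D : ℕ)
    (h : ∀ ω : ∀ i, β i, D * #{x : β i | E (Function.update ω i x)} ≤ Fintype.card (β i)) :
    D * #{ω : ∀ i, β i | E ω} ≤ Fintype.card (∀ i, β i) := by
  classical
  rcases isEmpty_or_nonempty (∀ i, β i) with hemp | ⟨⟨ω₀⟩⟩
  · simp
  have e := Equiv.piSplitAt i β
  have h1 : #{ω : ∀ i, β i | E ω} =
      ∑ r : (∀ j : {j // j ≠ i}, β j), #{x : β i | E ((Equiv.piSplitAt i β).symm (x, r))} := by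
    have : #{ω : ∀ i, β i | E ω} =
        #{q : β i × (∀ j : {j // j ≠ i}, β j) | E ((Equiv.piSplitAt i β).symm q)} := by
      refine Finset.card_equiv (Equiv.piSplitAt i β) fun ω => ?_
      simp only [Finset.mem_filter, Finset.mem_univ, true_and, Equiv.symm_apply_apply]
    rw [this]
    simp only [Finset.card_filter, Fintype.sum_prod_type]
    rw [Finset.sum_comm]
  have h2 : Fintype.card (∀ i, β i) =
      ∑ r : (∀ j : {j // j ≠ i}, β j), Fintype.card (β i) := by
    rw [Fintype.card_congr (Equiv.piSplitAt i β), Fintype.card_prod, Finset.sum_const,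
      Finset.card_univ, smul_eq_mul, mul_comm]
  rw [h1, h2, Finset.mul_sum]
  refine Finset.sum_le_sum fun r _ => ?_
  refine le_trans (le_of_eq ?_) (h ((Equiv.piSplitAt i β).symm (ω₀ i, r)))
  congr 3
  ext x
  have : (Equiv.piSplitAt i β).symm (x, r) =
      Function.update ((Equiv.piSplitAt i β).symm (ω₀ i, r)) i x := by
    funext j
    by_cases hj : j = i
    · subst hj; simp [Equiv.piSplitAt]
    · simp [Equiv.piSplitAt, hj]
  rw [this]

/-! ### Peeling, its coloured version, and the comparison with the ideal process. -/

section Peeling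

variable {V : Type*} [Fintype V] [DecidableEq V] (G : SimpleGraph V)

open Classical in
/-- The neighbours of `v` in the set `A`. -/
noncomputable def nbrs (A : Finset V) (v : V) : Finset V := {u ∈ A | G.Adj v u}

/-- Remove all vertices with at least `θ` neighbours. -/
noncomputable def thresh (θ : ℕ) (A : Finset V) : Finset V := {v ∈ A | #(nbrs G A v) < θ}

/-- The neighbours of `v` in `A` that have the colour of `v`. -/
noncomputable def monoNbrs (γ : V → ℕ) (A : Finset V) (v : V) : Finset V :=
  {u ∈ nbrs G A v | γ u = γ v}

/-- Remove all vertices with more than `b` neighbours of their own colour. -/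
noncomputable def trimMono (γ : V → ℕ) (b : ℕ) (A : Finset V) : Finset V :=
  {v ∈ A | #(monoNbrs G γ A v) ≤ b}

/-- Remove, for `j = 0, 1, …`, all vertices with at least `τ j` neighbours of their own colour. -/
noncomputable def peel (γ : V → ℕ) (τ : ℕ → ℕ) (A : Finset V) : ℕ → Finset V
  | 0 => A
  | j + 1 => {v ∈ peel γ τ A j | #(monoNbrs G γ (peel γ τ A j) v) < τ j}

/-- The peeling process relative to a vertex cover `O`: what is left of `O` and of its complement. -/
noncomputable def ideal (O A : Finset V) (hi lo : ℕ → ℕ) : ℕ → Finset V × Finset V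
  | 0 => (A ∩ O, A \ O)
  | j + 1 =>
    ({v ∈ (ideal O A hi lo j).1 | #(nbrs G (ideal O A hi lo j).2 v) < hi j},
      {v ∈ (ideal O A hi lo j).2 | #(nbrs G (ideal O A hi lo j).1 v) < lo j})

variable {G}

theorem mem_nbrs {A : Finset V} {v u : V} : u ∈ nbrs G A v ↔ u ∈ A ∧ G.Adj v u := by
  classical
  exact Finset.mem_filter

theorem nbrs_mono {A B : Finset V} (h : A ⊆ B) (v : V) : nbrs G A v ⊆ nbrs G B v := by
  classical
  exact Finset.filter_subset_filter _ h

theorem thresh_subset (θ : ℕ) (A : Finset V) : thresh G θ A ⊆ A := Finset.filter_subset _ _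

theorem trimMono_subset (γ : V → ℕ) (b : ℕ) (A : Finset V) : trimMono G γ b A ⊆ A :=
  Finset.filter_subset _ _

theorem peel_subset (γ : V → ℕ) (τ : ℕ → ℕ) (A : Finset V) (j : ℕ) : peel G γ τ A j ⊆ A := by
  induction j with
  | zero => exact subset_rfl
  | succ j ih => exact (Finset.filter_subset _ _).trans ih

theorem card_nbrs_thresh_lt (θ : ℕ) (A : Finset V) (v : V) (hv : v ∈ thresh G θ A) :
    #(nbrs G (thresh G θ A) v) < θ :=
  (Finset.card_le_card (nbrs_mono (thresh_subset θ A) v)).trans_lt (Finset.mem_filter.1 hv).2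

/-- Double counting of the edges between `Z` and `Y`. -/
theorem card_mul_le_of_nbrs {X Y Z : Finset V} {m M : ℕ} (hY : ∀ u ∈ Y, #(nbrs G X u) ≤ M)
    (hZX : Z ⊆ X) (hZ : ∀ v ∈ Z, m ≤ #(nbrs G Y v)) : #Z * m ≤ #Y * M := by
  classical
  refine Finset.card_mul_le_card_mul G.Adj (fun v hv => ?_) (fun u hu => ?_)
  · convert hZ v hv using 2
    ext u; simp [mem_nbrs, Finset.mem_bipartiteAbove]
  · refine le_trans (Finset.card_le_card ?_) (hY u hu)
    intro v hv
    rw [Finset.mem_bipartiteBelow] at hv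
    exact mem_nbrs.2 ⟨hZX hv.1, hv.2.symm⟩

/-- `O` covers every edge inside `A`. -/
def CoversIn (G : SimpleGraph V) (O A : Finset V) : Prop :=
  ∀ v ∈ A, ∀ u ∈ A, G.Adj v u → v ∈ O ∨ u ∈ O

theorem CoversIn.mono {O A B : Finset V} (h : CoversIn G O B) (hAB : A ⊆ B) : CoversIn G O A :=
  fun v hv u hu => h v (hAB hv) u (hAB hu)

theorem CoversIn.nbrs_subset {O A : Finset V} (h : CoversIn G O A) {v : V} (hv : v ∈ A)
    (hvO : v ∉ O) : nbrs G A v ⊆ A ∩ O := by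
  intro u hu
  rw [mem_nbrs] at hu
  exact Finset.mem_inter.2 ⟨hu.1, (h v hv u hu.1 hu.2).resolve_left hvO⟩

/-- All neighbours in `A` of a vertex outside `O` lie in `A ∩ O`, so each removed one accounts for
`θ` edges, and each vertex of `A ∩ O` absorbs at most `M` of them. The set `X` may be smaller than
`A \ O` since a phase controls only the degrees into the ideal survivors. -/
theorem card_thresh_removed_le {O A X : Finset V} {θ M : ℕ} (hO : CoversIn G O A) (hX : X ⊆ A \ O)
    (hM : ∀ u ∈ A ∩ O, #(nbrs G X u) ≤ M) :
    #(X \ thresh G θ A) * θ ≤ #O * M := by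
  refine (card_mul_le_of_nbrs (X := X) (Y := A ∩ O) hM Finset.sdiff_subset ?_).trans
    (Nat.mul_le_mul_right _ (Finset.card_le_card Finset.inter_subset_right))
  intro v hv
  rw [Finset.mem_sdiff] at hv
  have hvA := Finset.mem_sdiff.1 (hX hv.1)
  have h1 : θ ≤ #(nbrs G A v) := by
    by_contra hlt
    exact hv.2 (Finset.mem_filter.2 ⟨hvA.1, not_le.1 hlt⟩)
  refine h1.trans (Finset.card_le_card ?_)
  intro u hu
  exact mem_nbrs.2 ⟨hO.nbrs_subset hvA.1 hvA.2 hu, (mem_nbrs.1 hu).2⟩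

/-- One exact peeling step removes few vertices outside a vertex cover. -/
theorem card_direct_removed_le {O A : Finset V} {a : ℕ} (hO : CoversIn G O A)
    (hdeg : ∀ v ∈ A, #(nbrs G A v) < 2 ^ (a + 1)) :
    #((A \ thresh G (2 ^ a) A) \ O) ≤ 2 * #O := by
  have h := card_thresh_removed_le (X := A \ O) (θ := 2 ^ a) (M := 2 ^ (a + 1)) hO subset_rfl
    (fun u hu => (Finset.card_le_card (nbrs_mono Finset.sdiff_subset u)).trans
      (hdeg u (Finset.mem_inter.1 hu).1).le)
  have h2 : (A \ thresh G (2 ^ a) A) \ O = (A \ O) \ thresh G (2 ^ a) A := by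
    ext; simp; tauto
  rw [h2]
  refine Nat.le_of_mul_le_mul_right (h.trans (le_of_eq ?_)) (Nat.two_pow_pos a)
  rw [pow_succ]; ring

section Ideal

variable (O A : Finset V) (hi lo : ℕ → ℕ)

theorem ideal_fst_subset (j : ℕ) : (ideal G O A hi lo j).1 ⊆ A ∩ O := by
  induction j with
  | zero => exact subset_rfl
  | succ j ih => exact (Finset.filter_subset _ _).trans ih

theorem ideal_snd_subset (j : ℕ) : (ideal G O A hi lo j).2 ⊆ A \ O := by
  induction j with
  | zero => exact subset_rfl
  | succ j ih => exact (Finset.filter_subset _ _).trans ih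

theorem ideal_snd_succ_subset (j : ℕ) :
    (ideal G O A hi lo (j + 1)).2 ⊆ (ideal G O A hi lo j).2 := Finset.filter_subset _ _

end Ideal

/-- The colouring `γ` with `2 ^ κ` colours behaves as expected in a phase that begins with the
vertex set `A` and takes the maximum degree from `2 ^ a` to `2 ^ (a - J)`. -/
structure GoodColoring (G : SimpleGraph V) (O A : Finset V) (a κ J z : ℕ) (γ : V → ℕ) : Prop where
  size : ∀ c < 2 ^ κ, #{u | γ u = c} ≤ z
  deg : ∀ c < 2 ^ κ, ∀ v, #(nbrs G A v) < 2 ^ a → #{u ∈ nbrs G A v | γ u = c} ≤ 2 * 2 ^ (a - κ)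
  lower : ∀ c < 2 ^ κ, ∀ j < J, ∀ v,
    2 ^ (a - 1 - j) ≤
      #(nbrs G (ideal G O A (fun j => 2 ^ (a - 1 - j)) (fun j => 2 ^ (a - 3 - j)) j).2 v) →
    2 ^ (a - j - 2 - κ) ≤
      #{u ∈ nbrs G (ideal G O A (fun j => 2 ^ (a - 1 - j)) (fun j => 2 ^ (a - 3 - j)) j).2 v |
        γ u = c}
  upper : ∀ c < 2 ^ κ, ∀ j < J, ∀ v,
    #(nbrs G (ideal G O A (fun j => 2 ^ (a - 1 - j)) (fun j => 2 ^ (a - 3 - j)) j).1 v) <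
      2 ^ (a - 3 - j) →
    #{u ∈ nbrs G (ideal G O A (fun j => 2 ^ (a - 1 - j)) (fun j => 2 ^ (a - 3 - j)) j).1 v |
        γ u = c} < 2 ^ (a - j - 2 - κ)

/-- The set of vertices that is left after a phase. -/
noncomputable def phase (G : SimpleGraph V) (a κ J z : ℕ) (γ : V → ℕ) (A : Finset V) : Finset V :=
  thresh G (2 ^ (a - J))
    (if ∀ c < 2 ^ κ, #{u | γ u = c} ≤ z then
      peel G γ (fun j => 2 ^ (a - j - 2 - κ)) (trimMono G γ (2 * 2 ^ (a - κ)) A) J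
    else trimMono G γ (2 * 2 ^ (a - κ)) A)

/-- The coloured process is sandwiched by `ideal`, whose cost is bounded by double counting: a
vertex outside `O` removed in step `j` has at least `2 ^ (a - 3 - j)` neighbours in what is left of
`O`, and each vertex left there has at most `2 ^ (a - j)` neighbours in what is left outside, hence
`8 * #O` per step. The final exact threshold costs another `#O`. -/
theorem card_phase_removed_le {O A : Finset V} {a κ J z : ℕ} {γ : V → ℕ} (hJ : J + 2 ≤ a)
    (hγ : ∀ v, γ v < 2 ^ κ) (hO : CoversIn G O A) (hdeg : ∀ v ∈ A, #(nbrs G A v) < 2 ^ a)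
    (hgood : GoodColoring G O A a κ J z γ) :
    #((A \ phase G a κ J z γ A) \ O) ≤ (8 * J + 1) * #O := by
  -- For a good colouring the two safeguards of `phase`, trimming and the test of the class sizes,
  -- have no effect.
  have hguard : trimMono G γ (2 * 2 ^ (a - κ)) A = A :=
    Finset.filter_true_of_mem fun v hv => hgood.deg _ (hγ v) v (hdeg v hv)
  unfold phase
  rw [if_pos hgood.size, hguard]
  set τ : ℕ → ℕ := fun j => 2 ^ (a - j - 2 - κ) with hτ
  set hi : ℕ → ℕ := fun j => 2 ^ (a - 1 - j) with hhi
  set lo : ℕ → ℕ := fun j => 2 ^ (a - 3 - j) with hlo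
  set I := ideal G O A hi lo with hI
  -- Both inclusions are proved together, as each one feeds the other. A vertex of `O` with many
  -- ideal neighbours outside `O` sees enough of them in its colour, and they are still present. A
  -- vertex outside `O` has only neighbours in `O`; those still present are ideal ones, and too few
  -- of them share its colour.
  have sandwich : ∀ j ≤ J, peel G γ τ A j ∩ O ⊆ (I j).1 ∧ (I j).2 ⊆ peel G γ τ A j := by
    intro j
    induction j with
    | zero => intro _; exact ⟨subset_rfl, Finset.sdiff_subset⟩
    | succ j ih =>
      intro hj
      obtain ⟨ih1, ih2⟩ := ih (by omega)
      constructor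
      · intro v hv
        obtain ⟨hv1, hvO⟩ := Finset.mem_inter.1 hv
        obtain ⟨hv1, hv2⟩ := Finset.mem_filter.1 hv1
        refine Finset.mem_filter.2 ⟨ih1 (Finset.mem_inter.2 ⟨hv1, hvO⟩), ?_⟩
        by_contra hcon
        have := hgood.lower _ (hγ v) j (by omega) v (not_lt.1 hcon)
        refine absurd (this.trans (Finset.card_le_card ?_)) (not_le.2 hv2)
        exact Finset.filter_subset_filter _ (nbrs_mono ih2 v)
      · intro v hv
        obtain ⟨hv1, hv2⟩ := Finset.mem_filter.1 hv
        refine Finset.mem_filter.2 ⟨ih2 hv1, ?_⟩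
        have hvA := Finset.mem_sdiff.1 (ideal_snd_subset O A hi lo j hv1)
        refine lt_of_le_of_lt (Finset.card_le_card ?_) (hgood.upper _ (hγ v) j (by omega) v hv2)
        refine Finset.filter_subset_filter _ fun u hu => ?_
        have h1 := (hO.mono (peel_subset γ τ A j)).nbrs_subset (ih2 hv1) hvA.2 hu
        exact mem_nbrs.2 ⟨ih1 h1, (mem_nbrs.1 hu).2⟩
  have hbound : ∀ j ≤ J, ∀ u ∈ (I j).1, #(nbrs G (I j).2 u) ≤ 2 ^ (a - j) := by
    intro j hj u hu
    rcases j with _ | j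
    · refine (Finset.card_le_card (nbrs_mono Finset.sdiff_subset u)).trans ?_
      exact (hdeg u (Finset.mem_inter.1 hu).1).le
    · refine (Finset.card_le_card (nbrs_mono (ideal_snd_succ_subset O A hi lo j) u)).trans ?_
      refine (Finset.mem_filter.1 hu).2.le.trans (le_of_eq ?_)
      simp only [hhi]
      congr 1; omega
  have hstep : ∀ j < J, #((I j).2 \ (I (j + 1)).2) ≤ 8 * #O := by
    intro j hj
    have h := card_mul_le_of_nbrs (G := G) (Z := (I j).2 \ (I (j + 1)).2) (m := lo j)
      (hbound j hj.le) Finset.sdiff_subset (fun v hv => by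
        obtain ⟨hv1, hv2⟩ := Finset.mem_sdiff.1 hv
        by_contra hcon
        exact hv2 (Finset.mem_filter.2 ⟨hv1, not_le.1 hcon⟩))
    have h2 : #(I j).1 ≤ #O := Finset.card_le_card
      ((ideal_fst_subset O A hi lo j).trans Finset.inter_subset_right)
    have h3 : 2 ^ (a - j) = 8 * lo j := by
      rw [show (8 : ℕ) = 2 ^ 3 by norm_num, ← pow_add]
      congr 1; omega
    rw [h3] at h
    refine Nat.le_of_mul_le_mul_right (c := lo j) ?_ (Nat.two_pow_pos _)
    calc _ ≤ _ := h
      _ ≤ #O * (8 * lo j) := Nat.mul_le_mul_right _ h2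
      _ = _ := by ring
  have htotal : ∀ j ≤ J, #((A \ O) \ (I j).2) ≤ 8 * j * #O := by
    intro j
    induction j with
    | zero =>
      intro _
      have : (A \ O) \ (I 0).2 = ∅ := Finset.sdiff_self _
      rw [this]; simp
    | succ j ih =>
      intro hj
      have h1 : (A \ O) \ (I (j + 1)).2 ⊆ ((A \ O) \ (I j).2) ∪ ((I j).2 \ (I (j + 1)).2) := by
        intro v; simp only [Finset.mem_sdiff, Finset.mem_union]; tauto
      have := Finset.card_le_card h1
      have h3 := Finset.card_union_le ((A \ O) \ (I j).2) ((I j).2 \ (I (j + 1)).2)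
      have h4 := ih (by omega)
      have h5 := hstep j (by omega)
      have h6 : 8 * (j + 1) * #O = 8 * j * #O + 8 * #O := by ring
      omega
  have hlast : #((I J).2 \ thresh G (2 ^ (a - J)) (peel G γ τ A J)) ≤ #O := by
    obtain ⟨hs1, hs2⟩ := sandwich J le_rfl
    have h := card_thresh_removed_le (O := O) (A := peel G γ τ A J) (X := (I J).2)
      (θ := 2 ^ (a - J)) (M := 2 ^ (a - J)) (hO.mono (peel_subset _ _ _ _))
      (fun v hv => Finset.mem_sdiff.2
        ⟨hs2 hv, (Finset.mem_sdiff.1 (ideal_snd_subset O A hi lo J hv)).2⟩)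
      (fun u hu => hbound J le_rfl u (hs1 hu))
    exact Nat.le_of_mul_le_mul_right h (Nat.two_pow_pos _)
  have hsub : (A \ thresh G (2 ^ (a - J)) (peel G γ τ A J)) \ O ⊆
      ((A \ O) \ (I J).2) ∪ ((I J).2 \ thresh G (2 ^ (a - J)) (peel G γ τ A J)) := by
    intro v; simp only [Finset.mem_sdiff, Finset.mem_union]; tauto
  have h1 := Finset.card_le_card hsub
  have h2 := Finset.card_union_le ((A \ O) \ (I J).2)
    ((I J).2 \ thresh G (2 ^ (a - J)) (peel G γ τ A J))
  have h3 := htotal J le_rfl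
  have h4 : (8 * J + 1) * #O = 8 * J * #O + #O := by ring
  omega

theorem card_le_of_forall_exists_mem {Ω ι : Type*} [Fintype ι] (s : Finset Ω)
    (E : ι → Finset Ω) (δ : ℝ) (hs : ∀ ω ∈ s, ∃ i, ω ∈ E i) (h : ∀ i, (#(E i) : ℝ) ≤ δ) :
    (#s : ℝ) ≤ Fintype.card ι * δ := by
  classical
  have h1 : s ⊆ Finset.univ.biUnion E := by
    intro ω hω
    simpa using hs ω hω
  calc (#s : ℝ) ≤ ((∑ i, #(E i) : ℕ) : ℝ) := by
        exact_mod_cast (Finset.card_le_card h1).trans Finset.card_biUnion_le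
    _ ≤ Fintype.card ι * δ := by
        rw [Nat.cast_sum, ← Finset.card_univ, ← nsmul_eq_mul]
        exact Finset.sum_le_card_nsmul _ _ _ fun i _ => h i

open Classical in
-- A union bound over colours, vertices and steps. The sets whose hits are counted are fixed before
-- `γ` is drawn. With `J = a - κ - l` every threshold is at least `2 ^ (l - 1)`, so each event has
-- at most the same weight `δ`. The terms `1`, `card V` and two times `card V * J` in the count
-- belong to the four fields of `GoodColoring`.
theorem card_not_good_le (O A : Finset V) {a a₀ κ l : ℕ} (hl : 2 ≤ l) (ha : κ + l < a)
    (haa : a ≤ a₀) (hV : Fintype.card V ≤ 2 ^ a₀) :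
    (#{γ : V → Fin (2 ^ κ) |
        ¬ GoodColoring G O A a κ (a - κ - l) (2 * 2 ^ (a₀ - κ)) fun v => γ v} : ℝ) ≤
      2 ^ κ * (1 + Fintype.card V * (2 * a + 1)) * (5 / 6) ^ 2 ^ (l - 1) *
        Fintype.card (V → Fin (2 ^ κ)) := by
  set I := ideal G O A (fun j => 2 ^ (a - 1 - j)) (fun j => 2 ^ (a - 3 - j)) with hI
  set δ : ℝ := (5 / 6) ^ 2 ^ (l - 1) * Fintype.card (V → Fin (2 ^ κ)) with hδ
  have hcard : (Fintype.card (V → Fin (2 ^ κ)) : ℝ) =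
      (Fintype.card (Fin (2 ^ κ)) : ℝ) ^ Fintype.card V := by
    rw [Fintype.card_fun]; push_cast; rfl
  have hpow : ∀ e, l - 1 ≤ e → (5 / 6 : ℝ) ^ 2 ^ e * Fintype.card (V → Fin (2 ^ κ)) ≤ δ := by
    intro e he
    rw [hδ]
    gcongr ?_ * _
    exact pow_le_pow_of_le_one (by norm_num) (by norm_num) (Nat.pow_le_pow_right (by norm_num) he)
  have up : ∀ (S : Finset V) (c : Fin (2 ^ κ)) (e : ℕ), l - 1 ≤ e → 2 * #S ≤ 2 ^ e * 2 ^ κ →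
      (#{γ : V → Fin (2 ^ κ) | 2 ^ e ≤ #{u ∈ S | (γ u : ℕ) = c}} : ℝ) ≤ δ := by
    intro S c e he hS
    refine le_trans ?_ (hpow e he)
    rw [hcard]
    refine le_trans (le_of_eq ?_) (chernoff_upper S {c} (2 ^ e) (by simpa using hS))
    simp [Fin.ext_iff]
  have low : ∀ (S : Finset V) (c : Fin (2 ^ κ)) (e : ℕ), l - 1 ≤ e → 2 * 2 ^ e * 2 ^ κ ≤ #S →
      (#{γ : V → Fin (2 ^ κ) | #{u ∈ S | (γ u : ℕ) = c} < 2 ^ e} : ℝ) ≤ δ := by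
    intro S c e he hS
    refine le_trans ?_ (hpow e he)
    rw [hcard]
    refine le_trans (le_of_eq ?_) (chernoff_lower S {c} (2 ^ e) (by simpa using hS))
    simp [Fin.ext_iff]
  have hδ0 : 0 ≤ δ := by positivity
  have zero_le : (#(∅ : Finset (V → Fin (2 ^ κ))) : ℝ) ≤ δ := by simpa using hδ0
  set J := a - κ - l with hJ
  let E1 : Fin (2 ^ κ) → Finset (V → Fin (2 ^ κ)) := fun c =>
    {γ : V → Fin (2 ^ κ) | 2 ^ (a₀ - κ + 1) ≤ #{u ∈ Finset.univ | (γ u : ℕ) = c}}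
  let E2 : Fin (2 ^ κ) × V → Finset (V → Fin (2 ^ κ)) := fun q =>
    if #(nbrs G A q.2) < 2 ^ a then
      (Finset.univ.filter fun γ : V → Fin (2 ^ κ) =>
        2 ^ (a - κ + 1) ≤ #{u ∈ nbrs G A q.2 | (γ u : ℕ) = q.1}) else ∅
  let E3 : Fin (2 ^ κ) × V × Fin J → Finset (V → Fin (2 ^ κ)) := fun q =>
    if 2 ^ (a - 1 - q.2.2) ≤ #(nbrs G (I q.2.2).2 q.2.1) then
      (Finset.univ.filter fun γ : V → Fin (2 ^ κ) =>
        #{u ∈ nbrs G (I q.2.2).2 q.2.1 | (γ u : ℕ) = q.1} < 2 ^ (a - q.2.2 - 2 - κ)) else ∅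
  let E4 : Fin (2 ^ κ) × V × Fin J → Finset (V → Fin (2 ^ κ)) := fun q =>
    if #(nbrs G (I q.2.2).1 q.2.1) < 2 ^ (a - 3 - q.2.2) then
      (Finset.univ.filter fun γ : V → Fin (2 ^ κ) =>
        2 ^ (a - q.2.2 - 2 - κ) ≤ #{u ∈ nbrs G (I q.2.2).1 q.2.1 | (γ u : ℕ) = q.1}) else ∅
  have b1 : ∀ c, (#(E1 c) : ℝ) ≤ δ := by
    refine fun c => up _ _ _ (by omega) ?_
    rw [← pow_add, Finset.card_univ, show a₀ - κ + 1 + κ = a₀ + 1 by omega, pow_succ]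
    omega
  have b2 : ∀ q, (#(E2 q) : ℝ) ≤ δ := by
    intro q
    simp only [E2]
    split_ifs with h
    · refine up _ _ _ (by omega) ?_
      rw [← pow_add, show a - κ + 1 + κ = a + 1 by omega, pow_succ]
      omega
    · exact zero_le
  -- The expected number of hits is at least `2 ^ (a - 1 - j - κ)`, twice the threshold; in `b4` it
  -- is less than half the same threshold. The gap between the high and the low ideal threshold
  -- provides exactly these two factors.
  have b3 : ∀ q, (#(E3 q) : ℝ) ≤ δ := by
    intro q
    have hc := q.2.2.2
    simp only [E3]
    split_ifs with h
    · refine low _ _ _ (by omega) (le_trans (le_of_eq ?_) h)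
      rw [mul_assoc, ← pow_add, ← pow_succ']
      congr 1; omega
    · exact zero_le
  have b4 : ∀ q, (#(E4 q) : ℝ) ≤ δ := by
    intro q
    have hc := q.2.2.2
    simp only [E4]
    split_ifs with h
    · refine up _ _ _ (by omega) ?_
      rw [← pow_add, show a - q.2.2 - 2 - κ + κ = (a - 3 - q.2.2) + 1 by omega, pow_succ]
      omega
    · exact zero_le
  have key := card_le_of_forall_exists_mem ({γ : V → Fin (2 ^ κ) |
        ¬ GoodColoring G O A a κ J (2 * 2 ^ (a₀ - κ)) fun v => γ v} : Finset _)
    (Sum.elim E1 (Sum.elim E2 (Sum.elim E3 E4))) δ ?_ ?_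
  · refine key.trans ?_
    simp only [Fintype.card_sum, Fintype.card_prod, Fintype.card_fin]
    push_cast
    have hJa : (J : ℝ) ≤ a := by exact_mod_cast (by omega : J ≤ a)
    calc _ = (2 : ℝ) ^ κ * (1 + Fintype.card V * (2 * J + 1)) * δ := by ring
      _ ≤ (2 : ℝ) ^ κ * (1 + Fintype.card V * (2 * a + 1)) * δ := by gcongr
      _ = _ := by rw [hδ]; ring
  · intro γ hγ
    by_contra hcon
    simp only [Sum.exists, Sum.elim_inl, Sum.elim_inr, not_or, not_exists] at hcon
    obtain ⟨h1, h2, h3, h4⟩ := hcon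
    rw [Finset.mem_filter] at hγ
    refine hγ.2 ⟨?_, ?_, ?_, ?_⟩
    · intro c hc
      have := h1 ⟨c, hc⟩
      simp only [E1, Finset.mem_filter, Finset.mem_univ, true_and, not_le] at this
      rw [pow_succ] at this
      exact (this.le.trans (le_of_eq (by ring)))
    · intro c hc v hv
      have := h2 (⟨c, hc⟩, v)
      simp only [E2, if_pos hv, Finset.mem_filter, Finset.mem_univ, true_and, not_le] at this
      rw [pow_succ] at this
      exact (this.le.trans (le_of_eq (by ring)))
    · intro c hc j hj v hv
      have := h3 (⟨c, hc⟩, v, ⟨j, hj⟩)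
      simp only [E3, hI] at this
      rw [if_pos hv] at this
      simpa only [Finset.mem_filter, Finset.mem_univ, true_and, not_lt] using this
    · intro c hc j hj v hv
      have := h4 (⟨c, hc⟩, v, ⟨j, hj⟩)
      simp only [E4, hI] at this
      rw [if_pos hv] at this
      simpa only [Finset.mem_filter, Finset.mem_univ, true_and, not_le] using this
  · rintro (c | q | q | q)
    · exact b1 c
    · exact b2 q
    · exact b3 q
    · exact b4 q

end Peeling

/-! ### The schedule of degree bounds and the outcome of all phases. -/

/-- The binary logarithm of the number of colours in a phase with maximum degree `2 ^ a`. -/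
def colorExp (d a : ℕ) : ℕ := (a + d + 11) / 2

/-- The binary logarithm of the degree bound after `i` phases. -/
def degExp (a₀ d l : ℕ) : ℕ → ℕ
  | 0 => a₀
  | i + 1 =>
    if colorExp d (degExp a₀ d l i) + l < degExp a₀ d l i then colorExp d (degExp a₀ d l i) + l
    else degExp a₀ d l i

theorem degExp_succ_le_self (a₀ d l i : ℕ) : degExp a₀ d l (i + 1) ≤ degExp a₀ d l i := by
  rw [degExp]; split_ifs <;> omega

theorem degExp_le (a₀ d l i : ℕ) : degExp a₀ d l i ≤ a₀ := by
  induction i with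
  | zero => exact le_rfl
  | succ i ih => exact (degExp_succ_le_self _ _ _ _).trans ih

/-- With `c = d + 11 + 2 * l`, a phase takes the exponent `e` to at most `(e + c) / 2`, a
contraction towards `c`. When the phase is skipped, `e` is already below this value. -/
theorem degExp_le_add_div (a₀ d l i : ℕ) :
    degExp a₀ d l i ≤ d + 11 + 2 * l + a₀ / 2 ^ i := by
  induction i with
  | zero => simp [degExp]
  | succ i ih =>
    have h : degExp a₀ d l (i + 1) ≤ (degExp a₀ d l i + (d + 11 + 2 * l)) / 2 := by
      rw [degExp, colorExp]; split_ifs <;> omega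
    have h2 : a₀ / 2 ^ (i + 1) = a₀ / 2 ^ i / 2 := by rw [pow_succ, Nat.div_div_eq_div_mul]
    omega

section Outcome

variable {V : Type*} [Fintype V] [DecidableEq V] (G : SimpleGraph V) (a₀ d l : ℕ)

/-- The vertices that are left after `i` phases with the colourings `γ 0, …, γ (i - 1)`. -/
noncomputable def aliveAt (γ : ℕ → V → ℕ) : ℕ → Finset V
  | 0 => Finset.univ
  | i + 1 =>
    if colorExp d (degExp a₀ d l i) + l < degExp a₀ d l i then
      phase G (degExp a₀ d l i) (colorExp d (degExp a₀ d l i))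
        (degExp a₀ d l i - colorExp d (degExp a₀ d l i) - l)
        (2 * 2 ^ (a₀ - colorExp d (degExp a₀ d l i))) (γ i) (aliveAt γ i)
    else aliveAt γ i

/-- The vertices that are left after `j` exact peeling steps that begin with maximum degree
`2 ^ a`. -/
noncomputable def directAt (a : ℕ) (A : Finset V) : ℕ → Finset V
  | 0 => A
  | j + 1 => thresh G (2 ^ (a - 1 - j)) (directAt a A j)

/-- The vertices outside the computed vertex cover. -/
noncomputable def survivors (T : ℕ) (γ : ℕ → V → ℕ) : Finset V :=
  directAt G (degExp a₀ d l T) (aliveAt G a₀ d l γ T) (degExp a₀ d l T)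

variable {G a₀ d l}

theorem aliveAt_congr {γ γ' : ℕ → V → ℕ} {i : ℕ} (h : ∀ j < i, γ j = γ' j) :
    aliveAt G a₀ d l γ i = aliveAt G a₀ d l γ' i := by
  induction i with
  | zero => rfl
  | succ i ih => rw [aliveAt, aliveAt, ih fun j hj => h j (hj.trans i.lt_succ_self),
      h i i.lt_succ_self]

/-- Valid for every sequence of colourings, because each executed phase ends with an exact
threshold. Hence bad colourings affect only the size of the cover and not its feasibility. -/
theorem aliveAt_deg_lt (hV : Fintype.card V ≤ 2 ^ a₀) (γ : ℕ → V → ℕ) (i : ℕ) :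
    ∀ v ∈ aliveAt G a₀ d l γ i, #(nbrs G (aliveAt G a₀ d l γ i) v) < 2 ^ degExp a₀ d l i := by
  induction i with
  | zero =>
    intro v _
    refine lt_of_lt_of_le ?_ hV
    rw [← Finset.card_univ]
    refine Finset.card_lt_card (Finset.ssubset_univ_iff.2 fun h => ?_)
    have := h ▸ Finset.mem_univ v
    exact G.loopless.irrefl v (mem_nbrs.1 this).2
  | succ i ih =>
    by_cases h : colorExp d (degExp a₀ d l i) + l < degExp a₀ d l i
    · simp only [aliveAt, degExp, if_pos h]
      intro v hv
      have h2 : degExp a₀ d l i - (degExp a₀ d l i - colorExp d (degExp a₀ d l i) - l) =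
        colorExp d (degExp a₀ d l i) + l := by omega
      unfold phase at hv ⊢
      rw [h2] at hv ⊢
      exact card_nbrs_thresh_lt _ _ v hv
    · simp only [aliveAt, degExp, if_neg h]
      exact ih

theorem directAt_deg_lt {a : ℕ} {A : Finset V} (hA : ∀ v ∈ A, #(nbrs G A v) < 2 ^ a) (j : ℕ) :
    ∀ v ∈ directAt G a A j, #(nbrs G (directAt G a A j) v) < 2 ^ (a - j) := by
  rcases j with _ | j
  · exact hA
  · intro v hv
    have := card_nbrs_thresh_lt _ _ v hv
    rwa [show a - (j + 1) = a - 1 - j by omega]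

theorem directAt_subset (a : ℕ) (A : Finset V) (j : ℕ) : directAt G a A j ⊆ A := by
  induction j with
  | zero => exact subset_rfl
  | succ j ih => exact (thresh_subset _ _).trans ih

theorem card_directAt_removed_le {O A : Finset V} {a : ℕ} (hO : CoversIn G O A)
    (hA : ∀ v ∈ A, #(nbrs G A v) < 2 ^ a) (j : ℕ) (hj : j ≤ a) :
    #((A \ directAt G a A j) \ O) ≤ 2 * j * #O := by
  induction j with
  | zero => simp [directAt]
  | succ j ih =>
    have h1 : (A \ directAt G a A (j + 1)) \ O ⊆ ((A \ directAt G a A j) \ O) ∪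
        ((directAt G a A j \ directAt G a A (j + 1)) \ O) := by
      intro v; simp only [Finset.mem_sdiff, Finset.mem_union]; tauto
    have h2 := (Finset.card_le_card h1).trans (Finset.card_union_le _ _)
    have h3 : #((directAt G a A j \ directAt G a A (j + 1)) \ O) ≤ 2 * #O := by
      refine card_direct_removed_le (hO.mono (directAt_subset _ _ _)) fun v hv => ?_
      have := directAt_deg_lt hA j v hv
      rwa [show a - 1 - j + 1 = a - j by omega]
    have h4 := ih (by omega)
    have h5 : 2 * (j + 1) * #O = 2 * j * #O + 2 * #O := by ring
    omega

/-- The number of steps in a phase is the decrease of the exponent, so the costs `8 * J + 1`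
telescope to `8` per unit of decrease and `1` per phase. -/
theorem card_aliveAt_removed_le {O : Finset V} (hO : CoversIn G O Finset.univ) (hl : 2 ≤ l)
    (hV : Fintype.card V ≤ 2 ^ a₀) (γ : ℕ → V → ℕ) (i : ℕ)
    (hγ : ∀ j < i, ∀ v, γ j v < 2 ^ colorExp d (degExp a₀ d l j))
    (hgood : ∀ j < i, colorExp d (degExp a₀ d l j) + l < degExp a₀ d l j →
      GoodColoring G O (aliveAt G a₀ d l γ j) (degExp a₀ d l j) (colorExp d (degExp a₀ d l j))
        (degExp a₀ d l j - colorExp d (degExp a₀ d l j) - l)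
        (2 * 2 ^ (a₀ - colorExp d (degExp a₀ d l j))) (γ j)) :
    #((Finset.univ \ aliveAt G a₀ d l γ i) \ O) ≤ (8 * (a₀ - degExp a₀ d l i) + i) * #O := by
  induction i with
  | zero => simp [aliveAt]
  | succ i ih =>
    have ih := ih (fun j hj => hγ j (by omega)) (fun j hj => hgood j (by omega))
    by_cases h : colorExp d (degExp a₀ d l i) + l < degExp a₀ d l i
    · have h3 := card_phase_removed_le (G := G) (O := O) (by omega) (hγ i i.lt_succ_self)
        (hO.mono (Finset.subset_univ _)) (aliveAt_deg_lt hV γ i) (hgood i i.lt_succ_self h)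
      have hle := degExp_le a₀ d l i
      simp only [aliveAt, degExp, if_pos h]
      set A' := phase G (degExp a₀ d l i) (colorExp d (degExp a₀ d l i))
        (degExp a₀ d l i - colorExp d (degExp a₀ d l i) - l)
        (2 * 2 ^ (a₀ - colorExp d (degExp a₀ d l i))) (γ i) (aliveAt G a₀ d l γ i)
      have h1 : (Finset.univ \ A') \ O ⊆ ((Finset.univ \ aliveAt G a₀ d l γ i) \ O) ∪
          ((aliveAt G a₀ d l γ i \ A') \ O) := by
        intro v; simp only [Finset.mem_sdiff, Finset.mem_union]; tauto
      have h2 := (Finset.card_le_card h1).trans (Finset.card_union_le _ _)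
      refine h2.trans ((add_le_add ih h3).trans ?_)
      rw [← add_mul]
      exact Nat.mul_le_mul_right _ (by omega)
    · simp only [aliveAt, degExp, if_neg h]
      exact ih.trans (Nat.mul_le_mul_right _ (by omega))

theorem survivors_no_edges (hV : Fintype.card V ≤ 2 ^ a₀) (T : ℕ) (γ : ℕ → V → ℕ) {v u : V}
    (hv : v ∈ survivors G a₀ d l T γ) (hu : u ∈ survivors G a₀ d l T γ) : ¬ G.Adj v u := by
  intro h
  have := directAt_deg_lt (aliveAt_deg_lt (G := G) (d := d) (l := l) hV γ T) _ v hv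
  rw [Nat.sub_self, pow_zero, Nat.lt_one_iff, Finset.card_eq_zero] at this
  exact Finset.notMem_empty u (this ▸ mem_nbrs.2 ⟨hu, h⟩)

/-- The removed vertices are charged to `O` itself, to the phases at `8` per unit of the exponent,
and to the final exact steps at only `2` per unit; an extra `1` per phase gives `T`. -/
theorem card_compl_survivors_le {O : Finset V} (hO : CoversIn G O Finset.univ) (hl : 2 ≤ l)
    (hV : Fintype.card V ≤ 2 ^ a₀) (T : ℕ) (γ : ℕ → V → ℕ)
    (hγ : ∀ j < T, ∀ v, γ j v < 2 ^ colorExp d (degExp a₀ d l j))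
    (hgood : ∀ j < T, colorExp d (degExp a₀ d l j) + l < degExp a₀ d l j →
      GoodColoring G O (aliveAt G a₀ d l γ j) (degExp a₀ d l j) (colorExp d (degExp a₀ d l j))
        (degExp a₀ d l j - colorExp d (degExp a₀ d l j) - l)
        (2 * 2 ^ (a₀ - colorExp d (degExp a₀ d l j))) (γ j)) :
    #(survivors G a₀ d l T γ)ᶜ ≤ (8 * a₀ + T + 1) * #O := by
  have h1 := card_aliveAt_removed_le hO hl hV γ T hγ hgood
  have h2 := card_directAt_removed_le (hO.mono (Finset.subset_univ _))
    (aliveAt_deg_lt (G := G) (d := d) (l := l) hV γ T) _ le_rfl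
  have h3 : (survivors G a₀ d l T γ)ᶜ ⊆ O ∪ (((Finset.univ \ aliveAt G a₀ d l γ T) \ O) ∪
      ((aliveAt G a₀ d l γ T \ survivors G a₀ d l T γ) \ O)) := by
    intro v
    simp only [Finset.mem_compl, Finset.mem_sdiff, Finset.mem_union, Finset.mem_univ, true_and]
    tauto
  have h4 := (Finset.card_le_card h3).trans ((Finset.card_union_le _ _).trans
    (Nat.add_le_add_left (Finset.card_union_le _ _) _))
  refine h4.trans ((Nat.add_le_add_left (add_le_add h1 h2) _).trans ?_)
  have := degExp_le a₀ d l T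
  calc _ = (1 + (8 * (a₀ - degExp a₀ d l T) + T) + 2 * degExp a₀ d l T) * #O := by ring
    _ ≤ _ := Nat.mul_le_mul_right _ (by omega)

/-- The colourings used by the phases. -/
abbrev Colorings (V : Type*) (a₀ d l T : ℕ) : Type _ :=
  ∀ i : Fin T, V → Fin (2 ^ colorExp d (degExp a₀ d l i))

/-- Colours as natural numbers. -/
def Colorings.nat {T : ℕ} (ω : Colorings V a₀ d l T) (i : ℕ) (v : V) : ℕ :=
  if h : i < T then ω ⟨i, h⟩ v else 0

theorem Colorings.nat_lt {T : ℕ} (ω : Colorings V a₀ d l T) (i : ℕ) (v : V) :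
    ω.nat i v < 2 ^ colorExp d (degExp a₀ d l i) := by
  unfold Colorings.nat
  split_ifs with h
  · exact (ω ⟨i, h⟩ v).2
  · positivity

open Classical in
-- The failure `E i` of phase `i` concerns the set alive before it, which is determined by the
-- earlier colourings. With all coordinates but `i` fixed, this set is fixed and the bound for one
-- uniform colouring applies; then come a union bound over the phases and `card_compl_survivors_le`.
theorem card_bad_colorings_le {O : Finset V} (hO : CoversIn G O Finset.univ) (hl : 2 ≤ l)
    (hV : Fintype.card V ≤ 2 ^ a₀) (n T : ℕ)
    (hnum : (2 * n * T : ℝ) * (2 ^ a₀ * (1 + Fintype.card V * (2 * a₀ + 1)) *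
      (5 / 6) ^ 2 ^ (l - 1)) ≤ 1) :
    2 * n * #{ω : Colorings V a₀ d l T |
      ¬ #(survivors G a₀ d l T ω.nat)ᶜ ≤ (8 * a₀ + T + 1) * #O} ≤
      Fintype.card (Colorings V a₀ d l T) := by
  let E : Fin T → Colorings V a₀ d l T → Prop := fun i ω =>
    colorExp d (degExp a₀ d l i) + l < degExp a₀ d l i ∧
      ¬ GoodColoring G O (aliveAt G a₀ d l ω.nat i) (degExp a₀ d l i)
        (colorExp d (degExp a₀ d l i)) (degExp a₀ d l i - colorExp d (degExp a₀ d l i) - l)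
        (2 * 2 ^ (a₀ - colorExp d (degExp a₀ d l i))) fun v => ω i v
  have hE : ∀ i, 2 * n * T * #{ω | E i ω} ≤ Fintype.card (Colorings V a₀ d l T) := by
    intro i
    refine card_pi_le_of_update (E i) i (2 * n * T) fun (ω : Colorings V a₀ d l T) => ?_
    by_cases h : colorExp d (degExp a₀ d l i) + l < degExp a₀ d l i
    · have hA : ∀ x, aliveAt G a₀ d l (Colorings.nat (Function.update ω i x)) i =
          aliveAt G a₀ d l ω.nat i := by
        intro x
        refine aliveAt_congr fun j hj => ?_
        funext v
        unfold Colorings.nat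
        split_ifs with h2
        · rw [Function.update_of_ne]
          intro h3
          rw [← h3] at hj
          exact lt_irrefl _ hj
        · rfl
      simp only [E, h, true_and, hA, Function.update_self]
      have hb := card_not_good_le (G := G) O (aliveAt G a₀ d l ω.nat i) hl h
        (degExp_le a₀ d l i) hV
      have ha : (degExp a₀ d l i : ℝ) ≤ a₀ := by exact_mod_cast degExp_le a₀ d l i
      have hk : (2 : ℝ) ^ colorExp d (degExp a₀ d l i) ≤ 2 ^ a₀ := by
        apply pow_le_pow_right₀ (by norm_num)
        have := degExp_le a₀ d l i
        omega
      have hfin := (mul_le_mul_of_nonneg_left hb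
        (show (0 : ℝ) ≤ ((2 * n * T : ℕ) : ℝ) by positivity)).trans
          (b := ((2 * n * T : ℕ) : ℝ) * _)
          (c := 1 * (Fintype.card (V → Fin (2 ^ colorExp d (degExp a₀ d l i))) : ℝ)) (by
        rw [← mul_assoc]
        gcongr ?_ * _
        refine le_trans ?_ hnum
        push_cast
        gcongr)
      rw [one_mul] at hfin
      exact_mod_cast hfin
    · simp [E, h]
  -- The union bound is compared after multiplication by `T`, so zero phases are treated apart; then
  -- no colouring is bad.
  rcases Nat.eq_zero_or_pos T with rfl | hT
  · have : ({ω : Colorings V a₀ d l 0 |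
      ¬ #(survivors G a₀ d l 0 ω.nat)ᶜ ≤ (8 * a₀ + 0 + 1) * #O} : Finset _) = ∅ := by
      refine Finset.filter_false_of_mem fun ω _ => not_not.2 ?_
      exact card_compl_survivors_le hO hl hV 0 _ (fun j hj => absurd hj (Nat.not_lt_zero j))
        (fun j hj => absurd hj (Nat.not_lt_zero j))
    rw [this]; simp
  · have hsub : ({ω : Colorings V a₀ d l T |
        ¬ #(survivors G a₀ d l T ω.nat)ᶜ ≤ (8 * a₀ + T + 1) * #O} : Finset _) ⊆
        Finset.univ.biUnion fun i => {ω | E i ω} := by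
      intro ω hω
      by_contra hcon
      rw [Finset.mem_filter] at hω
      refine hω.2 (card_compl_survivors_le hO hl hV T _ (fun j _ v => ω.nat_lt j v) ?_)
      intro j hj hlt
      by_contra hbad
      refine hcon (Finset.mem_biUnion.2 ⟨⟨j, hj⟩, Finset.mem_univ _,
        Finset.mem_filter.2 ⟨Finset.mem_univ _, hlt, ?_⟩⟩)
      convert hbad using 2
      funext v
      simp [Colorings.nat, hj]
    have hc := (Finset.card_le_card hsub).trans Finset.card_biUnion_le
    refine le_of_mul_le_mul_left (a := T) ?_ hT
    calc _ ≤ T * (2 * n * ∑ i, #{ω | E i ω}) := by gcongr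
      _ = ∑ i, 2 * n * T * #{ω | E i ω} := by rw [← Finset.mul_sum]; ring
      _ ≤ ∑ _i : Fin T, Fintype.card (Colorings V a₀ d l T) := Finset.sum_le_sum fun i _ => hE i
      _ = _ := by simp

end Outcome

theorem exists_isVertexCover_card {n : ℕ} (G : SimpleGraph (Fin n)) :
    ∃ O : Finset (Fin n), CoversIn G O Finset.univ ∧ #O = G.vertexCoverNum.toNat := by
  classical
  obtain ⟨s, hs, hc⟩ := G.vertexCoverNum_exists
  refine ⟨s.toFinset, fun v _ u _ h => ?_, ?_⟩
  · simpa using hc h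
  · rw [← hs, Set.encard_eq_coe_toFinset_card, ENat.toNat_natCast]

open Classical in
/-- A short list of colourings that contains, for every graph, mostly good ones. -/
theorem exists_coloring_seeds {n a₀ d l T τ : ℕ} (hl : 2 ≤ l) (hn : n ≤ 2 ^ a₀)
    (hnum : (2 * n * T : ℝ) * (2 ^ a₀ * (1 + n * (2 * a₀ + 1)) * (5 / 6) ^ 2 ^ (l - 1)) ≤ 1)
    (hτ : (2 : ℝ) ^ (n * n) * (5 / 6) ^ τ < 1) :
    ∃ h : Fin (τ * n) → Colorings (Fin n) a₀ d l T, ∀ G : SimpleGraph (Fin n),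
      #{σ | ¬ #(survivors G a₀ d l T (h σ).nat)ᶜ ≤
        (8 * a₀ + T + 1) * G.vertexCoverNum.toNat} < τ := by
  -- Graphs are counted crudely as arbitrary relations.
  have hG : (Fintype.card (SimpleGraph (Fin n)) : ℝ) ≤ 2 ^ (n * n) := by
    have h1 : Fintype.card (SimpleGraph (Fin n)) ≤ Fintype.card (Fin n → Fin n → Prop) :=
      Fintype.card_le_of_injective (fun G => G.Adj) fun _ _ h => SimpleGraph.ext h
    have h2 : Fintype.card (Fin n → Fin n → Prop) = 2 ^ (n * n) := by
      simp [pow_mul]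
    exact_mod_cast h1.trans h2.le
  obtain ⟨h, hh⟩ := exists_seeds (fun G : SimpleGraph (Fin n) =>
      ({ω : Colorings (Fin n) a₀ d l T | ¬ #(survivors G a₀ d l T ω.nat)ᶜ ≤
        (8 * a₀ + T + 1) * G.vertexCoverNum.toNat} : Finset _)) n τ (fun G => by
    obtain ⟨O, hO, hcard⟩ := exists_isVertexCover_card G
    rw [← hcard]
    exact card_bad_colorings_le hO hl (by simpa using hn) n T (by simpa using hnum))
    (lt_of_le_of_lt (by gcongr) hτ)
  exact ⟨h, fun G => by simpa using hh G⟩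

/-! ### Rounds of communication in terms of what the machines can know. -/

namespace MPC

variable {I δ : Type} {p : ℕ}

/-- A family of instances, indexed by `I`, of a problem for `p` machines with a memory of `s` words,
numbers below `W`: in the instance `a`, machine `i` is given the data `given a i`. -/
structure Env (I : Type) (p : ℕ) (δ : Type) where
  W : ℕ
  s : ℕ
  given : I → Fin p → δ

/-- Each machine can compute its value of `y` from its value of `x`. -/
def Det {α β : Type} (x : I → Fin p → α) (y : I → Fin p → β) : Prop :=
  ∀ i a b, x a i = x b i → y a i = y b i

section Det

variable {α β γ : Type} {x : I → Fin p → α} {y : I → Fin p → β} {z : I → Fin p → γ}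

theorem Det.refl (x : I → Fin p → α) : Det x x := fun _ _ _ h => h

theorem Det.trans (h : Det x y) (h' : Det y z) : Det x z := fun i a b e => h' i a b (h i a b e)

theorem Det.pair (h : Det x y) (h' : Det x z) : Det x fun a i => (y a i, z a i) :=
  fun i a b e => Prod.ext (h i a b e) (h' i a b e)

theorem Det.fst : Det (fun a i => (x a i, y a i)) x := fun _ _ _ h => congrArg Prod.fst h

theorem Det.snd : Det (fun a i => (x a i, y a i)) y := fun _ _ _ h => congrArg Prod.snd h

/-- Local computation is unrestricted, so factoring through `x` is all that is needed; on values
that `x` never takes the function is arbitrary. -/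
theorem Det.exists_eq [Nonempty β] (h : Det x y) :
    ∃ g : Fin p → α → β, ∀ a i, y a i = g i (x a i) := by
  classical
  refine ⟨fun i v => if hv : ∃ a, x a i = v then y hv.choose i else Classical.arbitrary β,
    fun a i => ?_⟩
  have hv : ∃ b, x b i = x a i := ⟨a, rfl⟩
  simp only [dif_pos hv]
  exact (h i _ _ hv.choose_spec).symm

end Det

/-- On each machine `x` takes few enough values to be stored in `ℓ` words below `W`. -/
def Small (W ℓ : ℕ) {α : Type} (x : I → Fin p → α) : Prop :=
  ∀ i, ∃ e : I → Fin ℓ → Fin W, ∀ a b, e a = e b ↔ x a i = x b i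

section Small

variable {α β : Type} {x : I → Fin p → α} {y : I → Fin p → β} {W ℓ ℓ' : ℕ}

/-- A value of `y` is stored as the encoding of `x` in a representative instance with this value.
The representative depends on the value alone, so equal values get equal codes. -/
theorem Small.of_det (h : Small W ℓ x) (hxy : Det x y) : Small W ℓ y := by
  intro i
  obtain ⟨e, he⟩ := h i
  have ex : ∀ a, ∃ c, y c i = y a i := fun a => ⟨a, rfl⟩
  have aux : ∀ (v v' : β) (h : ∃ c, y c i = v) (h' : ∃ c, y c i = v'), v = v' →
      h.choose = h'.choose := by
    rintro v _ h h' rfl; rfl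
  refine ⟨fun a => e (ex a).choose, fun a b => ⟨fun hab => ?_, fun hab => ?_⟩⟩
  · rw [← (ex a).choose_spec, ← (ex b).choose_spec]
    exact hxy i _ _ ((he _ _).1 hab)
  · exact congrArg e (aux _ _ _ _ hab)

theorem Small.pair (h : Small W ℓ x) (h' : Small W ℓ' y) :
    Small W (ℓ + ℓ') fun a i => (x a i, y a i) := by
  intro i
  obtain ⟨e, he⟩ := h i
  obtain ⟨e', he'⟩ := h' i
  refine ⟨fun a => Fin.append (e a) (e' a), fun a b => ?_⟩
  rw [Prod.mk.injEq, ← he, ← he']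
  constructor
  · intro hab
    constructor
    · funext k
      have := congrFun hab (Fin.castAdd ℓ' k)
      simpa using this
    · funext k
      have := congrFun hab (Fin.natAdd ℓ k)
      simpa using this
  · rintro ⟨h1, h2⟩
    simp only [h1, h2]

theorem Small.of_card_le (R : Finset α) (hx : ∀ a i, x a i ∈ R) (hR : #R ≤ W ^ ℓ) :
    Small W ℓ x := by
  classical
  intro i
  have : Fintype.card R ≤ Fintype.card (Fin ℓ → Fin W) := by simpa using hR
  obtain ⟨f⟩ := Function.Embedding.nonempty_of_card_le this
  refine ⟨fun a => f ⟨x a i, hx a i⟩, fun a b => ?_⟩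
  rw [f.injective.eq_iff, Subtype.mk.injEq]

theorem Small.mono (h : Small W ℓ x) (hl : ℓ ≤ ℓ') (hW : 0 < W) : Small W ℓ' x := by
  intro i
  obtain ⟨e, he⟩ := h i
  refine ⟨fun a k => if hk : (k : ℕ) < ℓ then e a ⟨k, hk⟩ else ⟨0, hW⟩, fun a b => ?_⟩
  rw [← he]
  constructor
  · intro hab
    funext k
    simpa using congrFun hab (Fin.castLE hl k)
  · intro hab
    simp only [hab]

/-- The sets of at most `r` elements of a finite set. -/
theorem card_powerset_filter_card_le {β : Type*} [DecidableEq β] (R : Finset β) (r : ℕ) :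
    #{F ∈ R.powerset | #F ≤ r} ≤ (#R + 1) ^ r := by
  -- Lists of length `r` with `none` as padding represent all sets of at most `r` elements.
  let f : (Fin r → Option R) → Finset β :=
    fun g => (Finset.univ.image g).eraseNone.map (Function.Embedding.subtype _)
  have hsub : ({F ∈ R.powerset | #F ≤ r} : Finset (Finset β)) ⊆ Finset.univ.image f := by
    intro F hF
    obtain ⟨hF1, hF2⟩ := Finset.mem_filter.1 hF
    rw [Finset.mem_powerset] at hF1
    refine Finset.mem_image.2 ⟨fun k => if hk : (k : ℕ) < #F then
      some ⟨F.equivFin.symm ⟨k, hk⟩, hF1 (F.equivFin.symm ⟨k, hk⟩).2⟩ else none,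
      Finset.mem_univ _, ?_⟩
    ext v
    simp only [f, Finset.mem_map, Finset.mem_eraseNone, Finset.mem_image, Finset.mem_univ,
      true_and, Function.Embedding.coe_subtype, Subtype.exists, exists_and_right, exists_eq_right]
    constructor
    · rintro ⟨hv, k, hk⟩
      split_ifs at hk with hlt
      · simp only [Option.some.injEq, Subtype.mk.injEq] at hk
        rw [← hk]
        exact (F.equivFin.symm ⟨k, hlt⟩).2
    · intro hv
      refine ⟨hF1 hv, ⟨F.equivFin ⟨v, hv⟩, (F.equivFin ⟨v, hv⟩).2.trans_le hF2⟩, ?_⟩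
      simp
  refine (Finset.card_le_card hsub).trans (Finset.card_image_le.trans ?_)
  simp

theorem Small.of_finset {β : Type} {x : I → Fin p → Finset β} (R : Finset β) (r : ℕ)
    (hx : ∀ a i, x a i ⊆ R) (hr : ∀ a i, #(x a i) ≤ r) (hR : (#R + 1) ^ r ≤ W ^ ℓ) :
    Small W ℓ x := by
  classical
  refine Small.of_card_le {F ∈ R.powerset | #F ≤ r} (fun a i => ?_)
    ((card_powerset_filter_card_le R r).trans hR)
  exact Finset.mem_filter.2 ⟨Finset.mem_powerset.2 (hx a i), hr a i⟩

/-- The second word per element pays for sets with fewer than `r` elements: `W + 1 ≤ W ^ 2`. -/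
theorem Small.of_words {x : I → Fin p → Finset ℕ} {r : ℕ} (hW : 2 ≤ W)
    (hx : ∀ a i, ∀ w ∈ x a i, w < W) (hr : ∀ a i, #(x a i) ≤ r) : Small W (2 * r) x := by
  refine Small.of_finset (Finset.range W) r (fun a i w hw => Finset.mem_range.2 (hx a i w hw)) hr ?_
  rw [Finset.card_range, pow_mul]
  exact Nat.pow_le_pow_left (by nlinarith) _

theorem Small.of_lt {x : I → Fin p → ℕ} (hx : ∀ a i, x a i < W) : Small W 1 x :=
  Small.of_card_le (Finset.range W) (fun a i => Finset.mem_range.2 (hx a i)) (by simp)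

end Small

/-- A set of words, as a list. -/
noncomputable def wordList (W : ℕ) (F : Finset ℕ) : List (Fin W) :=
  (F.sort (· ≤ ·)).filterMap fun w => if h : w < W then some ⟨w, h⟩ else none

theorem length_wordList_le (W : ℕ) (F : Finset ℕ) : (wordList W F).length ≤ #F :=
  (List.length_filterMap_le _ _).trans (by simp)

theorem wordList_injOn {W : ℕ} {F F' : Finset ℕ} (hF : ∀ w ∈ F, w < W) (hF' : ∀ w ∈ F', w < W)
    (h : wordList W F = wordList W F') : F = F' := by
  have key : ∀ F : Finset ℕ, (∀ w ∈ F, w < W) →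
      ∀ w, w ∈ F ↔ ∃ c ∈ wordList W F, (c : ℕ) = w := by
    intro F hF w
    simp only [wordList, List.mem_filterMap, Finset.mem_sort]
    constructor
    · intro hw
      exact ⟨⟨w, hF w hw⟩, ⟨w, hw, by simp [hF w hw]⟩, rfl⟩
    · rintro ⟨c, ⟨v, hv, hvc⟩, rfl⟩
      rw [dif_pos (hF v hv), Option.some.injEq] at hvc
      rw [← hvc]
      exact hv
  ext w
  rw [key F hF, key F' hF', h]

namespace Env

variable (S : Env I p δ)

/-- The messages `M` respect the memory. -/
def Fits (M : I → Fin p → Fin p → List (Fin S.W)) : Prop :=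
  ∀ a i, ∑ j, (M a i j).length ≤ S.s ∧ ∑ j, (M a j i).length ≤ S.s

/-- The messages `M` can be sent in round `t`. -/
def Sends : ℕ → (I → Fin p → Fin p → List (Fin S.W)) → Prop
  | 0, M => S.Fits M ∧ Det S.given M
  | t + 1, M => S.Fits M ∧ ∃ M', Sends t M' ∧ Det (fun a i k => M' a k i) M

/-- After `t` rounds, each machine `i` can know `x a i` in the instance `a`. -/
def Reach (t : ℕ) {α : Type} (x : I → Fin p → α) : Prop :=
  match t with
  | 0 => Det S.given x
  | t + 1 => ∃ M, S.Sends t M ∧ Det (fun a i k => M a k i) x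

/-- After at most `T` rounds, each machine `i` can know `x a i` in the instance `a`. -/
def Know (T : ℕ) {α : Type} (x : I → Fin p → α) : Prop := ∃ t ≤ T, S.Reach t x

variable {S} {α β : Type} {x : I → Fin p → α} {y : I → Fin p → β}

theorem Reach.det {t : ℕ} (h : S.Reach t x) (hxy : Det x y) : S.Reach t y := by
  cases t with
  | zero => exact Det.trans h hxy
  | succ t =>
    obtain ⟨M, hM, hx⟩ := h
    exact ⟨M, hM, hx.trans hxy⟩

theorem Know.det {T : ℕ} (h : S.Know T x) (hxy : Det x y) : S.Know T y := by
  obtain ⟨t, ht, h⟩ := h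
  exact ⟨t, ht, h.det hxy⟩

theorem Know.mono {T T' : ℕ} (h : S.Know T x) (hT : T ≤ T') : S.Know T' x := by
  obtain ⟨t, ht, h⟩ := h
  exact ⟨t, ht.trans hT, h⟩

theorem Know.of_given (h : Det S.given x) : S.Know 0 x := ⟨0, le_rfl, h⟩

/-- One round: the machines keep `y` and send the sets `out` of words. -/
theorem Reach.round {t ℓ : ℕ} {out : I → Fin p → Fin p → Finset ℕ} (h : S.Reach t x)
    (hy : Det x y) (hout : Det x out) (hsmall : Small S.W ℓ y)
    (hw : ∀ a i j, ∀ w ∈ out a i j, w < S.W)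
    (hsend : ∀ a i, ℓ + ∑ j, #(out a i j) ≤ S.s)
    (hrecv : ∀ a j, ℓ + ∑ i, #(out a i j) ≤ S.s) :
    S.Reach (t + 1) fun a j => (y a j, fun i => out a i j) := by
  choose e he using hsmall
  let M : I → Fin p → Fin p → List (Fin S.W) := fun a i j =>
    (if i = j then List.ofFn (e i a) else []) ++ wordList S.W (out a i j)
  have hlen : ∀ a i j, (M a i j).length ≤ (if i = j then ℓ else 0) + #(out a i j) := by
    intro a i j
    simp only [M, List.length_append]
    refine add_le_add ?_ (length_wordList_le _ _)
    split_ifs <;> simp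
  have hfits : S.Fits M := by
    intro a i
    constructor
    · refine (Finset.sum_le_sum fun j _ => hlen a i j).trans ?_
      rw [Finset.sum_add_distrib]
      simpa using hsend a i
    · refine (Finset.sum_le_sum fun j _ => hlen a j i).trans ?_
      rw [Finset.sum_add_distrib]
      simpa using hrecv a i
  have hdet : Det x M := by
    intro i a b hab
    funext j
    simp only [M, hout i a b hab, (he i a b).2 (hy i a b hab)]
  have hback : Det (fun a i k => M a k i) fun a j => (y a j, fun i => out a i j) := by
    intro j a b hab
    -- A message to oneself contains both the stored data and the words sent; the stored part has
    -- the fixed length `ℓ`, so the message can be cut.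
    have hsplit : e j a = e j b ∧ wordList S.W (out a j j) = wordList S.W (out b j j) := by
      have := congrFun hab j
      simp only [M, if_true] at this
      obtain ⟨h1, h2⟩ := List.append_inj this (by simp)
      exact ⟨List.ofFn_injective h1, h2⟩
    refine Prod.ext ((he j a b).1 hsplit.1) ?_
    funext i
    refine wordList_injOn (hw a i j) (hw b i j) ?_
    by_cases hij : i = j
    · subst hij; exact hsplit.2
    · have := congrFun hab i
      simpa [M, hij] using this
  refine ⟨M, ?_, hback⟩
  cases t with
  | zero => exact ⟨hfits, h.trans hdet⟩
  | succ t =>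
    obtain ⟨M', hM', hx⟩ := h
    exact ⟨hfits, M', hM', hx.trans hdet⟩

/-- One round: the machines keep `y` and send the sets `out` of words. -/
theorem Know.round {T ℓ : ℕ} {out : I → Fin p → Fin p → Finset ℕ} (h : S.Know T x)
    (hy : Det x y) (hout : Det x out) (hsmall : Small S.W ℓ y)
    (hw : ∀ a i j, ∀ w ∈ out a i j, w < S.W)
    (hsend : ∀ a i, ℓ + ∑ j, #(out a i j) ≤ S.s)
    (hrecv : ∀ a j, ℓ + ∑ i, #(out a i j) ≤ S.s) :
    S.Know (T + 1) fun a j => (y a j, fun i => out a i j) := by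
  obtain ⟨t, ht, h⟩ := h
  exact ⟨t + 1, by omega, h.round hy hout hsmall hw hsend hrecv⟩

end Env

section Protocol

variable {W : ℕ}

/-- The messages of a protocol that is given by its local computations. -/
def run (start : Fin p → δ → Fin p → List (Fin W))
    (step : ℕ → Fin p → (Fin p → List (Fin W)) → Fin p → List (Fin W)) (g : Fin p → δ) :
    ℕ → Fin p → Fin p → List (Fin W)
  | 0 => fun i => start i (g i)
  | t + 1 => fun i => step t i fun k => run start step g t k i

theorem run_congr {start : Fin p → δ → Fin p → List (Fin W)}
    {step step' : ℕ → Fin p → (Fin p → List (Fin W)) → Fin p → List (Fin W)} {t : ℕ}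
    (h : ∀ t' < t, step t' = step' t') (g : Fin p → δ) :
    run start step g t = run start step' g t := by
  induction t with
  | zero => rfl
  | succ t ih =>
    funext i
    rw [run, run, ih fun t' ht' => h t' (by omega), h t (by omega)]

/-- Local functions are chosen round by round. A new round changes `step` only at one index that
earlier rounds do not use, so their messages and memory bounds persist. -/
theorem Env.Sends.exists_run {S : Env I p δ} {t : ℕ} {M : I → Fin p → Fin p → List (Fin S.W)}
    (h : S.Sends t M) : ∃ start step, (∀ a, run start step (S.given a) t = M a) ∧
      ∀ t' ≤ t, S.Fits fun a => run start step (S.given a) t' := by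
  induction t generalizing M with
  | zero =>
    obtain ⟨hfits, hdet⟩ := h
    obtain ⟨g, hg⟩ := hdet.exists_eq
    have hrun : ∀ a, run g (fun _ _ _ _ => []) (S.given a) 0 = M a := by
      intro a; funext i; exact (hg a i).symm
    refine ⟨g, fun _ _ _ _ => [], hrun, fun t' ht' => ?_⟩
    rw [Nat.le_zero.1 ht']
    simpa only [hrun] using hfits
  | succ t ih =>
    obtain ⟨hfits, M', hM', hdet⟩ := h
    obtain ⟨start, step, hrun, hfit⟩ := ih hM'
    obtain ⟨g, hg⟩ := hdet.exists_eq
    have hold : ∀ t' ≤ t, ∀ a, run start (Function.update step t g) (S.given a) t' =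
        run start step (S.given a) t' := by
      intro t' ht' a
      refine run_congr (fun t'' h'' => ?_) _
      rw [Function.update_of_ne (by omega)]
    have hnew : ∀ a, run start (Function.update step t g) (S.given a) (t + 1) = M a := by
      intro a
      funext i
      rw [run, hold t le_rfl, Function.update_self, hrun, hg]
    refine ⟨start, Function.update step t g, hnew, fun t' ht' => ?_⟩
    rcases Nat.lt_or_ge t t' with hlt | hle
    · rw [show t' = t + 1 by omega]
      simpa only [hnew] using hfits
    · simpa only [hold t' hle] using hfit t' hle

/-- What the machines can know after some rounds can be the output of an algorithm. -/
theorem Env.Know.exists_algorithm {n N T : ℕ}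
    {S : Env I p (Finset (Sym2 (Fin n)) × Fin (N + 1))} {x : I → Fin p → Finset (Fin n)}
    (h : S.Know T x) (hx : ∀ a i, #(x a i) ≤ S.s) (hW : n + 1 ≤ S.W) :
    ∃ A : MPCAlgorithm n p S.W, A.rounds ≤ T + 1 ∧ ∃ hc : A.coin = N,
      ∀ (a : I) (input : Fin p → Finset (Sym2 (Fin n))) (ω : A.Randomness),
        (∀ i, S.given a i = (input i, Fin.cast (by rw [hc]) (ω ⟨0, Nat.succ_pos _⟩ i))) →
        A.FitsMemory S.s input ω ∧ A.machineOutput input ω = x a := by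
  obtain ⟨t, ht, h⟩ := h
  have hsmall : Small S.W S.s x := Small.of_finset Finset.univ S.s
    (fun _ _ => Finset.subset_univ _) hx (Nat.pow_le_pow_left (by simpa using hW) _)
  -- The output is read off from messages only, so one more round is spent in which every machine
  -- sends its part to itself. A set of at most `s` vertices fits into `s` words because `n + 1 ≤
  -- W`.
  obtain ⟨M, hM, hdet⟩ := (h.round (out := fun _ _ _ => ∅) (Det.refl x) (fun _ _ _ _ => rfl) hsmall
    (by simp) (by simp) (by simp)).det Det.fst
  obtain ⟨start, step, hrun, hfit⟩ := hM.exists_run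
  obtain ⟨g, hg⟩ := hdet.exists_eq
  let A : MPCAlgorithm n p S.W :=
    { lastRound := t
      coin := N
      start := fun i E r => start i (E, r)
      step := fun t i M _ => step t i M
      output := g }
  refine ⟨A, Nat.succ_le_succ ht, rfl, fun a input ω hω => ?_⟩
  have hmsg : ∀ t' (ht' : t' < A.rounds), A.message input ω t' ht' =
      run start step (S.given a) t' := by
    intro t'
    induction t' with
    | zero =>
      intro ht'
      funext i
      change start i (input i, ω ⟨0, ht'⟩ i) = start i (S.given a i)
      rw [hω]
      rfl
    | succ t' ih =>
      intro ht'
      funext i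
      rw [MPCAlgorithm.message, run, ih]
  have hout : A.machineOutput input ω = x a := by
    funext i
    rw [hg, ← hrun]
    exact congrArg (fun m : Fin p → Fin p → List (Fin S.W) => g i fun k => m k i)
      (hmsg t (Nat.lt_succ_self t))
  refine ⟨⟨fun t' ht' i => ?_, fun i => ?_⟩, hout⟩
  · rw [hmsg]
    exact hfit t' (Nat.le_of_lt_succ ht') a i
  · rw [hout]
    exact hx a i

end Protocol

end MPC

/-! ### Routing in portions, and prefix and suffix values over all machines. -/

namespace MPC

variable {I δ : Type} {p : ℕ}

namespace Env

variable {S : Env I p δ} {α β : Type} {x : I → Fin p → α}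

section Route

/-- The elements are enumerated and cut into blocks of length `b`. -/
theorem exists_slices {σ : Type*} (P : Finset σ) (K b : ℕ) (h : #P ≤ K * b) :
    ∃ c : σ → ℕ, (∀ k, #{v ∈ P | c v = k} ≤ b) ∧ ∀ v ∈ P, c v < K := by
  classical
  refine ⟨fun v => if hv : v ∈ P then (P.equivFin ⟨v, hv⟩ : ℕ) / b else 0, fun k => ?_,
    fun v hv => ?_⟩
  · rcases Nat.eq_zero_or_pos b with rfl | hb
    · have : P = ∅ := by simpa using h
      simp [this]
    · refine le_trans (b := #(Finset.Ico (k * b) (k * b + b))) ?_ (by simp)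
      refine Finset.card_le_card_of_injOn
        (fun v => if hv : v ∈ P then (P.equivFin ⟨v, hv⟩ : ℕ) else 0) ?_ ?_
      · intro v hv
        obtain ⟨hv, hk⟩ := Finset.mem_filter.1 (Finset.mem_coe.1 hv)
        simp only [dif_pos hv] at hk ⊢
        rw [Finset.coe_Ico, Set.mem_Ico]
        rw [Nat.div_eq_iff hb] at hk
        omega
      · intro v hv w hw hvw
        have hv := (Finset.mem_filter.1 (Finset.mem_coe.1 hv)).1
        have hw := (Finset.mem_filter.1 (Finset.mem_coe.1 hw)).1
        simp only [dif_pos hv, dif_pos hw] at hvw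
        have := P.equivFin.injective (Fin.ext hvw)
        exact congrArg Subtype.val this
  · simp only [dif_pos hv]
    have := (P.equivFin ⟨v, hv⟩).2
    exact Nat.div_lt_of_lt_mul (by rw [mul_comm]; omega)

/-- Send the words `out`; in order to stay below the memory, they are sent in `K` portions. -/
theorem Know.route {T ℓ b r : ℕ} (K : ℕ) {out : I → Fin p → Fin p → Finset ℕ} (h : S.Know T x)
    (hsmall : Small S.W ℓ x) (hout : Det x out) (hW : 2 ≤ S.W)
    (hw : ∀ a i j, ∀ w ∈ out a i j, w < S.W)
    (hsend : ∀ a i, ∑ j, #(out a i j) ≤ K * b) (hrecv : ∀ a j, ∑ i, #(out a i j) ≤ r)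
    (hb : ℓ + 2 * r + b ≤ S.s) (hr : ℓ + 3 * r ≤ S.s) :
    S.Know (T + K) fun a j => (x a j, Finset.univ.biUnion fun i => out a i j) := by
  classical
  have hex : ∀ o : Fin p → Finset ℕ, ∃ c : (Σ _ : Fin p, ℕ) → ℕ,
      #(Finset.univ.sigma o) ≤ K * b →
      (∀ k, #{v ∈ Finset.univ.sigma o | c v = k} ≤ b) ∧ ∀ v ∈ Finset.univ.sigma o, c v < K := by
    intro o
    by_cases ho : #(Finset.univ.sigma o) ≤ K * b
    · obtain ⟨c, hc⟩ := exists_slices _ K b ho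
      exact ⟨c, fun _ => hc⟩
    · exact ⟨fun _ => 0, fun h => absurd h ho⟩
  choose c hc using hex
  have hc' : ∀ a i, (∀ k, #{v ∈ Finset.univ.sigma (out a i) | c (out a i) v = k} ≤ b) ∧
      ∀ v ∈ Finset.univ.sigma (out a i), c (out a i) v < K := fun a i => hc _ (by
    rw [Finset.card_sigma]; exact hsend a i)
  -- What has arrived before portion `k`. Senders are forgotten: only the union of the words is
  -- kept.
  let R : ℕ → I → Fin p → Finset ℕ := fun k a j =>
    Finset.univ.biUnion fun i => {w ∈ out a i j | c (out a i) ⟨j, w⟩ < k}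
  have hRw : ∀ k a j, ∀ w ∈ R k a j, w < S.W := by
    intro k a j w hw'
    obtain ⟨i, _, hi⟩ := Finset.mem_biUnion.1 hw'
    exact hw a i j w (Finset.mem_filter.1 hi).1
  have hRc : ∀ k a j, #(R k a j) ≤ r := by
    intro k a j
    refine Finset.card_biUnion_le.trans (le_trans ?_ (hrecv a j))
    exact Finset.sum_le_sum fun i _ => Finset.card_le_card (Finset.filter_subset _ _)
  have key : ∀ k, S.Know (T + k) fun a j => (x a j, R k a j) := by
    intro k
    induction k with
    | zero =>
      refine h.det (Det.pair (Det.refl x) fun i a b _ => ?_)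
      simp [R]
    | succ k ih =>
      have hround := Know.round (ℓ := ℓ + 2 * r) (y := fun a j => (x a j, R k a j))
        (out := fun a i j => {w ∈ out a i j | c (out a i) ⟨j, w⟩ = k}) ih (Det.refl _)
        (fun i a b hab => by
          have h1 : x a i = x b i := congrArg Prod.fst hab
          have h2 : out a i = out b i := hout i a b h1
          funext j
          simp only [h2])
        (hsmall.pair (Small.of_words hW (hRw k) (hRc k)))
        (fun a i j w hw' => hw a i j w (Finset.mem_filter.1 hw').1)
        (fun a i => by
          refine le_trans ?_ hb
          have : ∑ j, #{w ∈ out a i j | c (out a i) ⟨j, w⟩ = k} =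
              #{v ∈ Finset.univ.sigma (out a i) | c (out a i) v = k} := by
            rw [← Finset.card_sigma]
            congr 1
            ext ⟨j, w⟩
            simp
          rw [this]
          exact Nat.add_le_add_left ((hc' a i).1 k) _)
        (fun a j => by
          have : ∑ i, #{w ∈ out a i j | c (out a i) ⟨j, w⟩ = k} ≤ r :=
            (Finset.sum_le_sum fun i _ => Finset.card_le_card (Finset.filter_subset _ _)).trans
              (hrecv a j)
          omega)
      refine hround.det fun j a b hab => ?_
      have h1 := congrArg (fun v => v.1.1) hab
      have h2 := congrArg (fun v => v.1.2) hab
      have h3 := congrArg (fun v => v.2) hab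
      dsimp only at h1 h2 h3
      refine Prod.ext h1 ?_
      have hR : ∀ a, R (k + 1) a j = R k a j ∪
          Finset.univ.biUnion fun i => {w ∈ out a i j | c (out a i) ⟨j, w⟩ = k} := by
        intro a
        ext w
        simp only [R, Finset.mem_union, Finset.mem_biUnion, Finset.mem_univ, true_and,
          Finset.mem_filter, Nat.lt_succ_iff_lt_or_eq]
        constructor
        · rintro ⟨i, hi, hlt | heq⟩
          exacts [Or.inl ⟨i, hi, hlt⟩, Or.inr ⟨i, hi, heq⟩]
        · rintro (⟨i, hi, hlt⟩ | ⟨i, hi, heq⟩)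
          exacts [⟨i, hi, Or.inl hlt⟩, ⟨i, hi, Or.inr heq⟩]
      change R (k + 1) a j = R (k + 1) b j
      rw [hR, hR, h2]
      congr 1
      refine Finset.biUnion_congr rfl fun i _ => congrFun h3 i
  refine (key K).det fun j a b hab => ?_
  have hfull : ∀ a, R K a j = Finset.univ.biUnion fun i => out a i j := by
    intro a
    refine Finset.biUnion_congr rfl fun i _ => Finset.filter_true_of_mem fun w hw' => ?_
    exact (hc' a i).2 ⟨j, w⟩ (Finset.mem_sigma.2 ⟨Finset.mem_univ _, hw'⟩)
  simpa only [hfull] using hab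

end Route

section Scan

theorem card_filter_near_le (q w : ℕ) (i : Fin p) :
    #{j : Fin p | ∃ c < q, (j : ℕ) = i + c * w ∨ (i : ℕ) = j + c * w} ≤ 2 * q := by
  have h1 : #{j : Fin p | ∃ c < q, (j : ℕ) = i + c * w ∨ (i : ℕ) = j + c * w} ≤
      #((Finset.range q).image (fun c => (i : ℕ) + c * w) ∪
        (Finset.range q).image (fun c => (i : ℕ) - c * w)) := by
    refine Finset.card_le_card_of_injOn Fin.val ?_ (Fin.val_injective.injOn)
    intro j hj
    obtain ⟨c, hc, h | h⟩ := (Finset.mem_filter.1 (Finset.mem_coe.1 hj)).2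
    · exact Finset.mem_coe.2 (Finset.mem_union_left _
        (Finset.mem_image.2 ⟨c, Finset.mem_range.2 hc, h.symm⟩))
    · exact Finset.mem_coe.2 (Finset.mem_union_right _
        (Finset.mem_image.2 ⟨c, Finset.mem_range.2 hc, by omega⟩))
  refine h1.trans ((Finset.card_union_le _ _).trans ?_)
  have h2 : #((Finset.range q).image (fun c => (i : ℕ) + c * w)) ≤ q :=
    Finset.card_image_le.trans (by simp)
  have h3 : #((Finset.range q).image (fun c => (i : ℕ) - c * w)) ≤ q :=
    Finset.card_image_le.trans (by simp)
  omega

/-- Two sets of words in one. -/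
def tagged (A B : Finset ℕ) : Finset ℕ := A.image (fun w => 2 * w) ∪ B.image (fun w => 2 * w + 1)

theorem card_tagged_le {A B : Finset ℕ} {m : ℕ} (hA : #A ≤ m) (hB : #B ≤ m) :
    #(tagged A B) ≤ 2 * m := by
  refine (Finset.card_union_le _ _).trans ?_
  have h1 := Finset.card_image_le (s := A) (f := fun w => 2 * w)
  have h2 := Finset.card_image_le (s := B) (f := fun w => 2 * w + 1)
  omega

theorem tagged_inj {A B A' B' : Finset ℕ} (h : tagged A B = tagged A' B') : A = A' ∧ B = B' := by
  have e1 : ∀ (A B : Finset ℕ) w, 2 * w ∈ tagged A B ↔ w ∈ A := by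
    intro A B w
    simp only [tagged, Finset.mem_union, Finset.mem_image]
    constructor
    · rintro (⟨v, hv, e⟩ | ⟨v, hv, e⟩)
      · rwa [show w = v by omega]
      · omega
    · exact fun hw => Or.inl ⟨w, hw, rfl⟩
  have e2 : ∀ (A B : Finset ℕ) w, 2 * w + 1 ∈ tagged A B ↔ w ∈ B := by
    intro A B w
    simp only [tagged, Finset.mem_union, Finset.mem_image]
    constructor
    · rintro (⟨v, hv, e⟩ | ⟨v, hv, e⟩)
      · omega
      · rwa [show w = v by omega]
    · exact fun hw => Or.inr ⟨w, hw, rfl⟩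
  constructor
  · ext w; rw [← e1 A B, h, e1]
  · ext w; rw [← e2 A B, h, e2]

/-- Prefix and suffix values of a function `F` of intervals of machines that is determined by its
values on the parts of the interval. -/
theorem Know.scan {T ℓ q D B : ℕ} (h : S.Know T x) (hsmall : Small S.W ℓ x)
    (F : I → ℕ → ℕ → β) (E : β → Finset ℕ) (hown : Det x fun a (i : Fin p) => F a i (i + 1))
    (hnil : ∀ a b l, F a l l = F b l l)
    (hcat : ∀ a b l m r, l ≤ m → m ≤ r → r ≤ p → F a l m = F b l m → F a m r = F b m r →
      F a l r = F b l r)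
    (hE : ∀ a b l r, r ≤ p → E (F a l r) = E (F b l r) → F a l r = F b l r)
    (hcard : ∀ a l r, r ≤ p → #(E (F a l r)) ≤ B)
    (hword : ∀ a l r, r ≤ p → ∀ w ∈ E (F a l r), 2 * w + 1 < S.W)
    (hq : 1 ≤ q) (hp : p ≤ q ^ D) (hs : ℓ + 4 * q * B ≤ S.s) :
    S.Know (T + (D + 1)) fun a (i : Fin p) => (x a i, F a 0 i, F a (i + 1) p) := by
  classical
  -- A machine communicates with at most `2 * q` machines and exchanges two encoded values of size
  -- `B` with each, in either direction.
  have hbudget : ∀ (q' : ℕ) (w : ℕ) (o : Fin p → Fin p → Finset ℕ), q' ≤ q →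
      (∀ i j : Fin p, (¬ ∃ c < q', (j : ℕ) = i + c * w ∨ (i : ℕ) = j + c * w) → o i j = ∅) →
      (∀ i j, #(o i j) ≤ 2 * B) →
      (∀ i, ℓ + ∑ j, #(o i j) ≤ S.s) ∧ (∀ j, ℓ + ∑ i, #(o i j) ≤ S.s) := by
    intro q' w o hq' ho hoB
    have aux : ∀ (f : Fin p → ℕ) (i : Fin p), (∀ j, f j ≤ 2 * B) →
        (∀ j : Fin p, (¬ ∃ c < q', (j : ℕ) = i + c * w ∨ (i : ℕ) = j + c * w) → f j = 0) →
        ℓ + ∑ j, f j ≤ S.s := by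
      intro f i hf1 hf2
      refine le_trans (Nat.add_le_add_left ?_ _) hs
      rw [← Finset.sum_filter_add_sum_filter_not Finset.univ
        (fun j : Fin p => ∃ c < q', (j : ℕ) = i + c * w ∨ (i : ℕ) = j + c * w)]
      rw [Finset.sum_eq_zero (s := Finset.univ.filter _) (fun j hj => hf2 j (Finset.mem_filter.1 hj).2),
        add_zero]
      calc _ ≤ #{j : Fin p | ∃ c < q', (j : ℕ) = i + c * w ∨ (i : ℕ) = j + c * w} * (2 * B) :=
            Finset.sum_le_card_nsmul _ _ _ fun j _ => hf1 j
        _ ≤ (2 * q') * (2 * B) := Nat.mul_le_mul_right _ (card_filter_near_le q' w i)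
        _ ≤ (2 * q) * (2 * B) := by gcongr
        _ = _ := by ring
    refine ⟨fun i => aux _ i (fun j => hoB i j) fun j hj => ?_,
      fun j => aux _ j (fun i => hoB i j) fun i hi => ?_⟩
    · rw [ho i j hj, Finset.card_empty]
    · rw [ho i j (fun hc => hi (by
        obtain ⟨c, hc, h⟩ := hc
        exact ⟨c, hc, h.symm⟩)), Finset.card_empty]
  let L : ℕ → I → Fin p → β := fun w a i => F a (i - w) i
  let R : ℕ → I → Fin p → β := fun w a i => F a (i + 1) (min (i + 1 + w) p)
  -- After stage `j` each machine knows the values of the windows of `q ^ j` machines on its left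
  -- and right, itself excluded. One further round multiplies the width by `q`, and width `q ^ D`
  -- covers everything.
  have hstage : ∀ j, S.Know (T + (j + 1)) fun a i => (x a i, L (q ^ j) a i, R (q ^ j) a i) := by
    intro j
    induction j with
    | zero =>
      let out : I → Fin p → Fin p → Finset ℕ := fun a i j =>
        if (j : ℕ) = i + 1 ∨ (i : ℕ) = j + 1 then E (F a i (i + 1)) else ∅
      have hip : ∀ i : Fin p, (i : ℕ) + 1 ≤ p := fun i => i.2
      have hB : ∀ a i j, #(out a i j) ≤ B := by
        intro a i j
        simp only [out]
        split_ifs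
        · exact hcard a _ _ (hip i)
        · simp
      have haux : ∀ (f : Fin p → ℕ) (i : Fin p), (∀ j, f j ≤ B) →
          (∀ j : Fin p, ¬ ((j : ℕ) = i + 1 ∨ (i : ℕ) = j + 1) → f j = 0) →
          ℓ + ∑ j, f j ≤ S.s := by
        intro f i hf1 hf2
        have hcd : #{j : Fin p | (j : ℕ) = i + 1 ∨ (i : ℕ) = j + 1} ≤ 4 := by
          refine le_trans (Finset.card_le_card ?_) (card_filter_near_le 2 1 i)
          intro j hj
          refine Finset.mem_filter.2 ⟨Finset.mem_univ _, 1, by norm_num, ?_⟩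
          simpa using hj
        have h5 : ∑ j, f j ≤ 4 * B := by
          rw [← Finset.sum_filter_add_sum_filter_not Finset.univ
            (fun j : Fin p => (j : ℕ) = i + 1 ∨ (i : ℕ) = j + 1)]
          rw [Finset.sum_eq_zero (s := Finset.univ.filter _)
            (fun j hj => hf2 j (Finset.mem_filter.1 hj).2), add_zero]
          exact (Finset.sum_le_card_nsmul _ _ _ fun j _ => hf1 j).trans
            (Nat.mul_le_mul_right _ hcd)
        have : 4 * B ≤ 4 * q * B := Nat.mul_le_mul_right _ (by omega)
        omega
      have hround := h.round (out := out) (Det.refl x)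
        (fun i a b hab => by
          have h1 : F a i (i + 1) = F b i (i + 1) := hown i a b hab
          funext j
          simp only [out, h1]) hsmall
        (fun a i j w hw' => by
          simp only [out] at hw'
          split_ifs at hw'
          · have := hword a _ _ (hip i) w hw'
            omega
          · simp at hw')
        (fun a i => haux _ i (fun j => hB a i j) fun j hj => by simp [out, hj])
        (fun a j => haux _ j (fun i => hB a i j) fun i hi => by
          simp only [out]
          rw [if_neg fun h => hi (Or.symm h), Finset.card_empty])
      refine hround.det fun j a b hab => ?_
      have h1 := congrArg Prod.fst hab
      have h2 := congrArg Prod.snd hab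
      dsimp only at h1 h2
      refine Prod.ext h1 (Prod.ext ?_ ?_)
      · simp only [L, pow_zero]
        rcases Nat.eq_zero_or_pos (j : ℕ) with h0 | h0
        · rw [h0]; exact hnil a b 0
        · have h3 := congrFun h2 ⟨j - 1, by omega⟩
          have h4 : (j : ℕ) - 1 + 1 = j := by omega
          simp only [out, h4, true_or, if_true] at h3
          exact hE _ _ _ _ j.2.le h3
      · simp only [R, pow_zero]
        rcases Nat.lt_or_ge ((j : ℕ) + 1) p with h0 | h0
        · have h3 := congrFun h2 ⟨j + 1, h0⟩
          simp only [out, or_true, if_true] at h3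
          rw [min_eq_left (by omega)]
          exact hE _ _ _ _ (by omega) h3
        · rw [min_eq_right (by omega), show (j : ℕ) + 1 = p by omega]
          exact hnil a b p
    | succ k ih =>
      set w := q ^ k with hwdef
      -- The case `c = 0` is included, so a machine also sends its two current windows to itself;
      -- besides these messages only `x` has to be kept.
      let near : Fin p → Fin p → Prop := fun i j =>
        ∃ c < q, (j : ℕ) = i + c * w ∨ (i : ℕ) = j + c * w
      let out : I → Fin p → Fin p → Finset ℕ := fun a i j =>
        if near i j then tagged (E (L w a i)) (E (R w a i)) else ∅
      have hLp : ∀ i : Fin p, (i : ℕ) ≤ p := fun i => i.2.le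
      have hRp : ∀ i : Fin p, min ((i : ℕ) + 1 + w) p ≤ p := fun i => min_le_right _ _
      have hB : ∀ a i j, #(out a i j) ≤ 2 * B := by
        intro a i j
        simp only [out]
        split_ifs
        · exact card_tagged_le (hcard a _ _ (hLp i)) (hcard a _ _ (hRp i))
        · simp
      have hround := ih.round (out := out) (y := x) Det.fst
        (fun i a b hab => by
          have h1 := congrArg (fun v => v.2.1) hab
          have h2 := congrArg (fun v => v.2.2) hab
          dsimp only at h1 h2
          funext j
          simp only [out, h1, h2]) hsmall
        (fun a i j w' hw' => by
          simp only [out] at hw'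
          split_ifs at hw'
          · rcases Finset.mem_union.1 hw' with hw' | hw' <;>
              obtain ⟨v, hv, rfl⟩ := Finset.mem_image.1 hw'
            · have := hword a _ _ (hLp i) v hv
              omega
            · exact hword a _ _ (hRp i) v hv
          · simp at hw')
        (fun a => (hbudget q w (out a) le_rfl (fun i j hij => if_neg hij) (hB a)).1)
        (fun a => (hbudget q w (out a) le_rfl (fun i j hij => if_neg hij) (hB a)).2)
      refine hround.det fun j a b hab => ?_
      have h1 := congrArg Prod.fst hab
      have h2 := congrArg Prod.snd hab
      dsimp only at h1 h2
      have h3 : ∀ i, near i j → L w a i = L w b i ∧ R w a i = R w b i := by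
        intro i hi
        have := congrFun h2 i
        simp only [out, if_pos hi] at this
        obtain ⟨h4, h5⟩ := tagged_inj this
        exact ⟨hE _ _ _ _ (hLp i) h4, hE _ _ _ _ (hRp i) h5⟩
      -- The wide window is glued from `c` narrow ones. Once it reaches machine `0`, truncated
      -- subtraction leaves it unchanged.
      have hL : ∀ c ≤ q, F a (j - c * w) j = F b (j - c * w) j := by
        intro c
        induction c with
        | zero => intro _; rw [Nat.zero_mul, Nat.sub_zero]; exact hnil a b j
        | succ c ihc =>
          intro hc
          have ihc := ihc (by omega)
          have e : (j : ℕ) - (c + 1) * w = j - c * w - w := by rw [Nat.succ_mul]; omega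
          by_cases hcj : c * w ≤ j
          · have := (h3 ⟨j - c * w, by omega⟩ ⟨c, by omega, Or.inl (by simp only; omega)⟩).1
            refine hcat a b _ (j - c * w) _ (by omega) (by omega) (hLp j) ?_ ihc
            rw [e]
            exact this
          · rw [show (j : ℕ) - (c + 1) * w = j - c * w by omega]
            exact ihc
      have hR : ∀ c ≤ q, F a (j + 1) (min (j + 1 + c * w) p) = F b (j + 1) (min (j + 1 + c * w) p) := by
        intro c
        induction c with
        | zero =>
          intro _
          rw [Nat.zero_mul, Nat.add_zero, min_eq_left (by omega)]
          exact hnil a b _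
        | succ c ihc =>
          intro hc
          have ihc := ihc (by omega)
          have e : (c + 1) * w = c * w + w := Nat.succ_mul _ _
          by_cases hcj : j + c * w < p
          · have := (h3 ⟨j + c * w, hcj⟩ ⟨c, by omega, Or.inr rfl⟩).2
            rw [min_eq_left (by omega)] at ihc
            refine hcat a b _ (j + 1 + c * w) _ (by omega) (by omega) (min_le_right _ _) ihc ?_
            rw [e, show (j : ℕ) + 1 + (c * w + w) = j + c * w + 1 + w by ring,
              show (j : ℕ) + 1 + c * w = j + c * w + 1 by ring]
            exact this
          · rw [show min ((j : ℕ) + 1 + (c + 1) * w) p = min (j + 1 + c * w) p by omega]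
            exact ihc
      have e : q ^ (k + 1) = q * w := by rw [pow_succ, mul_comm]
      refine Prod.ext h1 (Prod.ext ?_ ?_)
      · simp only [L, e]; exact hL q le_rfl
      · simp only [R, e]; exact hR q le_rfl
  refine (hstage D).det fun i a b hab => ?_
  have e1 : ∀ a, L (q ^ D) a i = F a 0 i := by
    intro a
    simp only [L]
    rw [Nat.sub_eq_zero_of_le (i.2.le.trans hp)]
  have e2 : ∀ a, R (q ^ D) a i = F a (i + 1) p := by
    intro a
    simp only [R]
    rw [min_eq_right (by omega)]
  simpa only [e1, e2] using hab

end Scan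

end Env

end MPC

/-! ### Radix sort in constantly many rounds. -/

namespace MPC

variable {I δ : Type} {p : ℕ}

section Rank

variable {κ α β : Type*} [LinearOrder α] [LinearOrder β]

/-- The rank of `k` in `H` with respect to the sorting key `f`. -/
def rankBy (f : κ → α) (H : Finset κ) (k : κ) : ℕ := #{k' ∈ H | f k' < f k}

theorem rankBy_lt_rankBy {f : κ → α} {H : Finset κ} {k k' : κ} (hk : k ∈ H) (h : f k < f k') :
    rankBy f H k < rankBy f H k' := by
  refine Finset.card_lt_card ⟨fun v hv => ?_, fun hsub => ?_⟩
  · obtain ⟨hv, hlt⟩ := Finset.mem_filter.1 hv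
    exact Finset.mem_filter.2 ⟨hv, hlt.trans h⟩
  · exact lt_irrefl _ (Finset.mem_filter.1 (hsub (Finset.mem_filter.2 ⟨hk, h⟩))).2

theorem rankBy_le_rankBy {f : κ → α} {H : Finset κ} {k k' : κ} (h : f k ≤ f k') :
    rankBy f H k ≤ rankBy f H k' := by
  refine Finset.card_le_card fun v hv => ?_
  obtain ⟨hv, hlt⟩ := Finset.mem_filter.1 hv
  exact Finset.mem_filter.2 ⟨hv, hlt.trans_le h⟩

theorem rankBy_lt_iff {f : κ → α} {H : Finset κ} {k k' : κ} (hk : k ∈ H) :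
    rankBy f H k < rankBy f H k' ↔ f k < f k' := by
  refine ⟨fun h => ?_, rankBy_lt_rankBy hk⟩
  by_contra hle
  exact absurd (rankBy_le_rankBy (not_lt.1 hle)) (not_le.2 h)

theorem rankBy_injOn {f : κ → α} {H : Finset κ} (hf : Set.InjOn f H) :
    Set.InjOn (rankBy f H) H := by
  intro k hk k' hk' h
  refine hf hk hk' (le_antisymm ?_ ?_)
  · exact not_lt.1 fun hlt => absurd h (rankBy_lt_rankBy hk' hlt).ne'
  · exact not_lt.1 fun hlt => absurd h (rankBy_lt_rankBy hk hlt).ne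

theorem rankBy_lt_card {f : κ → α} {H : Finset κ} {k : κ} (hk : k ∈ H) : rankBy f H k < #H :=
  Finset.card_lt_card ⟨Finset.filter_subset _ _, fun hsub =>
    lt_irrefl _ (Finset.mem_filter.1 (hsub hk)).2⟩

theorem rankBy_congr {f : κ → α} {g : κ → β} {H : Finset κ} {k : κ}
    (h : ∀ k' ∈ H, f k' < f k ↔ g k' < g k) : rankBy f H k = rankBy g H k := by
  unfold rankBy
  congr 1
  exact Finset.filter_congr h

theorem card_filter_div_le {f : κ → ℕ} {H : Finset κ} (hf : Set.InjOn f H) {L : ℕ} (hL : 0 < L)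
    (i : ℕ) : #{k ∈ H | f k / L = i} ≤ L := by
  refine le_trans (b := #(Finset.Ico (i * L) (i * L + L))) ?_ (by simp)
  refine Finset.card_le_card_of_injOn f ?_ (hf.mono fun k hk => ?_)
  · intro k hk
    have := (Finset.mem_filter.1 (Finset.mem_coe.1 hk)).2
    rw [Nat.div_eq_iff hL] at this
    rw [Finset.coe_Ico, Set.mem_Ico]
    omega
  · exact (Finset.mem_filter.1 (Finset.mem_coe.1 hk)).1

end Rank

theorem sum_card_filter_eq_le {κ : Type*} (X : Finset κ) (f : κ → ℕ) :
    ∑ j : Fin p, #{k ∈ X | f k = (j : ℕ)} ≤ #X := by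
  classical
  rw [← Finset.card_biUnion]
  · refine Finset.card_le_card fun k hk => ?_
    obtain ⟨j, _, hj⟩ := Finset.mem_biUnion.1 hk
    exact (Finset.mem_filter.1 hj).1
  · intro i _ j _ hij
    refine Finset.disjoint_filter.2 fun k _ h1 h2 => hij (Fin.ext ?_)
    rw [← h1, ← h2]

theorem pair_lt_sq {a b U : ℕ} (ha : a ≤ U) (hb : b ≤ U) : Nat.pair a b < (U + 1) ^ 2 :=
  (Nat.pair_lt_max_add_one_sq a b).trans_le (Nat.pow_le_pow_left (by omega) 2)

/-- The memory is large compared to the parameters of the primitives: scans work with blocks of `q`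
machines, items are numbers below `U`, and machines hold `L` items each. -/
structure Capacity (S : Env I p δ) (q D U Q L : ℕ) : Prop where
  two_le_q : 2 ≤ q
  q_le_U : q ≤ U
  four_le_U : 4 ≤ U
  p_le_pow : p ≤ q ^ D
  U_le_pow : U ≤ q ^ Q
  one_le_Q : 1 ≤ Q
  pow_le_W : U ^ 8 ≤ S.W
  one_le_L : 1 ≤ L
  L_le : 1000 * L ≤ S.s
  q_le : 1000 * (q * q) ≤ S.s

theorem Capacity.two_mul_add_one_lt {S : Env I p δ} {q D U Q L : ℕ} (cap : Capacity S q D U Q L)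
    {w : ℕ} (hw : w < (U + 1) ^ 2) : 2 * w + 1 < S.W := by
  refine lt_of_lt_of_le ?_ cap.pow_le_W
  have h := cap.four_le_U
  have h1 : (U + 1) ^ 2 ≤ 4 * U ^ 2 := by nlinarith
  have h2 : 4 * U ^ 2 * 4 ≤ U ^ 4 := by nlinarith [Nat.pow_le_pow_left h 2]
  have h3 : U ^ 4 ≤ U ^ 8 := Nat.pow_le_pow_right (by omega) (by norm_num)
  omega

theorem Capacity.two_le_W {S : Env I p δ} {q D U Q L : ℕ} (cap : Capacity S q D U Q L) :
    2 ≤ S.W := by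
  have := cap.two_mul_add_one_lt (w := 1) (by nlinarith [cap.four_le_U])
  omega

/-- The items of machine `i`, together with their labels. -/
def labelled (H : I → Finset ℕ) (loc σ : I → ℕ → ℕ) (a : I) (i : Fin p) : Finset ℕ :=
  {k ∈ H a | loc a k = i}.image fun k => Nat.pair k (σ a k)

theorem labelled_eq {H : I → Finset ℕ} {loc σ : I → ℕ → ℕ} {a b : I} {i : Fin p}
    (h : labelled H loc σ a i = labelled H loc σ b i) :
    ({k ∈ H a | loc a k = i} : Finset ℕ) = {k ∈ H b | loc b k = i} ∧
      ∀ k ∈ H a, loc a k = i → σ a k = σ b k := by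
  have key : ∀ a b, labelled H loc σ a i = labelled H loc σ b i → ∀ k ∈ H a, loc a k = i →
      (k ∈ H b ∧ loc b k = i) ∧ σ a k = σ b k := by
    intro a b h k hk hki
    have h1 : Nat.pair k (σ a k) ∈ labelled H loc σ b i := by
      rw [← h]
      exact Finset.mem_image_of_mem (fun k => Nat.pair k (σ a k)) (Finset.mem_filter.2 ⟨hk, hki⟩)
    obtain ⟨k', hk', e⟩ := Finset.mem_image.1 h1
    obtain ⟨e1, e2⟩ := Nat.pair_eq_pair.1 e
    subst e1
    exact ⟨Finset.mem_filter.1 hk', e2.symm⟩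
  refine ⟨?_, fun k hk hki => (key a b h k hk hki).2⟩
  ext k
  simp only [Finset.mem_filter]
  exact ⟨fun hk => (key a b h k hk.1 hk.2).1, fun hk => (key b a h.symm k hk.1 hk.2).1⟩

/-- The number of items on the machines `l, …, r - 1` that have the digit `b`. -/
def digitCount (H : I → Finset ℕ) (loc : I → ℕ → ℕ) (dig : ℕ → ℕ) (a : I) (l r b : ℕ) : ℕ :=
  #{k ∈ H a | l ≤ loc a k ∧ loc a k < r ∧ dig k = b}

theorem digitCount_add (H : I → Finset ℕ) (loc : I → ℕ → ℕ) (dig : ℕ → ℕ) (a : I) {l m r : ℕ}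
    (h : l ≤ m) (h' : m ≤ r) (b : ℕ) :
    digitCount H loc dig a l r b = digitCount H loc dig a l m b + digitCount H loc dig a m r b := by
  unfold digitCount
  rw [← Finset.card_union_of_disjoint]
  · congr 1
    ext k
    simp only [Finset.mem_filter, Finset.mem_union, ← and_or_left]
    refine and_congr_right fun _ => ?_
    omega
  · refine Finset.disjoint_filter.2 fun k _ h1 h2 => ?_
    omega

theorem digitCount_own (H : I → Finset ℕ) (loc : I → ℕ → ℕ) (dig : ℕ → ℕ) (a : I) (i b : ℕ) :
    digitCount H loc dig a i (i + 1) b =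
      #{k ∈ ({k ∈ H a | loc a k = i} : Finset ℕ) | dig k = b} := by
  unfold digitCount
  congr 1
  ext k
  simp only [Finset.mem_filter, and_assoc]
  refine and_congr_right fun _ => ?_
  omega

/-- The position of an item after stable sorting by a digit. -/
theorem rankBy_lex_eq {H : I → Finset ℕ} {loc σ : I → ℕ → ℕ} {dig : ℕ → ℕ} {a : I}
    (hmono : ∀ k ∈ H a, ∀ k' ∈ H a, loc a k < loc a k' → σ a k < σ a k')
    (hloc : ∀ k ∈ H a, loc a k < p) {k : ℕ} (hk : k ∈ H a) :
    rankBy (fun k => toLex (dig k, σ a k)) (H a) k =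
      ∑ b ∈ Finset.range (dig k), digitCount H loc dig a 0 p b +
        (digitCount H loc dig a 0 (loc a k) (dig k) +
          #{k' ∈ {k' ∈ H a | loc a k' = loc a k} | dig k' = dig k ∧ σ a k' < σ a k}) := by
  unfold rankBy
  -- Three disjoint kinds of predecessors: smaller digit; same digit on an earlier machine; same
  -- digit on the same machine with smaller label. By `hmono`, items with the same digit on later
  -- machines do not precede `k`, and all those on earlier machines do, so counts per digit suffice.
  have h1 : ({k' ∈ H a | toLex (dig k', σ a k') < toLex (dig k, σ a k)} : Finset ℕ) =
      {k' ∈ H a | dig k' < dig k} ∪ ({k' ∈ H a | 0 ≤ loc a k' ∧ loc a k' < loc a k ∧ dig k' = dig k} ∪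
        {k' ∈ {k' ∈ H a | loc a k' = loc a k} | dig k' = dig k ∧ σ a k' < σ a k}) := by
    ext k'
    simp only [Finset.mem_filter, Finset.mem_union, Prod.Lex.toLex_lt_toLex]
    constructor
    · rintro ⟨hk', h | ⟨h, h'⟩⟩
      · exact Or.inl ⟨hk', h⟩
      · right
        rcases lt_trichotomy (loc a k') (loc a k) with hl | hl | hl
        · exact Or.inl ⟨hk', Nat.zero_le _, hl, h⟩
        · exact Or.inr ⟨⟨hk', hl⟩, h, h'⟩
        · exact absurd (hmono k hk k' hk' hl) (not_lt.2 h'.le)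
    · rintro (⟨hk', h⟩ | ⟨hk', _, hl, h⟩ | ⟨⟨hk', hl⟩, h, h'⟩)
      · exact ⟨hk', Or.inl h⟩
      · exact ⟨hk', Or.inr ⟨h, hmono k' hk' k hk hl⟩⟩
      · exact ⟨hk', Or.inr ⟨h, h'⟩⟩
  rw [h1, Finset.card_union_of_disjoint, Finset.card_union_of_disjoint]
  · congr 1
    rw [Finset.card_eq_sum_card_fiberwise (f := dig) (t := Finset.range (dig k))]
    · refine Finset.sum_congr rfl fun b hb => ?_
      rw [Finset.mem_range] at hb
      unfold digitCount
      congr 1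
      ext k'
      simp only [Finset.mem_filter]
      constructor
      · rintro ⟨⟨h1, h2⟩, h3⟩
        exact ⟨h1, Nat.zero_le _, hloc _ h1, h3⟩
      · rintro ⟨h1, _, _, h3⟩
        exact ⟨⟨h1, h3 ▸ hb⟩, h3⟩
    · intro k' hk'
      simpa using (Finset.mem_filter.1 (Finset.mem_coe.1 hk')).2
  · refine Finset.disjoint_left.2 fun k' h2 h3 => ?_
    simp only [Finset.mem_filter] at h2 h3
    omega
  · refine Finset.disjoint_left.2 fun k' h2 h3 => ?_
    simp only [Finset.mem_filter, Finset.mem_union] at h2 h3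
    omega

namespace Env

variable {S : Env I p δ} {α β : Type} {x : I → Fin p → α} {q D U Q L : ℕ}

/-- One pass of radix sort. -/
theorem Know.sortPass {T ℓ : ℕ} (cap : Capacity S q D U Q L) {H : I → Finset ℕ}
    {loc σ : I → ℕ → ℕ} {dig : ℕ → ℕ}
    (h : S.Know T fun a i => (x a i, labelled H loc σ a i))
    (hsmall : Small S.W ℓ fun a (i : Fin p) => (x a i, labelled H loc σ a i)) (hl : 2 * ℓ ≤ S.s)
    (hU : ∀ a, ∀ k ∈ H a, k < U) (hσ : ∀ a, Set.InjOn (σ a) (H a))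
    (hmono : ∀ a, ∀ k ∈ H a, ∀ k' ∈ H a, loc a k < loc a k' → σ a k < σ a k')
    (hloc : ∀ a, ∀ k ∈ H a, loc a k < p) (hdig : ∀ k, dig k < q)
    (hcard : ∀ a (i : Fin p), #{k ∈ H a | loc a k = i} ≤ 3 * S.s) :
    S.Know (T + (D + 33)) fun a i => (x a i,
      labelled H (fun a k => rankBy (fun k => toLex (dig k, σ a k)) (H a) k / L)
        (fun a => rankBy (fun k => toLex (dig k, σ a k)) (H a)) a i) := by
  set ρ : I → ℕ → ℕ := fun a => rankBy (fun k => toLex (dig k, σ a k)) (H a) with hρ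
  have hHU : ∀ a, #(H a) ≤ U := fun a => by
    rw [← Finset.card_range U]
    exact Finset.card_le_card fun k hk => Finset.mem_range.2 (hU a k hk)
  have hcount : ∀ a l r b, digitCount H loc dig a l r b ≤ U := fun a l r b =>
    (Finset.card_le_card (Finset.filter_subset _ _)).trans (hHU a)
  -- Only the `q` digits matter. Each count is sent together with its digit because sets of words
  -- carry no order.
  let E : (ℕ → ℕ) → Finset ℕ := fun f => (Finset.range q).image fun b => Nat.pair b (f b)
  have hEinj : ∀ a b l r, E (digitCount H loc dig a l r) = E (digitCount H loc dig b l r) →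
      digitCount H loc dig a l r = digitCount H loc dig b l r := by
    intro a b l r he
    funext c
    by_cases hc : c < q
    · have h1 : Nat.pair c (digitCount H loc dig a l r c) ∈ E (digitCount H loc dig b l r) := by
        rw [← he]
        exact Finset.mem_image_of_mem (fun c => Nat.pair c (digitCount H loc dig a l r c))
          (Finset.mem_range.2 hc)
      obtain ⟨c', _, e⟩ := Finset.mem_image.1 h1
      obtain ⟨e1, e2⟩ := Nat.pair_eq_pair.1 e
      subst e1
      exact e2.symm
    · have e : ∀ a, digitCount H loc dig a l r c = 0 := fun a => by
        refine Finset.card_eq_zero.2 (Finset.filter_false_of_mem fun k _ => ?_)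
        have := hdig k
        omega
      rw [e, e]
  have hEw : ∀ a l r, ∀ w ∈ E (digitCount H loc dig a l r), w < (U + 1) ^ 2 := by
    intro a l r w hw
    obtain ⟨c, hc, rfl⟩ := Finset.mem_image.1 hw
    exact pair_lt_sq ((Finset.mem_range.1 hc).le.trans cap.q_le_U) (hcount _ _ _ _)
  have hEc : ∀ a l r, #(E (digitCount H loc dig a l r)) ≤ q := fun a l r =>
    Finset.card_image_le.trans (by simp)
  have hscan := h.scan (q := q) (D := D) (B := q) hsmall (digitCount H loc dig) E
    (by
      intro i a b hab
      obtain ⟨h1, _⟩ := labelled_eq (congrArg Prod.snd hab)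
      funext c
      change digitCount H loc dig a i (i + 1) c = digitCount H loc dig b i (i + 1) c
      rw [digitCount_own, digitCount_own, h1])
    (by
      intro a b l
      funext c
      have e : ∀ a, digitCount H loc dig a l l c = 0 := fun a => by
        refine Finset.card_eq_zero.2 (Finset.filter_false_of_mem fun k _ => ?_)
        omega
      rw [e, e])
    (by
      intro a b l m r h1 h2 _ e1 e2
      funext c
      rw [digitCount_add H loc dig a h1 h2, digitCount_add H loc dig b h1 h2, e1, e2])
    (fun a b l r _ => hEinj a b l r)
    (fun a l r _ => hEc a l r) (fun a l r _ w hw => cap.two_mul_add_one_lt (hEw a l r w hw))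
    (by have := cap.two_le_q; omega) cap.p_le_pow
    (by have := cap.q_le; rw [mul_assoc]; omega)
  have hρinj : ∀ a, Set.InjOn (ρ a) (H a) := fun a => rankBy_injOn fun k hk k' hk' e => by
    have : (dig k, σ a k) = (dig k', σ a k') := toLex.injective e
    exact hσ a hk hk' (Prod.mk.inj this).2
  let out : I → Fin p → Fin p → Finset ℕ := fun a i j =>
    {k ∈ {k ∈ H a | loc a k = i} | ρ a k / L = j}.image fun k => Nat.pair k (ρ a k)
  have hdetρ : ∀ (i : Fin p) a b, (x a i, labelled H loc σ a i) = (x b i, labelled H loc σ b i) →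
      digitCount H loc dig a 0 i = digitCount H loc dig b 0 i →
      digitCount H loc dig a (i + 1) p = digitCount H loc dig b (i + 1) p →
      ∀ k ∈ H a, loc a k = i → ρ a k = ρ b k := by
    intro i a b hab e0 e1 k hk hki
    obtain ⟨h1, h2⟩ := labelled_eq (congrArg Prod.snd hab)
    have hkb : k ∈ H b ∧ loc b k = i := by
      have : k ∈ ({k ∈ H b | loc b k = i} : Finset ℕ) := by
        rw [← h1]; exact Finset.mem_filter.2 ⟨hk, hki⟩
      exact Finset.mem_filter.1 this
    have e2 : digitCount H loc dig a i (i + 1) = digitCount H loc dig b i (i + 1) := by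
      funext c
      rw [digitCount_own, digitCount_own, h1]
    -- The totals are the prefix, the own count and the suffix; this is why the scan has to provide
    -- both directions.
    have etot : ∀ c, digitCount H loc dig a 0 p c = digitCount H loc dig b 0 p c := by
      intro c
      have hi := i.2
      rw [digitCount_add H loc dig a (Nat.zero_le i) hi.le,
        digitCount_add H loc dig b (Nat.zero_le i) hi.le,
        digitCount_add H loc dig a (Nat.le_succ i) hi,
        digitCount_add H loc dig b (Nat.le_succ i) hi]
      rw [e0]
      have e1' := congrFun e1 c
      have e2' := congrFun e2 c
      simp only [Nat.succ_eq_add_one]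
      omega
    simp only [hρ]
    rw [rankBy_lex_eq (hmono a) (hloc a) hk, rankBy_lex_eq (hmono b) (hloc b) hkb.1, hki, hkb.2]
    simp only [etot, e0]
    congr 3
    rw [h1]
    refine Finset.filter_congr fun k' hk' => and_congr_right fun _ => ?_
    rw [← h1] at hk'
    obtain ⟨hk1, hk2⟩ := Finset.mem_filter.1 hk'
    rw [h2 k hk hki, h2 k' hk1 hk2]
  have hdetout : Det (fun a (i : Fin p) => ((x a i, labelled H loc σ a i),
      digitCount H loc dig a 0 i, digitCount H loc dig a (i + 1) p)) out := by
    intro i a b hab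
    have hab1 := congrArg (fun v => v.1) hab
    have hab2 := congrArg (fun v => v.2.1) hab
    have hab3 := congrArg (fun v => v.2.2) hab
    dsimp only at hab1 hab2 hab3
    have hd := hdetρ i a b hab1 hab2 hab3
    obtain ⟨h1, h2⟩ := labelled_eq (congrArg Prod.snd hab1)
    funext j
    simp only [out]
    rw [← h1]
    have e1 : ∀ k ∈ ({k ∈ H a | loc a k = i} : Finset ℕ), ρ a k = ρ b k := fun k hk =>
      hd k (Finset.mem_filter.1 hk).1 (Finset.mem_filter.1 hk).2
    have e2 : ({k ∈ {k ∈ H a | loc a k = i} | ρ a k / L = j} : Finset ℕ) =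
        {k ∈ {k ∈ H a | loc a k = i} | ρ b k / L = j} :=
      Finset.filter_congr fun k hk => by rw [e1 k hk]
    rw [← e2]
    refine Finset.image_congr fun k hk => ?_
    rw [e1 k (Finset.mem_filter.1 (Finset.mem_coe.1 hk)).1]
  have hsmF : ∀ f g : Fin p → ℕ, Small S.W (2 * q) fun a i => digitCount H loc dig a (f i) (g i) := by
    intro f g
    refine Small.of_det (x := fun a i => E (digitCount H loc dig a (f i) (g i)))
      (Small.of_words cap.two_le_W (fun a i w hw => ?_) fun a i => hEc _ _ _)
      fun i a b => hEinj _ _ _ _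
    have := cap.two_mul_add_one_lt (hEw _ _ _ w hw)
    omega
  have hsm2 := hsmall.pair ((hsmF (fun _ => 0) fun i => i).pair (hsmF (fun i => i + 1) fun _ => p))
  have hlenE : ∀ a i j, #(out a i j) ≤ #{k ∈ {k ∈ H a | loc a k = i} | ρ a k / L = j} :=
    fun a i j => Finset.card_image_le
  have hrecv : ∀ a j, ∑ i, #(out a i j) ≤ L := by
    intro a j
    refine (Finset.sum_le_sum fun i _ => hlenE a i j).trans ?_
    refine le_trans (Finset.sum_le_sum (g := fun i : Fin p =>
      #{k ∈ ({k ∈ H a | ρ a k / L = j} : Finset ℕ) | loc a k = i}) fun i _ => ?_) ?_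
    · refine le_of_eq (congrArg _ ?_)
      ext k
      simp only [Finset.mem_filter]
      tauto
    · exact (sum_card_filter_eq_le _ _).trans (card_filter_div_le (hρinj a) cap.one_le_L j)
  -- A machine may hold up to `3 * s` items, more words than it can send in one round, hence the
  -- `32` portions of `s / 8` words. Every receiver gets at most `L` items in total.
  have hsend : ∀ a i, ∑ j, #(out a i j) ≤ 32 * (S.s / 8) := by
    intro a i
    refine (Finset.sum_le_sum fun j _ => hlenE a i j).trans ((sum_card_filter_eq_le _ _).trans
      ((hcard a i).trans ?_))
    have := cap.L_le
    have := cap.one_le_L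
    omega
  have hρU : ∀ a, ∀ k ∈ H a, ρ a k ≤ U := fun a k hk => (rankBy_lt_card hk).le.trans (hHU a)
  have hqs : 1000 * q ≤ S.s := by
    have h1 := cap.q_le
    have h2 := Nat.mul_le_mul_right q cap.two_le_q
    omega
  have hLs := cap.L_le
  have hroute := hscan.route (b := S.s / 8) (r := L) 32 hsm2 hdetout cap.two_le_W
    (by
      intro a i j w hw
      obtain ⟨k, hk, rfl⟩ := Finset.mem_image.1 hw
      have hk := (Finset.mem_filter.1 (Finset.mem_filter.1 hk).1).1
      have := cap.two_mul_add_one_lt (pair_lt_sq (hU a k hk).le (hρU a k hk))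
      omega)
    hsend hrecv (by omega) (by omega)
  refine (hroute.det fun j a b hab => ?_).mono (by omega)
  have h1 := congrArg (fun v => v.1.1.1) hab
  have h2 := congrArg (fun v => v.2) hab
  dsimp only at h1 h2
  have hfull : ∀ a, Finset.univ.biUnion (fun i => out a i j) =
      labelled H (fun a k => ρ a k / L) ρ a j := by
    intro a
    ext w
    simp only [out, labelled, Finset.mem_biUnion, Finset.mem_univ, true_and, Finset.mem_image,
      Finset.mem_filter]
    constructor
    · rintro ⟨i, k, ⟨⟨hk, _⟩, hj⟩, rfl⟩
      exact ⟨k, ⟨hk, hj⟩, rfl⟩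
    · rintro ⟨k, ⟨hk, hj⟩, rfl⟩
      exact ⟨⟨loc a k, hloc a k hk⟩, k, ⟨⟨hk, rfl⟩, hj⟩, rfl⟩
  rw [hfull, hfull] at h2
  exact Prod.ext h1 h2

/-- The labels of the items after some passes of radix sort. -/
def radixLabel (H : I → Finset ℕ) (loc : I → ℕ → ℕ) (q U : ℕ) : ℕ → I → ℕ → ℕ
  | 0 => fun a k => loc a k * U + k
  | m + 1 => fun a =>
    rankBy (fun k => toLex (k / q ^ m % q, radixLabel H loc q U m a k)) (H a)

/-- Least significant digit first: sorting by the digit `m` with ties broken by the previous label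
refines the order modulo `q ^ m` to the order modulo `q ^ (m + 1)`. -/
theorem radixLabel_props {H : I → Finset ℕ} {loc : I → ℕ → ℕ} {q U : ℕ} (hq : 0 < q)
    (hU : ∀ a, ∀ k ∈ H a, k < U) (m : ℕ) (a : I) :
    Set.InjOn (radixLabel H loc q U m a) (H a) ∧ ∀ k ∈ H a, ∀ k' ∈ H a,
      k % q ^ m < k' % q ^ m → radixLabel H loc q U m a k < radixLabel H loc q U m a k' := by
  induction m with
  | zero =>
    refine ⟨fun k hk k' hk' e => ?_, fun k _ k' _ hlt => ?_⟩
    · have h1 := hU a k hk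
      have h2 := hU a k' hk'
      have e1 := congrArg (· % U) e
      simpa only [radixLabel, Nat.mul_add_mod_of_lt h1, Nat.mul_add_mod_of_lt h2] using e1
    · simp [Nat.mod_one] at hlt
  | succ m ih =>
    refine ⟨rankBy_injOn fun k hk k' hk' e => ?_, fun k hk k' hk' hlt => ?_⟩
    · exact ih.1 hk hk' (Prod.mk.inj (toLex.injective e)).2
    · refine rankBy_lt_rankBy hk ?_
      rw [Prod.Lex.toLex_lt_toLex]
      rw [Nat.mod_pow_succ, Nat.mod_pow_succ] at hlt
      rcases lt_trichotomy (k / q ^ m % q) (k' / q ^ m % q) with h | h | h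
      · exact Or.inl h
      · refine Or.inr ⟨h, ih.2 k hk k' hk' ?_⟩
        rw [h] at hlt
        omega
      · exfalso
        have h1 : k' % q ^ m < q ^ m := Nat.mod_lt _ (by positivity)
        have h2 : q ^ m * (k' / q ^ m % q + 1) ≤ q ^ m * (k / q ^ m % q) :=
          Nat.mul_le_mul_left _ h
        rw [Nat.mul_succ] at h2
        generalize k % q ^ m = A at *
        generalize k' % q ^ m = A' at *
        omega

/-- Sorting: items that are distributed arbitrarily over the machines get sorted, so that machine `i`
holds the items of rank `i * L, …, i * L + L - 1`, and knows their ranks. -/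
theorem Know.sort {T ℓ : ℕ} (cap : Capacity S q D U Q L) {X : I → Fin p → Finset ℕ}
    (h : S.Know T fun a i => (x a i, X a i))
    (hsmall : Small S.W ℓ fun a (i : Fin p) => (x a i, X a i)) (hl : 4 * ℓ ≤ S.s)
    (hdisj : ∀ a i j k, k ∈ X a i → k ∈ X a j → i = j) (H : I → Finset ℕ)
    (hX : ∀ a k, k ∈ H a ↔ ∃ i, k ∈ X a i) (hU : ∀ a, ∀ k ∈ H a, k < U)
    (hcard : ∀ a i, #(X a i) ≤ 3 * S.s) (hpL : ∀ a, #(H a) ≤ p * L) :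
    S.Know (T + Q * (D + 33)) fun a i => (x a i,
      labelled H (fun a k => rankBy id (H a) k / L) (fun a => rankBy id (H a)) a i) := by
  classical
  let loc : I → ℕ → ℕ := fun a k => if hk : ∃ i, k ∈ X a i then hk.choose else 0
  have hlocX : ∀ a (i : Fin p), ({k ∈ H a | loc a k = i} : Finset ℕ) = X a i := by
    intro a i
    ext k
    rw [Finset.mem_filter, hX]
    constructor
    · rintro ⟨hk, hi⟩
      simp only [loc, dif_pos hk] at hi
      rw [← Fin.ext hi]
      exact hk.choose_spec
    · intro hk
      have hex : ∃ i, k ∈ X a i := ⟨i, hk⟩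
      refine ⟨hex, ?_⟩
      simp only [loc, dif_pos hex]
      exact congrArg Fin.val (hdisj a _ _ k hex.choose_spec hk)
  have hlocp : ∀ a, ∀ k ∈ H a, loc a k < p := by
    intro a k hk
    have hex := (hX a k).1 hk
    simp only [loc, dif_pos hex]
    exact hex.choose.2
  set σ := radixLabel H loc q U with hσ
  have hq : 0 < q := by have := cap.two_le_q; omega
  have hL : 0 < L := cap.one_le_L
  have hLs := cap.L_le
  -- Before the first pass items lie wherever they were given; after each pass an item lies on the
  -- machine `rank / L`.
  let loc' : ℕ → I → ℕ → ℕ := fun m => match m with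
    | 0 => loc
    | m + 1 => fun a k => σ (m + 1) a k / L
  have hHU : ∀ a, #(H a) ≤ U := fun a => by
    rw [← Finset.card_range U]
    exact Finset.card_le_card fun k hk => Finset.mem_range.2 (hU a k hk)
  have hloc'p : ∀ m a, ∀ k ∈ H a, loc' m a k < p := by
    intro m a k hk
    cases m with
    | zero => exact hlocp a k hk
    | succ m =>
      refine Nat.div_lt_of_lt_mul ?_
      rw [mul_comm]
      exact (rankBy_lt_card hk).trans_le (hpL a)
  have hmono : ∀ m a, ∀ k ∈ H a, ∀ k' ∈ H a, loc' m a k < loc' m a k' → σ m a k < σ m a k' := by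
    intro m a k hk k' hk' hlt
    cases m with
    | zero =>
      have h1 := hU a k hk
      change loc a k < loc a k' at hlt
      change loc a k * U + k < loc a k' * U + k'
      have h2 : (loc a k + 1) * U ≤ loc a k' * U := Nat.mul_le_mul_right _ hlt
      rw [Nat.succ_mul] at h2
      omega
    | succ m =>
      exact lt_of_not_ge fun hle => absurd (Nat.div_le_div_right (c := L) hle) (not_le.2 hlt)
  have hlabX : Det (fun a i => (x a i, X a i)) fun a (i : Fin p) =>
      (x a i, labelled H (loc' 0) (σ 0) a i) := by
    intro i a b hab
    have h1 := congrArg (fun v => v.1) hab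
    have h2 := congrArg (fun v => v.2) hab
    dsimp only at h1 h2
    refine Prod.ext h1 ?_
    change labelled H loc (σ 0) a i = labelled H loc (σ 0) b i
    have e : ∀ a, labelled H loc (σ 0) a i = (X a i).image fun k => Nat.pair k (i * U + k) := by
      intro a
      unfold labelled
      rw [hlocX]
      refine Finset.image_congr fun k hk => ?_
      have : loc a k = i := by
        have : k ∈ ({k ∈ H a | loc a k = i} : Finset ℕ) := by rw [hlocX]; exact hk
        exact (Finset.mem_filter.1 this).2
      change Nat.pair k (loc a k * U + k) = _
      rw [this]
    rw [e, e, h2]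
  have hsmx : Small S.W ℓ x := hsmall.of_det Det.fst
  have hcard' : ∀ m a (i : Fin p), #{k ∈ H a | loc' (m + 1) a k = i} ≤ L := fun m a i =>
    card_filter_div_le (radixLabel_props hq hU (m + 1) a).1 hL i
  -- The initial labelled items cost nothing extra, being a function of `x` and `X`; afterwards a
  -- machine stores at most `L` labelled items.
  have hsmm : ∀ m, Small S.W (ℓ + 2 * L) fun a (i : Fin p) =>
      (x a i, labelled H (loc' m) (σ m) a i) := by
    intro m
    cases m with
    | zero => exact (hsmall.of_det hlabX).mono (by omega) (by have := cap.two_le_W; omega)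
    | succ m =>
      refine hsmx.pair (Small.of_words cap.two_le_W (fun a i w hw => ?_) fun a i =>
        Finset.card_image_le.trans (hcard' m a i))
      obtain ⟨k, hk, rfl⟩ := Finset.mem_image.1 hw
      have hk := (Finset.mem_filter.1 hk).1
      have hb : σ (m + 1) a k ≤ U := (rankBy_lt_card hk).le.trans (hHU a)
      have := cap.two_mul_add_one_lt (pair_lt_sq (hU a k hk).le hb)
      omega
  have key : ∀ m, S.Know (T + m * (D + 33)) fun a i =>
      (x a i, labelled H (loc' m) (σ m) a i) := by
    intro m
    induction m with
    | zero => rw [Nat.zero_mul]; exact h.det hlabX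
    | succ m ih =>
      have := ih.sortPass (dig := fun k => k / q ^ m % q) cap (hsmm m) (by omega) hU
        (fun a => (radixLabel_props hq hU m a).1) (hmono m) (hloc'p m)
        (fun k => Nat.mod_lt _ hq) (fun a i => by
          cases m with
          | zero =>
            change #{k ∈ H a | loc a k = i} ≤ _
            rw [hlocX]; exact hcard a i
          | succ m => exact (hcard' m a i).trans (by omega))
      rw [Nat.succ_mul, ← add_assoc]
      exact this
  obtain ⟨Q', hQ'⟩ : ∃ Q', Q = Q' + 1 := ⟨Q - 1, by have := cap.one_le_Q; omega⟩
  -- Since all items are below `U ≤ q ^ Q`, the order modulo `q ^ Q` is the usual order.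
  have hend : ∀ a, ∀ k ∈ H a, σ Q a k = rankBy id (H a) k := by
    intro a k hk
    have hlt : ∀ k ∈ H a, ∀ k' ∈ H a, k < k' → σ Q a k < σ Q a k' := by
      intro k hk k' hk' hlt
      refine (radixLabel_props hq hU Q a).2 k hk k' hk' ?_
      rw [Nat.mod_eq_of_lt ((hU a k hk).trans_le cap.U_le_pow),
        Nat.mod_eq_of_lt ((hU a k' hk').trans_le cap.U_le_pow)]
      exact hlt
    have hiff : ∀ k ∈ H a, ∀ k' ∈ H a, σ Q a k < σ Q a k' ↔ k < k' := by
      intro k hk k' hk'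
      refine ⟨fun hs => ?_, hlt k hk k' hk'⟩
      rcases lt_trichotomy k k' with hc | hc | hc
      · exact hc
      · rw [hc] at hs; exact absurd hs (lt_irrefl _)
      · exact absurd (hlt k' hk' k hk hc) (not_lt.2 hs.le)
    rw [hQ'] at hiff ⊢
    refine rankBy_congr fun k' hk' => ?_
    exact (rankBy_lt_iff (f := fun k => toLex (k / q ^ Q' % q, σ Q' a k)) hk').symm.trans
      (hiff k' hk' k hk)
  have hfin : ∀ a (i : Fin p), labelled H (loc' Q) (σ Q) a i =
      labelled H (fun a k => rankBy id (H a) k / L) (fun a => rankBy id (H a)) a i := by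
    intro a i
    unfold labelled
    have h1 : ({k ∈ H a | loc' Q a k = i} : Finset ℕ) =
        {k ∈ H a | rankBy id (H a) k / L = i} := by
      refine Finset.filter_congr fun k hk => ?_
      rw [← hend a k hk, hQ']
    rw [h1]
    refine Finset.image_congr fun k hk => ?_
    rw [hend a k (Finset.mem_filter.1 (Finset.mem_coe.1 hk)).1]
  simpa only [hfin] using key Q

end Env

end MPC

/-! ### Vertices and darts laid out in sorted order, and the quantities on it that can be scanned.
-/

namespace MPC

variable {I δ : Type} {p n : ℕ}

open Classical in
/-- The ordered pairs of adjacent vertices. -/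
noncomputable def darts (G : SimpleGraph (Fin n)) : Finset (Fin n × Fin n) := {e | G.Adj e.1 e.2}

theorem mem_darts {G : SimpleGraph (Fin n)} {e : Fin n × Fin n} : e ∈ darts G ↔ G.Adj e.1 e.2 := by
  simp [darts]

theorem card_darts_le (G : SimpleGraph (Fin n)) : #(darts G) ≤ n * n :=
  (Finset.card_le_univ _).trans (by simp)

/-- An arrangement of the vertices and the darts of the graphs `G a` on the machines, where the dart
`(v, u)` is on the machine `mach a v u` and the vertex `v` on the machine `head a v`. Each vertex is
followed by the darts that begin in it. -/
structure Layout (G : I → SimpleGraph (Fin n)) (p L : ℕ) where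
  mach : I → Fin n → Fin n → ℕ
  head : I → Fin n → ℕ
  mach_lt : ∀ a v u, (G a).Adj v u → mach a v u < p
  head_lt : ∀ a v, head a v < p
  head_mono : ∀ a v v', v ≤ v' → head a v ≤ head a v'
  mach_le_head : ∀ a v u v', (G a).Adj v u → v < v' → mach a v u ≤ head a v'
  head_le_mach : ∀ a v v' u', (G a).Adj v' u' → v ≤ v' → head a v ≤ mach a v' u'
  card_mach : ∀ a i, #{e ∈ darts (G a) | mach a e.1 e.2 = i} ≤ L
  card_head : ∀ a i, #{v | head a v = i} ≤ L

namespace Layout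

variable {G : I → SimpleGraph (Fin n)} {L : ℕ} (Y : Layout G p L)

/-- The darts on a machine, together with the machines of the reversed darts. -/
noncomputable def dartsAt (a : I) (i : Fin p) : Finset ((Fin n × Fin n) × ℕ) :=
  {e ∈ darts (G a) | Y.mach a e.1 e.2 = i}.image fun e => (e, Y.mach a e.2 e.1)

/-- The vertices on a machine. -/
def headsAt (a : I) (i : Fin p) : Finset (Fin n) := {v | Y.head a v = i}

/-- The vertices of `A a` on a machine. -/
def own (A : I → Finset (Fin n)) (a : I) (i : Fin p) : Finset (Fin n) := {v ∈ A a | Y.head a v = i}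

/-- The darts of `E a` on a machine, together with the machines of their first vertices. -/
noncomputable def edgesAt (E : I → Finset (Fin n × Fin n)) (a : I) (i : Fin p) :
    Finset ((Fin n × Fin n) × ℕ) :=
  {e ∈ E a | Y.mach a e.1 e.2 = i}.image fun e => (e, Y.head a e.1)

variable {Y}

theorem dartsAt_eq {a b : I} {i : Fin p} (h : Y.dartsAt a i = Y.dartsAt b i) {v u : Fin n}
    (hvu : (G a).Adj v u) (hi : Y.mach a v u = i) :
    ((G b).Adj v u ∧ Y.mach b v u = i) ∧ Y.mach a u v = Y.mach b u v := by
  have h1 : ((v, u), Y.mach a u v) ∈ Y.dartsAt b i := by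
    rw [← h]
    exact Finset.mem_image_of_mem (fun e : Fin n × Fin n => (e, Y.mach a e.2 e.1))
      (Finset.mem_filter.2 ⟨mem_darts.2 hvu, hi⟩)
  obtain ⟨e, he, e1⟩ := Finset.mem_image.1 h1
  obtain ⟨e1, e2⟩ := Prod.mk.inj e1
  subst e1
  obtain ⟨he1, he2⟩ := Finset.mem_filter.1 he
  exact ⟨⟨mem_darts.1 he1, he2⟩, e2.symm⟩

theorem headsAt_eq {a b : I} {i : Fin p} (h : Y.headsAt a i = Y.headsAt b i) {v : Fin n} :
    Y.head a v = i ↔ Y.head b v = i := by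
  have := Finset.ext_iff.1 h v
  simpa [headsAt] using this

theorem own_eq {A : I → Finset (Fin n)} {a b : I} {i : Fin p} (h : Y.own A a i = Y.own A b i)
    {v : Fin n} : v ∈ A a ∧ Y.head a v = i ↔ v ∈ A b ∧ Y.head b v = i := by
  have := Finset.ext_iff.1 h v
  simpa [own] using this

theorem edgesAt_eq {E : I → Finset (Fin n × Fin n)} {a b : I} {i : Fin p}
    (h : Y.edgesAt E a i = Y.edgesAt E b i) {e : Fin n × Fin n} (he : e ∈ E a)
    (hi : Y.mach a e.1 e.2 = i) :
    (e ∈ E b ∧ Y.mach b e.1 e.2 = i) ∧ Y.head a e.1 = Y.head b e.1 := by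
  have h1 : (e, Y.head a e.1) ∈ Y.edgesAt E b i := by
    rw [← h]
    exact Finset.mem_image_of_mem (fun e : Fin n × Fin n => (e, Y.head a e.1))
      (Finset.mem_filter.2 ⟨he, hi⟩)
  obtain ⟨e', he', e1⟩ := Finset.mem_image.1 h1
  obtain ⟨e1, e2⟩ := Prod.mk.inj e1
  subst e1
  exact ⟨Finset.mem_filter.1 he', e2.symm⟩

theorem edgesAt_ext {E : I → Finset (Fin n × Fin n)} {a b : I} {i : Fin p}
    (h1 : ∀ e, e ∈ E a ∧ Y.mach a e.1 e.2 = i ↔ e ∈ E b ∧ Y.mach b e.1 e.2 = i)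
    (h2 : ∀ e ∈ E a, Y.mach a e.1 e.2 = i → Y.head a e.1 = Y.head b e.1) :
    Y.edgesAt E a i = Y.edgesAt E b i := by
  unfold edgesAt
  have e1 : ({e ∈ E a | Y.mach a e.1 e.2 = i} : Finset _) = {e ∈ E b | Y.mach b e.1 e.2 = i} := by
    ext e
    simpa only [Finset.mem_filter] using h1 e
  rw [← e1]
  refine Finset.image_congr fun e he => ?_
  obtain ⟨he1, he2⟩ := Finset.mem_filter.1 (Finset.mem_coe.1 he)
  simp only [h2 e he1 he2]

theorem small_own {W : ℕ} (hW : 2 ≤ W) (hn : n ≤ W) (A : I → Finset (Fin n)) :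
    Small W (2 * L) (Y.own A) := by
  refine Small.of_det (x := fun a i => (Y.own A a i).image Fin.val) (Small.of_words hW ?_ ?_) ?_
  · intro a i w hw
    obtain ⟨v, _, rfl⟩ := Finset.mem_image.1 hw
    omega
  · intro a i
    refine Finset.card_image_le.trans ((Finset.card_le_card ?_).trans (Y.card_head a i))
    exact Finset.filter_subset_filter _ (Finset.subset_univ _)
  · intro i a b h
    exact Finset.image_injective Fin.val_injective h

theorem small_edgesAt {W U : ℕ} (hW : 2 ≤ W) (hnU : n ≤ U) (hp : p ≤ U) (hUW : (U + 1) ^ 4 ≤ W)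
    {E : I → Finset (Fin n × Fin n)} (hE : ∀ a, E a ⊆ darts (G a)) :
    Small W (2 * L) (Y.edgesAt E) := by
  have hinj : Function.Injective fun e : (Fin n × Fin n) × ℕ =>
      Nat.pair (Nat.pair e.1.1 e.1.2) e.2 := by
    intro e e' h
    obtain ⟨h1, h2⟩ := Nat.pair_eq_pair.1 h
    obtain ⟨h3, h4⟩ := Nat.pair_eq_pair.1 h1
    exact Prod.ext (Prod.ext (Fin.ext h3) (Fin.ext h4)) h2
  refine Small.of_det (x := fun a i => (Y.edgesAt E a i).image fun e =>
    Nat.pair (Nat.pair e.1.1 e.1.2) e.2) (Small.of_words hW ?_ ?_) ?_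
  · intro a i w hw
    obtain ⟨v, hv, rfl⟩ := Finset.mem_image.1 hw
    obtain ⟨e, _, rfl⟩ := Finset.mem_image.1 hv
    refine lt_of_lt_of_le ?_ hUW
    have h1 : Nat.pair (e.1 : ℕ) e.2 < (U + 1) ^ 2 := pair_lt_sq (by omega) (by omega)
    have h2 := Y.head_lt a e.1
    have h3 : U < (U + 1) ^ 2 := by nlinarith
    refine (pair_lt_sq (U := (U + 1) ^ 2 - 1) 
      (Nat.le_sub_one_of_lt h1) ?_).trans_eq ?_
    · change Y.head a e.1 ≤ _
      omega
    · rw [Nat.sub_add_cancel (by omega), ← pow_mul]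
  · intro a i
    refine Finset.card_image_le.trans (Finset.card_image_le.trans
      ((Finset.card_le_card ?_).trans (Y.card_mach a i)))
    exact Finset.filter_subset_filter _ (hE a)
  · intro i a b h
    exact Finset.image_injective hinj h

/-- The last of the vertices on the machines `l, …, r - 1`. -/
noncomputable def lastHead (Y : Layout G p L) (a : I) (l r : ℕ) : Finset (Fin n) :=
  {v | (l ≤ Y.head a v ∧ Y.head a v < r) ∧ ∀ v', l ≤ Y.head a v' → Y.head a v' < r → v' ≤ v}

theorem card_lastHead_le (a : I) (l r : ℕ) : #(Y.lastHead a l r) ≤ 1 := by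
  refine Finset.card_le_one.2 fun v hv v' hv' => ?_
  obtain ⟨h1, h2⟩ := (Finset.mem_filter.1 hv).2
  obtain ⟨h3, h4⟩ := (Finset.mem_filter.1 hv').2
  exact le_antisymm (h4 v h1.1 h1.2) (h2 v' h3.1 h3.2)

theorem exists_mem_lastHead {a : I} {l r : ℕ} {v : Fin n} (h1 : l ≤ Y.head a v)
    (h2 : Y.head a v < r) : (Y.lastHead a l r).Nonempty := by
  obtain ⟨w, hw, hmax⟩ := Finset.exists_max_image
    ({v | l ≤ Y.head a v ∧ Y.head a v < r} : Finset (Fin n)) id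
    ⟨v, Finset.mem_filter.2 ⟨Finset.mem_univ _, h1, h2⟩⟩
  refine ⟨w, Finset.mem_filter.2 ⟨Finset.mem_univ _, (Finset.mem_filter.1 hw).2, ?_⟩⟩
  exact fun v' h3 h4 => hmax v' (Finset.mem_filter.2 ⟨Finset.mem_univ _, h3, h4⟩)

theorem lt_of_head_lt {a : I} {v v' : Fin n} (h : Y.head a v < Y.head a v') : v < v' := by
  by_contra hle
  exact absurd (Y.head_mono a v' v (not_lt.1 hle)) (not_le.2 h)

/-- The order on machines agrees with the order on vertices, so a vertex in the right interval beats
all in the left one. This is the form of concatenation that `Env.Know.scan` requires. -/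
theorem lastHead_concat (a : I) {l m r : ℕ} (hlm : l ≤ m) (hmr : m ≤ r) :
    Y.lastHead a l r =
      if (Y.lastHead a m r).Nonempty then Y.lastHead a m r else Y.lastHead a l m := by
  split_ifs with h
  · obtain ⟨v, hv⟩ := h
    obtain ⟨hv1, hv2⟩ := (Finset.mem_filter.1 hv).2
    ext w
    simp only [lastHead, Finset.mem_filter, Finset.mem_univ, true_and]
    constructor
    · rintro ⟨⟨h1, h2⟩, h3⟩
      refine ⟨⟨?_, h2⟩, fun v' h4 h5 => h3 v' (by omega) h5⟩
      by_contra hlt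
      have := h3 v (by omega) hv1.2
      exact absurd (lt_of_head_lt (Y := Y) (a := a) (v := w) (v' := v) (by omega)) (not_lt.2 this)
    · rintro ⟨⟨h1, h2⟩, h3⟩
      refine ⟨⟨by omega, h2⟩, fun v' h4 h5 => ?_⟩
      by_cases h6 : m ≤ Y.head a v'
      · exact h3 v' h6 h5
      · exact (lt_of_head_lt (Y := Y) (a := a) (by omega)).le
  · have hno : ∀ v, m ≤ Y.head a v → ¬ Y.head a v < r := fun v h1 h2 => h (exists_mem_lastHead h1 h2)
    have hiff : ∀ v, (l ≤ Y.head a v ∧ Y.head a v < r) ↔ (l ≤ Y.head a v ∧ Y.head a v < m) := by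
      intro v
      have := hno v
      constructor <;> intro h1 <;> refine ⟨h1.1, ?_⟩
      · by_contra h2
        exact this (not_lt.1 h2) h1.2
      · omega
    ext w
    simp only [lastHead, Finset.mem_filter, Finset.mem_univ, true_and, hiff]
    refine and_congr_right fun _ => forall_congr' fun v' => ?_
    have := hiff v'
    tauto

/-- The first vertex of a dart is on the same machine or is the last vertex before. -/
theorem mem_lastHead_of_dart {a : I} {v u : Fin n} (h : (G a).Adj v u)
    (hne : Y.head a v ≠ Y.mach a v u) : v ∈ Y.lastHead a 0 (Y.mach a v u) := by
  have h1 := Y.head_le_mach a v v u h le_rfl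
  refine Finset.mem_filter.2 ⟨Finset.mem_univ _, ⟨Nat.zero_le _, by omega⟩, fun v' _ h3 => ?_⟩
  by_contra hlt
  exact absurd (Y.mach_le_head a v u v' h (not_le.1 hlt)) (not_le.2 h3)

/-- The number of darts of `E a` on the machines `l, …, r - 1` before the first vertex on one of these
machines, and whether there is such a vertex. -/
noncomputable def countBefore (Y : Layout G p L) (E : I → Finset (Fin n × Fin n)) (a : I)
    (l r : ℕ) : ℕ × ℕ :=
  (#{e ∈ E a | (l ≤ Y.mach a e.1 e.2 ∧ Y.mach a e.1 e.2 < r) ∧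
      ∀ v', l ≤ Y.head a v' → Y.head a v' < r → e.1 < v'},
    if (Y.lastHead a l r).Nonempty then 1 else 0)

theorem lastHead_nonempty_iff {a : I} {l r : ℕ} :
    (Y.lastHead a l r).Nonempty ↔ ∃ v, l ≤ Y.head a v ∧ Y.head a v < r :=
  ⟨fun ⟨v, hv⟩ => ⟨v, (Finset.mem_filter.1 hv).2.1⟩, fun ⟨_, h1, h2⟩ => exists_mem_lastHead h1 h2⟩

/-- A segmented sum: once a vertex occurs in the left interval, the darts of the right interval no
longer come before the first vertex, so the flag stops the addition. -/
theorem countBefore_concat {E : I → Finset (Fin n × Fin n)} (hE : ∀ a, E a ⊆ darts (G a)) (a : I)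
    {l m r : ℕ} (hlm : l ≤ m) (hmr : m ≤ r) :
    Y.countBefore E a l r =
      (if (Y.countBefore E a l m).2 = 1 then (Y.countBefore E a l m).1
        else (Y.countBefore E a l m).1 + (Y.countBefore E a m r).1,
      max (Y.countBefore E a l m).2 (Y.countBefore E a m r).2) := by
  have hadj : ∀ e ∈ E a, (G a).Adj e.1 e.2 := fun e he => mem_darts.1 (hE a he)
  refine Prod.ext ?_ ?_
  · simp only [countBefore]
    split_ifs with h hh hh
    · obtain ⟨v, hv1, hv2⟩ := lastHead_nonempty_iff.1 h
      congr 1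
      refine Finset.filter_congr fun e he => ?_
      constructor
      · rintro ⟨⟨h1, h2⟩, h3⟩
        refine ⟨⟨h1, ?_⟩, fun v' h4 h5 => h3 v' h4 (by omega)⟩
        have := h3 v hv1 (by omega)
        have := Y.mach_le_head a e.1 e.2 v (hadj e he) this
        omega
      · rintro ⟨⟨h1, h2⟩, h3⟩
        refine ⟨⟨h1, by omega⟩, fun v' h4 h5 => ?_⟩
        by_contra hle
        have := Y.head_le_mach a v' e.1 e.2 (hadj e he) (not_lt.1 hle)
        exact hle (h3 v' h4 (by omega))
    · exact absurd rfl hh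
    · exact absurd hh (by norm_num)
    · have hno : ∀ v, l ≤ Y.head a v → ¬ Y.head a v < m := fun v h1 h2 =>
        h (exists_mem_lastHead h1 h2)
      rw [← Finset.card_union_of_disjoint]
      · congr 1
        ext e
        simp only [Finset.mem_filter, Finset.mem_union, ← and_or_left]
        refine and_congr_right fun he => ?_
        constructor
        · rintro ⟨⟨h1, h2⟩, h3⟩
          by_cases h4 : Y.mach a e.1 e.2 < m
          · exact Or.inl ⟨⟨h1, h4⟩, fun v' h5 h6 => absurd h6 (hno v' h5)⟩
          · exact Or.inr ⟨⟨not_lt.1 h4, h2⟩, fun v' h5 h6 => h3 v' (by omega) h6⟩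
        · rintro (⟨⟨h1, h2⟩, h3⟩ | ⟨⟨h1, h2⟩, h3⟩)
          · refine ⟨⟨h1, by omega⟩, fun v' h4 h5 => ?_⟩
            by_contra hle
            have := Y.head_le_mach a v' e.1 e.2 (hadj e he) (not_lt.1 hle)
            exact hno v' h4 (by omega)
          · refine ⟨⟨by omega, h2⟩, fun v' h4 h5 => h3 v' ?_ h5⟩
            exact not_lt.1 fun h6 => hno v' h4 h6
      · refine Finset.disjoint_filter.2 fun e _ h1 h2 => ?_
        omega
  · simp only [countBefore, lastHead_nonempty_iff]
    have : (∃ v, l ≤ Y.head a v ∧ Y.head a v < r) ↔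
        (∃ v, l ≤ Y.head a v ∧ Y.head a v < m) ∨ ∃ v, m ≤ Y.head a v ∧ Y.head a v < r := by
      constructor
      · rintro ⟨v, h1, h2⟩
        by_cases h3 : Y.head a v < m
        · exact Or.inl ⟨v, h1, h3⟩
        · exact Or.inr ⟨v, not_lt.1 h3, h2⟩
      · rintro (⟨v, h1, h2⟩ | ⟨v, h1, h2⟩)
        · exact ⟨v, h1, by omega⟩
        · exact ⟨v, by omega, h2⟩
    simp only [this]
    by_cases h1 : ∃ v, l ≤ Y.head a v ∧ Y.head a v < m <;>
      by_cases h2 : ∃ v, m ≤ Y.head a v ∧ Y.head a v < r <;> simp [h1, h2]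

open Classical in
/-- The degree of a vertex, from the darts on its machine and the darts on later machines before the
next vertex. -/
theorem card_dart_eq {E : I → Finset (Fin n × Fin n)} (hE : ∀ a, E a ⊆ darts (G a)) (a : I)
    (v : Fin n) :
    #{e ∈ E a | e.1 = v} = #{e ∈ E a | Y.mach a e.1 e.2 = Y.head a v ∧ e.1 = v} +
      if ∀ v', Y.head a v' = Y.head a v → v' ≤ v then
        (Y.countBefore E a (Y.head a v + 1) p).1 else 0 := by
  have hadj : ∀ e ∈ E a, (G a).Adj e.1 e.2 := fun e he => mem_darts.1 (hE a he)
  have hge : ∀ e ∈ E a, e.1 = v → Y.head a v ≤ Y.mach a e.1 e.2 := by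
    rintro e he rfl
    exact Y.head_le_mach a _ _ _ (hadj e he) le_rfl
  split_ifs with hmax
  · simp only [countBefore]
    rw [← Finset.card_union_of_disjoint]
    · congr 1
      ext e
      simp only [Finset.mem_filter, Finset.mem_union, ← and_or_left]
      refine and_congr_right fun he => ?_
      constructor
      · intro hev
        rcases (hge e he hev).eq_or_lt with h1 | h1
        · exact Or.inl ⟨h1.symm, hev⟩
        · refine Or.inr ⟨⟨h1, Y.mach_lt a _ _ (hadj e he)⟩, fun v' h2 _ => ?_⟩
          rw [hev]
          exact lt_of_head_lt (Y := Y) (a := a) h2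
      · rintro (⟨_, h⟩ | ⟨⟨h1, h2⟩, h3⟩)
        · exact h
        · refine le_antisymm ?_ ?_
          · by_contra hlt
            have h4 : v < e.1 := not_le.1 hlt
            have h5 := Y.head_mono a v e.1 h4.le
            rcases h5.eq_or_lt with h6 | h6
            · exact hlt (hmax e.1 h6.symm)
            · exact lt_irrefl _ (h3 e.1 h6 (Y.head_lt a _))
          · by_contra hlt
            have := Y.mach_le_head a e.1 e.2 v (hadj e he) (not_le.1 hlt)
            omega
    · refine Finset.disjoint_filter.2 fun e _ h1 h2 => ?_
      omega
  -- A later vertex on the same machine follows all darts of `v`, so none of them is on a later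
  -- machine.
  · push Not at hmax
    obtain ⟨v', hv', hlt⟩ := hmax
    rw [Nat.add_zero]
    congr 1
    refine Finset.filter_congr fun e he => ?_
    refine ⟨fun hev => ⟨le_antisymm ?_ (hge e he hev), hev⟩, fun h => h.2⟩
    rw [← hv']
    exact Y.mach_le_head a e.1 e.2 v' (hadj e he) (by rw [hev]; exact hlt)

end Layout

end MPC

/-! ### Telling darts about their vertices and vertices about their degrees. -/

namespace MPC

variable {I δ α : Type} {p n : ℕ}

/-- The machines know the layout, and the memory is large compared to what they know. -/
structure Room (S : Env I p δ) {G : I → SimpleGraph (Fin n)} {L : ℕ} (Y : Layout G p L)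
    (x : I → Fin p → α) (q D U Q m ℓ : ℕ) : Prop where
  cap : Capacity S q D U Q L
  n_le : n ≤ m
  p_le : p ≤ m
  pow_le : (m + 1) ^ 4 ≤ U
  dartsAt : Det x Y.dartsAt
  headsAt : Det x Y.headsAt
  small : Small S.W ℓ x
  le_s : 100 * ℓ ≤ S.s

section Rank

variable {S : Env I p δ} {G : I → SimpleGraph (Fin n)} {L q D U Q m ℓ : ℕ} {Y : Layout G p L}
  {x : I → Fin p → α} {A : I → Finset (Fin n)}

theorem Room.lt_U (R : Room S Y x q D U Q m ℓ) : 2 * m + 1 < U := by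
  rcases Nat.eq_zero_or_pos m with rfl | hm
  · have := R.cap.four_le_U
    omega
  · refine lt_of_lt_of_le ?_ R.pow_le
    have h2 : (m + 1) ^ 2 ≤ (m + 1) ^ 4 := Nat.pow_le_pow_right (by omega) (by norm_num)
    nlinarith

theorem Room.sq_lt_U (R : Room S Y x q D U Q m ℓ) : n * n < U := by
  refine lt_of_lt_of_le ?_ R.pow_le
  have h1 : n * n ≤ m * m := Nat.mul_le_mul R.n_le R.n_le
  have h2 : (m + 1) ^ 2 ≤ (m + 1) ^ 4 := Nat.pow_le_pow_right (by omega) (by norm_num)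
  nlinarith

theorem Room.small_own (R : Room S Y x q D U Q m ℓ) (A : I → Finset (Fin n)) :
    Small S.W (2 * L) (Y.own A) := by
  refine Layout.small_own R.cap.two_le_W ?_ A
  have h1 := R.lt_U
  have h2 := R.n_le
  have h3 := R.cap.two_mul_add_one_lt (w := U) (by nlinarith)
  omega

theorem Room.small_edgesAt (R : Room S Y x q D U Q m ℓ) {E : I → Finset (Fin n × Fin n)}
    (hE : ∀ a, E a ⊆ darts (G a)) : Small S.W (2 * L) (Y.edgesAt E) := by
  refine Layout.small_edgesAt R.cap.two_le_W R.n_le R.p_le ?_ hE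
  refine R.pow_le.trans (le_trans ?_ R.cap.pow_le_W)
  exact Nat.le_self_pow (by norm_num) U

theorem Room.pair_word (R : Room S Y x q D U Q m ℓ) {b c : ℕ} (hb : b ≤ U) (hc : c ≤ U) :
    2 * Nat.pair b c + 1 < S.W := R.cap.two_mul_add_one_lt (pair_lt_sq hb hc)

/-- The darts that begin in a vertex of `A a`. -/
noncomputable def halfLive (G : I → SimpleGraph (Fin n)) (A : I → Finset (Fin n)) (a : I) :
    Finset (Fin n × Fin n) := {e ∈ darts (G a) | e.1 ∈ A a}

/-- The darts inside `A a`. -/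
noncomputable def live (G : I → SimpleGraph (Fin n)) (A : I → Finset (Fin n)) (a : I) :
    Finset (Fin n × Fin n) := {e ∈ darts (G a) | e.1 ∈ A a ∧ e.2 ∈ A a}

theorem halfLive_subset (a : I) : halfLive G A a ⊆ darts (G a) := Finset.filter_subset _ _

theorem live_subset (a : I) : live G A a ⊆ darts (G a) := Finset.filter_subset _ _

/-- If a dart is not on the machine of its first vertex, this vertex is the last one on all earlier
machines. Hence one prefix scan of the last vertex, with its membership in `A` and its machine,
informs all darts. -/
theorem Env.Know.halfLive {T : ℕ} (R : Room S Y x q D U Q m ℓ)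
    (h : S.Know T fun a i => (x a i, Y.own A a i)) :
    S.Know (T + (D + 1)) fun a i => ((x a i, Y.own A a i), Y.edgesAt (halfLive G A) a i) := by
  classical
  have hsm : Small S.W (ℓ + 2 * L) fun a i => (x a i, Y.own A a i) := R.small.pair (R.small_own A)
  have hLs := R.cap.L_le
  have hqs := R.cap.q_le
  have hls := R.le_s
  have hqq : q ≤ q * q := Nat.le_mul_self q
  -- Membership is the parity bit. The machine of the vertex is included because `edgesAt` records
  -- it for each dart.
  let bit : I → Fin n → ℕ := fun a v => Nat.pair (Y.head a v) (2 * v + if v ∈ A a then 1 else 0)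
  have hbit : ∀ a v b w, bit a v = bit b w →
      v = w ∧ Y.head a v = Y.head b w ∧ (v ∈ A a ↔ w ∈ A b) := by
    intro a v b w hvw
    obtain ⟨h1, h2⟩ := Nat.pair_eq_pair.1 hvw
    have h3 : (v : ℕ) = w := by split_ifs at h2 <;> omega
    refine ⟨Fin.ext h3, h1, ?_⟩
    split_ifs at h2 <;> first | omega | simp_all
  have hscan := h.scan (D := D) (q := q) (B := 1) hsm
    (fun a l r => (Y.lastHead a l r).image (bit a)) id ?_ ?_ ?_ ?_ ?_ ?_
    (by have := R.cap.two_le_q; omega) R.cap.p_le_pow (by omega)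
  · refine hscan.det ?_
    intro i a b hab
    have e1 : x a i = x b i := congrArg (fun z => z.1.1) hab
    have e2 : Y.own A a i = Y.own A b i := congrArg (fun z => z.1.2) hab
    have e3 : (Y.lastHead a 0 i).image (bit a) = (Y.lastHead b 0 i).image (bit b) :=
      congrArg (fun z => z.2.1) hab
    have hd := R.dartsAt i a b e1
    have hh := R.headsAt i a b e1
    have key : ∀ a b, x a i = x b i → Y.own A a i = Y.own A b i →
        (Y.lastHead a 0 i).image (bit a) = (Y.lastHead b 0 i).image (bit b) →
        ∀ v u, (G a).Adj v u → Y.mach a v u = i →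
        Y.head a v = Y.head b v ∧ (v ∈ A a → v ∈ A b) := by
      intro a b e1 e2 e3 v u hvu hi
      by_cases hv : Y.head a v = i
      · have h1 := (Layout.headsAt_eq (R.headsAt i a b e1)).1 hv
        exact ⟨hv.trans h1.symm, fun hA => ((Layout.own_eq e2).1 ⟨hA, hv⟩).1⟩
      · have h1 := Y.mem_lastHead_of_dart hvu (by rw [hi]; exact hv)
        rw [hi] at h1
        have h2 : bit a v ∈ (Y.lastHead b 0 i).image (bit b) := by
          rw [← e3]; exact Finset.mem_image_of_mem _ h1
        obtain ⟨w, hw, e⟩ := Finset.mem_image.1 h2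
        obtain ⟨rfl, h3, h4⟩ := hbit _ _ _ _ e
        exact ⟨h3.symm, h4.2⟩
    refine Prod.ext (Prod.ext e1 e2) (Layout.edgesAt_ext ?_ ?_)
    · rintro ⟨v, u⟩
      constructor
      · rintro ⟨h1, hi⟩
        obtain ⟨h1, h2⟩ := Finset.mem_filter.1 h1
        have h1 := mem_darts.1 h1
        obtain ⟨h3, -⟩ := Layout.dartsAt_eq hd h1 hi
        exact ⟨Finset.mem_filter.2 ⟨mem_darts.2 h3.1, (key a b e1 e2 e3 v u h1 hi).2 h2⟩, h3.2⟩
      · rintro ⟨h1, hi⟩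
        obtain ⟨h1, h2⟩ := Finset.mem_filter.1 h1
        have h1 := mem_darts.1 h1
        obtain ⟨h3, -⟩ := Layout.dartsAt_eq hd.symm h1 hi
        exact ⟨Finset.mem_filter.2 ⟨mem_darts.2 h3.1,
          (key b a e1.symm e2.symm e3.symm v u h1 hi).2 h2⟩, h3.2⟩
    · rintro ⟨v, u⟩ h1 hi
      exact (key a b e1 e2 e3 v u (mem_darts.1 (Finset.mem_filter.1 h1).1) hi).1
  · intro i a b hab
    have e1 : x a i = x b i := congrArg (fun z => z.1) hab
    have e2 : Y.own A a i = Y.own A b i := congrArg (fun z => z.2) hab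
    have hh : ∀ v, Y.head a v = i ↔ Y.head b v = i := fun v =>
      Layout.headsAt_eq (R.headsAt i a b e1)
    have hl : Y.lastHead a i (i + 1) = Y.lastHead b i (i + 1) := by
      unfold Layout.lastHead
      have hiff : ∀ a v, (i : ℕ) ≤ Y.head a v ∧ Y.head a v < i + 1 ↔ Y.head a v = i := by
        intro a v; omega
      simp only [hiff, ← and_imp, hh]
    change Finset.image _ _ = Finset.image _ _
    rw [hl]
    refine Finset.image_congr fun v hv => ?_
    have hv := (Finset.mem_filter.1 (Finset.mem_coe.1 hv)).2.1
    have h1 : Y.head b v = i := by omega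
    have h2 := (hh v).2 h1
    have h3 : v ∈ A a ↔ v ∈ A b := by
      have := Layout.own_eq e2 (v := v)
      simpa [h1, h2] using this
    simp only [bit, h1, h2, h3]
  · intro a b l
    have : ∀ a, Y.lastHead a l l = ∅ := fun a => Finset.filter_false_of_mem fun v _ => by omega
    simp only [this, Finset.image_empty]
  · intro a b l k r h1 h2 h3 e1 e2
    rw [Layout.lastHead_concat a h1 h2, Layout.lastHead_concat b h1 h2]
    by_cases hne : (Y.lastHead a k r).Nonempty
    · have hne' : (Y.lastHead b k r).Nonempty := by
        rw [← Finset.image_nonempty (f := bit b), ← e2]; exact hne.image _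
      rw [if_pos hne, if_pos hne', e2]
    · have hne' : ¬ (Y.lastHead b k r).Nonempty := by
        rw [← Finset.image_nonempty (f := bit b), ← e2, Finset.image_nonempty]; exact hne
      rw [if_neg hne, if_neg hne', e1]
  · exact fun a b l r _ h => h
  · exact fun a l r _ => Finset.card_image_le.trans (Layout.card_lastHead_le a l r)
  · intro a l r _ w hw
    obtain ⟨v, _, rfl⟩ := Finset.mem_image.1 hw
    have h1 := Y.head_lt a v
    have h2 := R.lt_U
    have h3 := R.p_le
    have h4 := R.n_le
    have h5 := v.2
    refine R.pair_word (by omega) ?_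
    split_ifs <;> omega

theorem Layout.card_machine_le {P : Fin n × Fin n → Prop} [DecidablePred P] (a : I) (i : ℕ) :
    #{e ∈ darts (G a) | P e ∧ Y.mach a e.1 e.2 = i} ≤ L := by
  refine (Finset.card_le_card fun e he => ?_).trans (Y.card_mach a i)
  obtain ⟨h1, h2, h3⟩ := Finset.mem_filter.1 he
  exact Finset.mem_filter.2 ⟨h1, h3⟩

theorem Layout.card_machine_swap_le {P : Fin n × Fin n → Prop} [DecidablePred P] (a : I) (i : ℕ) :
    #{e ∈ darts (G a) | P e ∧ Y.mach a e.2 e.1 = i} ≤ L := by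
  refine le_trans ?_ (Y.card_mach a i)
  refine Finset.card_le_card_of_injOn Prod.swap (fun e he => ?_) Prod.swap_injective.injOn
  obtain ⟨h1, h2, h3⟩ := Finset.mem_filter.1 (Finset.mem_coe.1 he)
  exact Finset.mem_coe.2 (Finset.mem_filter.2 ⟨mem_darts.2 (mem_darts.1 h1).symm, h3⟩)

/-- The machines learn which of their darts have both vertices in `A a`. -/
theorem Env.Know.exchange {T : ℕ} (R : Room S Y x q D U Q m ℓ)
    (h : S.Know T fun a i => (x a i, Y.own A a i)) :
    S.Know (T + (D + 2)) fun a i => ((x a i, Y.own A a i), Y.edgesAt (live G A) a i) := by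
  classical
  have hsm : Small S.W (ℓ + 2 * L + 2 * L) fun a i =>
      ((x a i, Y.own A a i), Y.edgesAt (MPC.halfLive G A) a i) :=
    (R.small.pair (R.small_own A)).pair (R.small_edgesAt halfLive_subset)
  have hLs := R.cap.L_le
  have hls := R.le_s
  -- A dart with live first vertex announces itself to the machine of the reversed dart, which
  -- learns in this way that the second vertex of its own dart is live. Reversal is a bijection, so
  -- at most `L` words leave and reach a machine.
  let out : I → Fin p → Fin p → Finset ℕ := fun a i j =>
    {e ∈ darts (G a) | (e.1 ∈ A a ∧ Y.mach a e.1 e.2 = i) ∧ Y.mach a e.2 e.1 = j}.image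
      fun e => Nat.pair e.1 e.2
  have hroute := (h.halfLive R).route (out := out) (b := L) (r := L) 1 hsm ?_ R.cap.two_le_W ?_ ?_ ?_
    (by omega) (by omega)
  · refine (hroute.det ?_).mono (by omega)
    intro i a b hab
    have e1 : x a i = x b i := congrArg (fun z => z.1.1.1) hab
    have e2 : Y.own A a i = Y.own A b i := congrArg (fun z => z.1.1.2) hab
    have e3 : Y.edgesAt (MPC.halfLive G A) a i = Y.edgesAt (MPC.halfLive G A) b i :=
      congrArg (fun z => z.1.2) hab
    have e4 : (Finset.univ.biUnion fun j => out a j i) = Finset.univ.biUnion fun j => out b j i :=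
      congrArg (fun z => z.2) hab
    have hmem : ∀ a v u, (G a).Adj v u → Y.mach a v u = i →
        (u ∈ A a ↔ Nat.pair u v ∈ Finset.univ.biUnion fun j => out a j i) := by
      intro a v u hvu hi
      simp only [Finset.mem_biUnion, Finset.mem_univ, true_and, out, Finset.mem_image,
        Finset.mem_filter]
      constructor
      · intro hu
        exact ⟨⟨Y.mach a u v, Y.mach_lt a u v hvu.symm⟩, (u, v),
          ⟨mem_darts.2 hvu.symm, ⟨hu, rfl⟩, hi⟩, rfl⟩
      · rintro ⟨j, e, ⟨_, ⟨he, _⟩, _⟩, hp⟩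
        obtain ⟨h1, _⟩ := Nat.pair_eq_pair.1 hp
        rwa [Fin.ext h1] at he
    refine Prod.ext (Prod.ext e1 e2) (Layout.edgesAt_ext ?_ ?_)
    · have key : ∀ a b, x a i = x b i →
          Y.edgesAt (MPC.halfLive G A) a i = Y.edgesAt (MPC.halfLive G A) b i →
          ((Finset.univ.biUnion fun j => out a j i) = Finset.univ.biUnion fun j => out b j i) →
          ∀ e, e ∈ live G A a ∧ Y.mach a e.1 e.2 = i → e ∈ live G A b ∧ Y.mach b e.1 e.2 = i := by
        rintro a b e1 e3 e4 ⟨v, u⟩ ⟨he, hi⟩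
        obtain ⟨he, hv, hu⟩ := Finset.mem_filter.1 he
        have hvu := mem_darts.1 he
        obtain ⟨⟨h1, h2⟩, -⟩ := Layout.edgesAt_eq e3 (e := (v, u))
          (Finset.mem_filter.2 ⟨he, hv⟩) hi
        obtain ⟨h1, h3⟩ := Finset.mem_filter.1 h1
        refine ⟨Finset.mem_filter.2 ⟨h1, h3, ?_⟩, h2⟩
        refine (hmem b v u (mem_darts.1 h1) h2).2 ?_
        rw [← e4]
        exact (hmem a v u hvu hi).1 hu
      exact fun e => ⟨key a b e1 e3 e4 e, key b a e1.symm e3.symm e4.symm e⟩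
    · intro e he hi
      obtain ⟨he, hv, hu⟩ := Finset.mem_filter.1 he
      exact (Layout.edgesAt_eq e3 (Finset.mem_filter.2 ⟨he, hv⟩) hi).2
  · intro i a b hab
    have e1 : x a i = x b i := congrArg (fun z => z.1.1) hab
    have e3 : Y.edgesAt (MPC.halfLive G A) a i = Y.edgesAt (MPC.halfLive G A) b i :=
      congrArg (fun z => z.2) hab
    funext j
    have key : ∀ a b, x a i = x b i →
        Y.edgesAt (MPC.halfLive G A) a i = Y.edgesAt (MPC.halfLive G A) b i →
        ∀ e, e ∈ darts (G a) ∧ (e.1 ∈ A a ∧ Y.mach a e.1 e.2 = i) ∧ Y.mach a e.2 e.1 = j →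
          e ∈ darts (G b) ∧ (e.1 ∈ A b ∧ Y.mach b e.1 e.2 = i) ∧ Y.mach b e.2 e.1 = j := by
      rintro a b e1 e3 ⟨v, u⟩ ⟨he, ⟨hv, hi⟩, hj⟩
      obtain ⟨⟨h1, h2⟩, -⟩ := Layout.edgesAt_eq e3 (e := (v, u)) (Finset.mem_filter.2 ⟨he, hv⟩) hi
      obtain ⟨h1, h3⟩ := Finset.mem_filter.1 h1
      exact ⟨h1, ⟨h3, h2⟩, (Layout.dartsAt_eq (R.dartsAt i a b e1) (mem_darts.1 he) hi).2 ▸ hj⟩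
    change Finset.image _ _ = Finset.image _ _
    congr 1
    ext e
    simp only [Finset.mem_filter]
    exact ⟨key a b e1 e3 e, key b a e1.symm e3.symm e⟩
  · intro a i j w hw
    obtain ⟨e, _, rfl⟩ := Finset.mem_image.1 hw
    have h1 := R.lt_U
    have h2 := R.n_le
    have := R.pair_word (b := e.1) (c := e.2) (by omega) (by omega)
    omega
  · intro a i
    rw [one_mul]
    refine le_trans (Finset.sum_le_sum fun j _ => Finset.card_image_le) ?_
    refine le_trans ?_ (Layout.card_machine_le (Y := Y) (P := fun e => e.1 ∈ A a) a i)
    simp only [← Finset.filter_filter (fun e : Fin n × Fin n => e.1 ∈ A a ∧ Y.mach a e.1 e.2 = i)]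
    exact sum_card_filter_eq_le _ fun e : Fin n × Fin n => Y.mach a e.2 e.1
  · intro a j
    refine le_trans (Finset.sum_le_sum fun i _ => Finset.card_image_le) ?_
    refine le_trans ?_ (Layout.card_machine_swap_le (Y := Y) (P := fun e => e.1 ∈ A a) a j)
    have : ∀ i : Fin p, {e ∈ darts (G a) | (e.1 ∈ A a ∧ Y.mach a e.1 e.2 = i) ∧
        Y.mach a e.2 e.1 = j} = {e ∈ {e ∈ darts (G a) | e.1 ∈ A a ∧ Y.mach a e.2 e.1 = j} |
          Y.mach a e.1 e.2 = (i : ℕ)} := by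
      intro i
      rw [Finset.filter_filter]
      refine Finset.filter_congr fun e _ => ?_
      tauto
    simp only [this]
    exact sum_card_filter_eq_le _ fun e : Fin n × Fin n => Y.mach a e.1 e.2

open Classical in
/-- The number of darts of `E a` in the vertices on a machine. -/
noncomputable def Layout.degreesAt (Y : Layout G p L) (E : I → Finset (Fin n × Fin n)) (a : I)
    (i : Fin p) (v : Fin n) : ℕ := if Y.head a v = i then #{e ∈ E a | e.1 = v} else 0

/-- By `Layout.card_dart_eq` only the last vertex on a machine needs data from later machines: the
suffix value of the segmented sum `countBefore`. -/
theorem Env.Know.degrees {β : Type} {T ℓ' : ℕ} {y : I → Fin p → β}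
    {E : I → Finset (Fin n × Fin n)} (R : Room S Y x q D U Q m ℓ) (h : S.Know T y)
    (hx : Det y x) (hyE : Det y (Y.edgesAt E)) (hE : ∀ a, E a ⊆ darts (G a))
    (hsm : Small S.W ℓ' y) (hl : 2 * ℓ' ≤ S.s) :
    S.Know (T + (D + 1)) fun a i => (y a i, Y.degreesAt E a i) := by
  classical
  have hqs := R.cap.q_le
  have hqq : q ≤ q * q := Nat.le_mul_self q
  have hEeq : ∀ {i : Fin p} {a b : I}, y a i = y b i →
      ∀ e, e ∈ E a ∧ Y.mach a e.1 e.2 = i ↔ e ∈ E b ∧ Y.mach b e.1 e.2 = i := by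
    intro i a b hab e
    exact ⟨fun he => (Layout.edgesAt_eq (hyE i a b hab) he.1 he.2).1,
      fun he => (Layout.edgesAt_eq (hyE i a b hab).symm he.1 he.2).1⟩
  have hh : ∀ {i : Fin p} {a b : I}, y a i = y b i → ∀ v, Y.head a v = i ↔ Y.head b v = i :=
    fun {i a b} hab v => Layout.headsAt_eq (R.headsAt i a b (hx i a b hab))
  have hscan := h.scan (D := D) (q := q) (B := 1) hsm
    (fun a l r => Y.countBefore E a l r) (fun z => {Nat.pair z.1 z.2}) ?_ ?_ ?_ ?_ ?_ ?_
    (by have := R.cap.two_le_q; omega) R.cap.p_le_pow (by omega)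
  · refine hscan.det ?_
    intro i a b hab
    have e1 : y a i = y b i := congrArg (fun z => z.1) hab
    have e2 : Y.countBefore E a (i + 1) p = Y.countBefore E b (i + 1) p :=
      congrArg (fun z => z.2.2) hab
    refine Prod.ext e1 ?_
    funext v
    change (if _ then _ else _) = (if _ then _ else _)
    by_cases hv : Y.head a v = i
    · have hv' := (hh e1 v).1 hv
      have hset : ({e ∈ E a | Y.mach a e.1 e.2 = i ∧ e.1 = v} : Finset _) =
          {e ∈ E b | Y.mach b e.1 e.2 = i ∧ e.1 = v} := by
        ext e
        simp only [Finset.mem_filter, ← and_assoc]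
        rw [hEeq e1 e]
      rw [if_pos hv, if_pos hv', Layout.card_dart_eq hE, Layout.card_dart_eq hE, hv, hv', e2, hset]
      simp only [hh e1]
    · rw [if_neg hv, if_neg (fun hv' => hv ((hh e1 v).2 hv'))]
  · intro i a b hab
    have hiff : ∀ c, (i : ℕ) ≤ c ∧ c < i + 1 ↔ c = i := by intro c; omega
    have h1 : ∀ a, Y.countBefore E a i (i + 1) = (#{e ∈ E a | Y.mach a e.1 e.2 = i ∧
        ∀ v', Y.head a v' = i → e.1 < v'}, if ∃ v, Y.head a v = i then 1 else 0) := by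
      intro a
      unfold Layout.countBefore
      simp only [Layout.lastHead_nonempty_iff, ← and_imp, hiff]
    have hset : ({e ∈ E a | Y.mach a e.1 e.2 = i ∧ ∀ v', Y.head b v' = i → e.1 < v'} : Finset _) =
        {e ∈ E b | Y.mach b e.1 e.2 = i ∧ ∀ v', Y.head b v' = i → e.1 < v'} := by
      ext e
      simp only [Finset.mem_filter, ← and_assoc]
      rw [hEeq hab e]
    refine (h1 a).trans (Eq.trans ?_ (h1 b).symm)
    simp only [hh hab, hset]
  · intro a b l
    have : ∀ a, Y.countBefore E a l l = (0, 0) := by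
      intro a
      unfold Layout.countBefore
      simp only [Layout.lastHead_nonempty_iff]
      refine Prod.ext ?_ (if_neg ?_)
      · exact Finset.card_eq_zero.2 (Finset.filter_false_of_mem fun e _ => by omega)
      · rintro ⟨v, h1, h2⟩; omega
    rw [this, this]
  · intro a b l k r h1 h2 h3 e1 e2
    rw [Layout.countBefore_concat hE a h1 h2, Layout.countBefore_concat hE b h1 h2, e1, e2]
  · intro a b l r _ hab
    obtain ⟨h1, h2⟩ := Nat.pair_eq_pair.1 (Finset.singleton_injective hab)
    exact Prod.ext h1 h2
  · exact fun a l r _ => (Finset.card_singleton _).le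
  · intro a l r _ w hw
    rw [Finset.mem_singleton.1 hw]
    refine R.pair_word ?_ ?_
    · refine le_trans (Finset.card_le_card (Finset.filter_subset _ _)) ?_
      exact ((Finset.card_le_card (hE a)).trans (card_darts_le _)).trans R.sq_lt_U.le
    · have := R.lt_U
      change (if _ then 1 else 0) ≤ U
      split_ifs <;> omega

/-- The machines drop the vertices with many darts to vertices of `A a` that satisfy a condition known
to all machines. -/
theorem Env.Know.prune {T : ℕ} (R : Room S Y x q D U Q m ℓ) (P : I → Fin n × Fin n → Prop)
    [∀ a, DecidablePred (P a)] (hP : Det x fun a (_ : Fin p) => P a) (θ : ℕ)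
    (h : S.Know T fun a i => (x a i, Y.own A a i)) :
    S.Know (T + (2 * D + 3)) fun a i => (x a i,
      Y.own (fun a => {v ∈ A a | #{e ∈ live G A a | P a e ∧ e.1 = v} < θ}) a i) := by
  classical
  have hLs := R.cap.L_le
  have hls := R.le_s
  let E : I → Finset (Fin n × Fin n) := fun a => {e ∈ live G A a | P a e}
  have hE : ∀ a, E a ⊆ darts (G a) := fun a => (Finset.filter_subset _ _).trans (live_subset a)
  have h1 : Det (fun a i => ((x a i, Y.own A a i), Y.edgesAt (live G A) a i)) fun a i =>
      ((x a i, Y.own A a i), Y.edgesAt E a i) := by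
    intro i a b hab
    have e1 : x a i = x b i := congrArg (fun z => z.1.1) hab
    have e2 : Y.own A a i = Y.own A b i := congrArg (fun z => z.1.2) hab
    have e3 : Y.edgesAt (live G A) a i = Y.edgesAt (live G A) b i := congrArg (fun z => z.2) hab
    have e4 : P a = P b := hP i a b e1
    refine Prod.ext (Prod.ext e1 e2) (Layout.edgesAt_ext ?_ ?_)
    · intro e
      have h3 : e ∈ live G A a ∧ Y.mach a e.1 e.2 = i ↔ e ∈ live G A b ∧ Y.mach b e.1 e.2 = i :=
        ⟨fun he => (Layout.edgesAt_eq e3 he.1 he.2).1,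
          fun he => (Layout.edgesAt_eq e3.symm he.1 he.2).1⟩
      simp only [E, Finset.mem_filter, e4]
      tauto
    · intro e he hi
      exact (Layout.edgesAt_eq e3 (Finset.mem_filter.1 he).1 hi).2
  have h2 := ((h.exchange R).det h1).degrees R (fun i a b hab => congrArg (fun z => z.1.1) hab)
    Det.snd hE ((R.small.pair (R.small_own A)).pair (R.small_edgesAt hE)) (by omega)
  refine (h2.det ?_).mono (by omega)
  intro i a b hab
  have e1 : x a i = x b i := congrArg (fun z => z.1.1.1) hab
  have e2 : Y.own A a i = Y.own A b i := congrArg (fun z => z.1.1.2) hab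
  have e3 : Y.degreesAt E a i = Y.degreesAt E b i := congrArg (fun z => z.2) hab
  refine Prod.ext e1 ?_
  have key : ∀ a b, Y.own A a i = Y.own A b i → Y.degreesAt E a i = Y.degreesAt E b i → ∀ v,
      (v ∈ A a ∧ #{e ∈ live G A a | P a e ∧ e.1 = v} < θ) ∧ Y.head a v = i →
      (v ∈ A b ∧ #{e ∈ live G A b | P b e ∧ e.1 = v} < θ) ∧ Y.head b v = i := by
    rintro a b e2 e3 v ⟨⟨hv, hd⟩, hi⟩
    obtain ⟨hv', hi'⟩ := (Layout.own_eq e2).1 ⟨hv, hi⟩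
    refine ⟨⟨hv', ?_⟩, hi'⟩
    have h3 := congrFun e3 v
    simp only [Layout.degreesAt, if_pos hi, if_pos hi', E, Finset.filter_filter] at h3
    convert hd using 1
    convert h3.symm using 2
  ext v
  simp only [Layout.own, Finset.mem_filter]
  exact ⟨key a b e2 e3 v, key b a e2.symm e3.symm v⟩

end Rank

end MPC

/-! ### Peeling inside a colour class depends only on the edges of this class. -/

section Peeling

variable {V : Type*} [Fintype V] [DecidableEq V]

theorem mem_monoNbrs {G : SimpleGraph V} {γ : V → ℕ} {A : Finset V} {v u : V} :
    u ∈ monoNbrs G γ A v ↔ (u ∈ A ∧ G.Adj v u) ∧ γ u = γ v := by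
  rw [monoNbrs, Finset.mem_filter, mem_nbrs]

/-- Positive thresholds never remove a vertex without a neighbour of its own colour. So a colour
class may be gathered as a set of edges, without its isolated vertices. -/
theorem exists_of_notMem_peel {G : SimpleGraph V} {γ : V → ℕ} {τ : ℕ → ℕ} (hτ : ∀ j, 1 ≤ τ j)
    {A : Finset V} {j : ℕ} {v : V} (hv : v ∈ A) (hv' : v ∉ peel G γ τ A j) :
    ∃ u ∈ A, G.Adj v u ∧ γ u = γ v := by
  induction j with
  | zero => exact absurd hv hv'
  | succ j ih =>
    by_cases h : v ∈ peel G γ τ A j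
    · have h1 : ¬ #(monoNbrs G γ (peel G γ τ A j) v) < τ j :=
        fun h2 => hv' (Finset.mem_filter.2 ⟨h, h2⟩)
      obtain ⟨u, hu⟩ := Finset.card_pos.1 (((hτ j).trans (not_lt.1 h1)))
      obtain ⟨⟨h2, h3⟩, h4⟩ := mem_monoNbrs.1 hu
      exact ⟨u, peel_subset γ τ A j h2, h3, h4⟩
    · exact ih h

/-- The vertices of a colour that get removed are determined by the edges of this colour. -/
theorem notMem_peel_congr {G G' : SimpleGraph V} {γ : V → ℕ} {τ : ℕ → ℕ} (hτ : ∀ j, 1 ≤ τ j)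
    {A A' : Finset V} {c : ℕ} (h : ∀ v u, γ v = c → γ u = c →
      (v ∈ A ∧ u ∈ A ∧ G.Adj v u ↔ v ∈ A' ∧ u ∈ A' ∧ G'.Adj v u)) (j : ℕ) (v : V) (hv : γ v = c) :
    v ∈ A ∧ v ∉ peel G γ τ A j ↔ v ∈ A' ∧ v ∉ peel G' γ τ A' j := by
  induction j generalizing v with
  | zero => exact ⟨fun h => absurd h.1 h.2, fun h => absurd h.1 h.2⟩
  | succ j ih =>
    have key : ∀ (G G' : SimpleGraph V) (A A' : Finset V), (∀ v u, γ v = c → γ u = c →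
        v ∈ A ∧ u ∈ A ∧ G.Adj v u → v ∈ A' ∧ u ∈ A' ∧ G'.Adj v u) →
        (∀ v, γ v = c → (v ∈ A ∧ v ∉ peel G γ τ A j ↔ v ∈ A' ∧ v ∉ peel G' γ τ A' j)) →
        v ∈ A ∧ v ∉ peel G γ τ A (j + 1) → v ∈ A' ∧ v ∉ peel G' γ τ A' (j + 1) := by
      rintro G G' A A' h ih ⟨h1, h2⟩
      by_cases h3 : v ∈ peel G γ τ A j
      · have hsub : ∀ v u, γ v = c → γ u = c → v ∈ peel G γ τ A j → u ∈ peel G γ τ A j →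
            G.Adj v u → v ∈ A' ∧ u ∈ peel G' γ τ A' j ∧ G'.Adj v u := by
          intro v u hv hu hvj huj hvu
          obtain ⟨h4, h5, h6⟩ := h v u hv hu
            ⟨peel_subset γ τ A j hvj, peel_subset γ τ A j huj, hvu⟩
          refine ⟨h4, ?_, h6⟩
          by_contra h7
          exact ((ih u hu).2 ⟨h5, h7⟩).2 huj
        have h4 : ¬ #(monoNbrs G γ (peel G γ τ A j) v) < τ j :=
          fun h5 => h2 (Finset.mem_filter.2 ⟨h3, h5⟩)
        have hpos := (hτ j).trans (not_lt.1 h4)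
        -- The hypothesis compares edges only; membership of `v` in the other vertex set comes from
        -- an edge that the positive threshold provides.
        obtain ⟨u, hu⟩ := Finset.card_pos.1 hpos
        obtain ⟨⟨hu1, hu2⟩, hu3⟩ := mem_monoNbrs.1 hu
        refine ⟨(hsub v u hv (hu3.trans hv) h3 hu1 hu2).1, fun h5 => ?_⟩
        refine absurd (Finset.mem_filter.1 h5).2 (not_lt.2 ((not_lt.1 h4).trans
          (Finset.card_le_card fun u hu => ?_)))
        obtain ⟨⟨hu1, hu2⟩, hu3⟩ := mem_monoNbrs.1 hu
        obtain ⟨-, h6, h7⟩ := hsub v u hv (hu3.trans hv) h3 hu1 hu2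
        exact mem_monoNbrs.2 ⟨⟨h6, h7⟩, hu3⟩
      · obtain ⟨h4, h5⟩ := (ih v hv).1 ⟨h1, h3⟩
        exact ⟨h4, fun h6 => h5 (Finset.mem_filter.1 h6).1⟩
    exact ⟨key G G' A A' (fun v u hv hu => (h v u hv hu).1) ih,
      key G' G A' A (fun v u hv hu => (h v u hv hu).2) fun v hv => (ih v hv).symm⟩

end Peeling

/-! ### Gathering each colour class on one machine. -/

namespace MPC

variable {I δ α : Type} {p n : ℕ}

section Colour

variable {S : Env I p δ} {G : I → SimpleGraph (Fin n)} {L q D U Q m ℓ : ℕ} {Y : Layout G p L}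
  {x : I → Fin p → α} {A : I → Finset (Fin n)} {γ : I → Fin n → ℕ} {cond : I → Prop}

open Classical in
/-- The darts inside `A a` with both vertices of the same colour, if `cond a`. -/
noncomputable def monoLive (G : I → SimpleGraph (Fin n)) (A : I → Finset (Fin n))
    (γ : I → Fin n → ℕ) (cond : I → Prop) (a : I) : Finset (Fin n × Fin n) :=
  {e ∈ live G A a | cond a ∧ γ a e.1 = γ a e.2}

theorem mem_monoLive {a : I} {e : Fin n × Fin n} : e ∈ monoLive G A γ cond a ↔
    ((G a).Adj e.1 e.2 ∧ e.1 ∈ A a ∧ e.2 ∈ A a) ∧ cond a ∧ γ a e.1 = γ a e.2 := by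
  classical
  rw [monoLive, Finset.mem_filter, live, Finset.mem_filter, mem_darts]

theorem monoLive_subset (a : I) : monoLive G A γ cond a ⊆ darts (G a) := by
  classical
  exact (Finset.filter_subset _ _).trans (live_subset a)

/-- A word for a dart and the machine of its first vertex; darts get sorted by colour. -/
def Layout.key (Y : Layout G p L) (γ : I → Fin n → ℕ) (m : ℕ) (a : I) (e : Fin n × Fin n) : ℕ :=
  γ a e.1 * (m + 1) ^ 4 + Nat.pair (Nat.pair e.1 e.2) (Y.head a e.1)

theorem Room.pair_lt (R : Room S Y x q D U Q m ℓ) (a : I) (e : Fin n × Fin n) :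
    Nat.pair (Nat.pair e.1 e.2) (Y.head a e.1) < (m + 1) ^ 4 := by
  have h0 := R.n_le
  have h4 := R.p_le
  have h1 : Nat.pair (e.1 : ℕ) e.2 < (m + 1) ^ 2 := pair_lt_sq (by omega) (by omega)
  have h2 := Y.head_lt a e.1
  have h3 : m < (m + 1) ^ 2 := by nlinarith
  refine (pair_lt_sq (U := (m + 1) ^ 2 - 1) (Nat.le_sub_one_of_lt h1) (by omega)).trans_eq ?_
  rw [Nat.sub_add_cancel (by omega), ← pow_mul]

theorem Room.key_inj (R : Room S Y x q D U Q m ℓ) {a b : I} {e e' : Fin n × Fin n}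
    (h : Y.key γ m a e = Y.key γ m b e') : e = e' ∧ Y.head a e.1 = Y.head b e'.1 := by
  have h1 := congrArg (· % (m + 1) ^ 4) h
  simp only [Layout.key, Nat.mul_add_mod_self_right,
    Nat.mod_eq_of_lt (R.pair_lt _ _)] at h1
  obtain ⟨h2, h3⟩ := Nat.pair_eq_pair.1 h1
  obtain ⟨h4, h5⟩ := Nat.pair_eq_pair.1 h2
  exact ⟨Prod.ext (Fin.ext h4) (Fin.ext h5), h3⟩

theorem Room.key_div (R : Room S Y x q D U Q m ℓ) (a : I) (e : Fin n × Fin n) :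
    Y.key γ m a e / (m + 1) ^ 4 = γ a e.1 := by
  rw [Layout.key, mul_comm, Nat.mul_add_div (by positivity), Nat.div_eq_of_lt (R.pair_lt _ _),
    Nat.add_zero]

/-- The machine of a dart among the darts sorted by colour. -/
noncomputable def Layout.block (Y : Layout G p L) (A : I → Finset (Fin n)) (γ : I → Fin n → ℕ)
    (cond : I → Prop) (m : ℕ) (a : I) (e : Fin n × Fin n) : ℕ :=
  rankBy id ((monoLive G A γ cond a).image (Y.key γ m a)) (Y.key γ m a e) / L

/-- Keys are sorted by colour first, so a class is contiguous; having at most `L` darts, it meets at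
most two consecutive blocks. -/
theorem Room.block_le_block_add_one (R : Room S Y x q D U Q m ℓ)
    (hload : ∀ a c, #{e ∈ monoLive G A γ cond a | γ a e.1 = c} ≤ L) {a : I} {e e' : Fin n × Fin n}
    (hc : γ a e.1 = γ a e'.1) : Y.block A γ cond m a e' ≤ Y.block A γ cond m a e + 1 := by
  classical
  have hL := R.cap.one_le_L
  unfold Layout.block
  rw [← Nat.add_div_right _ hL]
  refine Nat.div_le_div_right ?_
  refine le_trans ?_ (Nat.add_le_add_left ((Finset.card_image_le (f := Y.key γ m a)).trans
    (hload a (γ a e.1))) _)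
  refine le_trans (Finset.card_le_card ?_) (Finset.card_union_le _ _)
  intro k hk
  obtain ⟨hk, hlt⟩ := Finset.mem_filter.1 hk
  by_cases h : k < Y.key γ m a e
  · exact Finset.mem_union_left _ (Finset.mem_filter.2 ⟨hk, h⟩)
  · refine Finset.mem_union_right _ ?_
    obtain ⟨f, hf, rfl⟩ := Finset.mem_image.1 hk
    refine Finset.mem_image_of_mem _ (Finset.mem_filter.2 ⟨hf, ?_⟩)
    have h1 := Nat.div_le_div_right (c := (m + 1) ^ 4) (not_lt.1 h)
    have h2 := Nat.div_le_div_right (c := (m + 1) ^ 4) (le_of_lt hlt)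
    simp only [id, R.key_div] at h1 h2
    omega

/-- The machine `i` deals with the colour of `v`: it is the first one that has a dart of this
colour. -/
def Layout.Handles (Y : Layout G p L) (A : I → Finset (Fin n)) (γ : I → Fin n → ℕ)
    (cond : I → Prop) (m : ℕ) (a : I) (i : ℕ) (v : Fin n) : Prop :=
  (∃ e ∈ monoLive G A γ cond a, Y.block A γ cond m a e = i ∧ γ a e.1 = γ a v) ∧
    ∀ e ∈ monoLive G A γ cond a, Y.block A γ cond m a e + 1 = i → γ a e.1 ≠ γ a v

theorem Layout.Handles.block_eq (R : Room S Y x q D U Q m ℓ)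
    (hload : ∀ a c, #{e ∈ monoLive G A γ cond a | γ a e.1 = c} ≤ L) {a : I} {i : ℕ} {v : Fin n}
    (h : Y.Handles A γ cond m a i v) {e : Fin n × Fin n} (he : e ∈ monoLive G A γ cond a)
    (hev : γ a e.1 = γ a v) : Y.block A γ cond m a e = i ∨ Y.block A γ cond m a e = i + 1 := by
  obtain ⟨⟨e', he', h1, h2⟩, h3⟩ := h
  have h4 := R.block_le_block_add_one (A := A) (cond := cond) hload (hev.trans h2.symm)
  have h5 := R.block_le_block_add_one (A := A) (cond := cond) hload (h2.trans hev.symm)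
  have h6 : Y.block A γ cond m a e + 1 ≠ i := fun h => h3 e he h hev
  omega

theorem Layout.Handles.unique (R : Room S Y x q D U Q m ℓ)
    (hload : ∀ a c, #{e ∈ monoLive G A γ cond a | γ a e.1 = c} ≤ L) {a : I} {i j : ℕ} {v : Fin n}
    (h : Y.Handles A γ cond m a i v) (h' : Y.Handles A γ cond m a j v) : i = j := by
  have h1 := fun e he hev => h.block_eq R hload (e := e) he hev
  have h2 := fun e he hev => h'.block_eq R hload (e := e) he hev
  obtain ⟨⟨e, he, e1, e2⟩, -⟩ := h
  obtain ⟨⟨f, hf, f1, f2⟩, -⟩ := h'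
  have := h1 f hf f2
  have := h2 e he e2
  omega

theorem Layout.exists_handles {a : I} {e : Fin n × Fin n} (he : e ∈ monoLive G A γ cond a) :
    ∃ i, (∃ f ∈ monoLive G A γ cond a, Y.block A γ cond m a f = i) ∧
      Y.Handles A γ cond m a i e.1 := by
  classical
  obtain ⟨f, hf, hmin⟩ := Finset.exists_min_image
    {f ∈ monoLive G A γ cond a | γ a f.1 = γ a e.1} (Y.block A γ cond m a)
    ⟨e, Finset.mem_filter.2 ⟨he, rfl⟩⟩
  obtain ⟨hf, hfe⟩ := Finset.mem_filter.1 hf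
  refine ⟨Y.block A γ cond m a f, ⟨f, hf, rfl⟩, ⟨f, hf, rfl, hfe⟩, fun g hg hgf hge => ?_⟩
  have := hmin g (Finset.mem_filter.2 ⟨hg, hge⟩)
  omega

theorem Room.card_block_le (R : Room S Y x q D U Q m ℓ) (a : I) (i : ℕ) :
    #{e ∈ monoLive G A γ cond a | Y.block A γ cond m a e = i} ≤ L := by
  classical
  have hinj : Set.InjOn (rankBy id ((monoLive G A γ cond a).image (Y.key γ m a)))
      ((monoLive G A γ cond a).image (Y.key γ m a) : Finset ℕ) :=
    rankBy_injOn fun _ _ _ _ h => h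
  refine le_trans ?_ (card_filter_div_le hinj R.cap.one_le_L i)
  refine Finset.card_le_card_of_injOn (Y.key γ m a) (fun e he => ?_)
    fun e _ e' _ h => (R.key_inj h).1
  obtain ⟨h1, h2⟩ := Finset.mem_filter.1 (Finset.mem_coe.1 he)
  exact Finset.mem_coe.2 (Finset.mem_filter.2 ⟨Finset.mem_image_of_mem _ h1, h2⟩)

/-- The keys of the darts in a block. -/
noncomputable def Layout.blockAt (Y : Layout G p L) (A : I → Finset (Fin n)) (γ : I → Fin n → ℕ)
    (cond : I → Prop) (m : ℕ) (a : I) (i : Fin p) : Finset ℕ :=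
  {e ∈ monoLive G A γ cond a | Y.block A γ cond m a e = i}.image (Y.key γ m a)

theorem Layout.card_darts_le_mul (Y : Layout G p L) (a : I) : #(darts (G a)) ≤ p * L := by
  classical
  calc #(darts (G a)) ≤ ∑ i : Fin p, #{e ∈ darts (G a) | Y.mach a e.1 e.2 = i} := by
        rw [← Finset.card_biUnion]
        · refine Finset.card_le_card fun e he => ?_
          exact Finset.mem_biUnion.2 ⟨⟨_, Y.mach_lt a _ _ (mem_darts.1 he)⟩, Finset.mem_univ _,
            Finset.mem_filter.2 ⟨he, rfl⟩⟩
        · intro i _ j _ hij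
          refine Finset.disjoint_filter.2 fun k _ h1 h2 => hij (Fin.ext ?_)
          rw [← h1, ← h2]
    _ ≤ ∑ _i : Fin p, L := Finset.sum_le_sum fun i _ => Y.card_mach a i
    _ = p * L := by simp

theorem Room.key_lt (R : Room S Y x q D U Q m ℓ) {C : ℕ} (hγC : ∀ a v, γ a v < C)
    (hCU : C * (m + 1) ^ 4 ≤ U) (a : I) (e : Fin n × Fin n) : Y.key γ m a e < U := by
  refine lt_of_lt_of_le ?_ hCU
  rw [← Nat.div_lt_iff_lt_mul (by positivity), R.key_div]
  exact hγC a e.1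

/-- Sorting the darts inside the colour classes by colour. -/
theorem Env.Know.sortColours {T C : ℕ} (R : Room S Y x q D U Q m ℓ)
    (hγ : Det x fun a (_ : Fin p) => γ a) (hcond : Det x fun a (_ : Fin p) => cond a)
    (hγC : ∀ a v, γ a v < C) (hCU : C * (m + 1) ^ 4 ≤ U)
    (h : S.Know T fun a i => (x a i, Y.own A a i)) :
    S.Know (T + (D + 2) + Q * (D + 33)) fun a i =>
      ((x a i, Y.own A a i), Y.blockAt A γ cond m a i) := by
  classical
  have hLs := R.cap.L_le
  have hls := R.le_s
  let X : I → Fin p → Finset ℕ := fun a i =>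
    {e ∈ monoLive G A γ cond a | Y.mach a e.1 e.2 = i}.image (Y.key γ m a)
  have hX : Det (fun a i => ((x a i, Y.own A a i), Y.edgesAt (live G A) a i)) fun a i =>
      ((x a i, Y.own A a i), X a i) := by
    intro i a b hab
    have e1 : x a i = x b i := congrArg (fun z => z.1.1) hab
    have e2 : Y.own A a i = Y.own A b i := congrArg (fun z => z.1.2) hab
    have e3 : Y.edgesAt (live G A) a i = Y.edgesAt (live G A) b i := congrArg (fun z => z.2) hab
    have e4 : γ a = γ b := hγ i a b e1
    have e5 : cond a = cond b := hcond i a b e1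
    refine Prod.ext (Prod.ext e1 e2) ?_
    change Finset.image _ _ = Finset.image _ _
    have h1 : ({e ∈ monoLive G A γ cond a | Y.mach a e.1 e.2 = i} : Finset _) =
        {e ∈ monoLive G A γ cond b | Y.mach b e.1 e.2 = i} := by
      ext e
      have h3 : e ∈ live G A a ∧ Y.mach a e.1 e.2 = i ↔ e ∈ live G A b ∧ Y.mach b e.1 e.2 = i :=
        ⟨fun he => (Layout.edgesAt_eq e3 he.1 he.2).1,
          fun he => (Layout.edgesAt_eq e3.symm he.1 he.2).1⟩
      simp only [monoLive, Finset.mem_filter, e4, e5]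
      tauto
    rw [← h1]
    refine Finset.image_congr fun e he => ?_
    obtain ⟨he, hi⟩ := Finset.mem_filter.1 (Finset.mem_coe.1 he)
    have := (Layout.edgesAt_eq e3 (Finset.mem_filter.1 he).1 hi).2
    simp only [Layout.key, e4, this]
  have hsm : Small S.W (ℓ + 2 * L + 2 * L) fun a i =>
      ((x a i, Y.own A a i), Y.edgesAt (live G A) a i) :=
    (R.small.pair (R.small_own A)).pair (R.small_edgesAt live_subset)
  refine ((((h.exchange R).det hX).sort R.cap (hsm.of_det hX) (by omega) ?_
    (fun a => (monoLive G A γ cond a).image (Y.key γ m a)) ?_ ?_ ?_ ?_).det ?_)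
  · intro a i j k hi hj
    obtain ⟨e, he, rfl⟩ := Finset.mem_image.1 hi
    obtain ⟨e', he', h1⟩ := Finset.mem_image.1 hj
    have := (R.key_inj h1).1
    subst this
    exact Fin.ext ((Finset.mem_filter.1 he).2.symm.trans (Finset.mem_filter.1 he').2)
  · intro a k
    simp only [X, Finset.mem_image, Finset.mem_filter]
    constructor
    · rintro ⟨e, he, rfl⟩
      exact ⟨⟨_, Y.mach_lt a _ _ (mem_darts.1 (monoLive_subset a he))⟩, e, ⟨he, rfl⟩, rfl⟩
    · rintro ⟨i, e, ⟨he, _⟩, rfl⟩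
      exact ⟨e, he, rfl⟩
  · intro a k hk
    obtain ⟨e, _, rfl⟩ := Finset.mem_image.1 hk
    exact R.key_lt hγC hCU a e
  · intro a i
    refine Finset.card_image_le.trans (le_trans (Finset.card_le_card ?_)
      ((Y.card_mach a i).trans (by omega)))
    exact Finset.filter_subset_filter _ (monoLive_subset a)
  · intro a
    exact Finset.card_image_le.trans ((Finset.card_le_card (monoLive_subset a)).trans
      (Y.card_darts_le_mul a))
  · intro i a b hab
    have e1 := congrArg (fun z => z.1) hab
    have e2 := (labelled_eq (H := fun a => (monoLive G A γ cond a).image (Y.key γ m a))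
      (loc := fun a k => rankBy id ((monoLive G A γ cond a).image (Y.key γ m a)) k / L)
      (σ := fun a => rankBy id ((monoLive G A γ cond a).image (Y.key γ m a)))
      (congrArg (fun z => z.2) hab)).1
    refine Prod.ext e1 ?_
    have h1 : ∀ a, Y.blockAt A γ cond m a i =
        {k ∈ (monoLive G A γ cond a).image (Y.key γ m a) |
          rankBy id ((monoLive G A γ cond a).image (Y.key γ m a)) k / L = i} := by
      intro a
      rw [Finset.filter_image]
      rfl
    exact (h1 a).trans (e2.trans (h1 b).symm)

theorem Room.blockAt_eq (R : Room S Y x q D U Q m ℓ) {a b : I} {i : Fin p}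
    (h : Y.blockAt A γ cond m a i = Y.blockAt A γ cond m b i) {e : Fin n × Fin n}
    (he : e ∈ monoLive G A γ cond a) (hi : Y.block A γ cond m a e = i) :
    (e ∈ monoLive G A γ cond b ∧ Y.block A γ cond m b e = i) ∧ Y.head a e.1 = Y.head b e.1 := by
  have h1 : Y.key γ m a e ∈ Y.blockAt A γ cond m b i := by
    rw [← h]
    exact Finset.mem_image_of_mem _ (Finset.mem_filter.2 ⟨he, hi⟩)
  obtain ⟨e', he', e1⟩ := Finset.mem_image.1 h1
  obtain ⟨rfl, e2⟩ := R.key_inj e1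
  exact ⟨Finset.mem_filter.1 he', e2.symm⟩

theorem Layout.block_lt {a : I} {e : Fin n × Fin n}
    (he : e ∈ monoLive G A γ cond a) : Y.block A γ cond m a e < p := by
  classical
  refine Nat.div_lt_of_lt_mul ?_
  rw [mul_comm]
  refine (rankBy_lt_card (Finset.mem_image_of_mem _ he)).trans_le (Finset.card_image_le.trans ?_)
  exact (Finset.card_le_card (monoLive_subset a)).trans (Y.card_darts_le_mul a)

theorem card_filter_adjacent_le (i : Fin p) :
    #{j : Fin p | (j : ℕ) = i ∨ (j : ℕ) = i + 1 ∨ (j : ℕ) + 1 = i} ≤ 3 := by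
  rw [← Finset.card_image_of_injective _ Fin.val_injective]
  refine le_trans (Finset.card_le_card (t := {(i : ℕ), (i : ℕ) + 1, (i : ℕ) - 1}) ?_)
    Finset.card_le_three
  intro k hk
  obtain ⟨j, hj, rfl⟩ := Finset.mem_image.1 hk
  have := (Finset.mem_filter.1 hj).2
  simp only [Finset.mem_insert, Finset.mem_singleton]
  omega

/-- The vertices of `A a` that are removed in the local peeling processes. -/
noncomputable def peeled (G : I → SimpleGraph (Fin n)) (A : I → Finset (Fin n))
    (γ : I → Fin n → ℕ) (cond : I → Prop) (τ : ℕ → ℕ) (J : ℕ) (a : I) : Set (Fin n) :=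
  {v | cond a ∧ v ∈ A a ∧ v ∉ peel (G a) (γ a) τ (A a) J}

theorem exists_dart_of_mem_peeled {τ : ℕ → ℕ} (hτ : ∀ j, 1 ≤ τ j) {J : ℕ} {a : I} {v : Fin n}
    (h : v ∈ peeled G A γ cond τ J a) : ∃ u, (v, u) ∈ monoLive G A γ cond a := by
  obtain ⟨h1, h2, h3⟩ := h
  obtain ⟨u, hu, hvu, hc⟩ := exists_of_notMem_peel hτ h2 h3
  exact ⟨u, mem_monoLive.2 ⟨⟨hvu, h2, hu⟩, h1, hc.symm⟩⟩

open Classical in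
/-- The removed vertices that the machine `i` reports to their machines. -/
noncomputable def Layout.report (Y : Layout G p L) (A : I → Finset (Fin n)) (γ : I → Fin n → ℕ)
    (cond : I → Prop) (m : ℕ) (τ : ℕ → ℕ) (J : ℕ) (a : I) (i j : Fin p) : Finset ℕ :=
  ({v | (v ∈ peeled G A γ cond τ J a ∧ Y.Handles A γ cond m a i v) ∧
    Y.head a v = j} : Finset (Fin n)).image Fin.val

/-- The preceding block shows whether machine `i` is the first one with a given colour; if it is,
its own and the next block contain all darts of that colour, and these determine the removed
vertices. The keys also tell where to report them. -/
theorem Room.report_eq (R : Room S Y x q D U Q m ℓ) {τ : ℕ → ℕ} (hτ : ∀ j, 1 ≤ τ j) {J : ℕ}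
    (hload : ∀ a c, #{e ∈ monoLive G A γ cond a | γ a e.1 = c} ≤ L) {a b : I} {i : Fin p}
    (hγ : γ a = γ b) (hcond : cond a = cond b)
    (h : ∀ j : Fin p, (i : ℕ) = j ∨ (i : ℕ) = j + 1 ∨ (i : ℕ) + 1 = j →
      Y.blockAt A γ cond m a j = Y.blockAt A γ cond m b j) :
    Y.report A γ cond m τ J a i = Y.report A γ cond m τ J b i := by
  classical
  funext j
  have key : ∀ a b, γ a = γ b → cond a = cond b → (∀ j : Fin p,
      (i : ℕ) = j ∨ (i : ℕ) = j + 1 ∨ (i : ℕ) + 1 = j →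
        Y.blockAt A γ cond m a j = Y.blockAt A γ cond m b j) → ∀ v : Fin n,
      ((v ∈ peeled G A γ cond τ J a ∧ Y.Handles A γ cond m a i v) ∧ Y.head a v = j) →
      (v ∈ peeled G A γ cond τ J b ∧ Y.Handles A γ cond m b i v) ∧ Y.head b v = j := by
    rintro a b hγ hcond h v ⟨⟨hv, hh⟩, hj⟩
    -- Darts in the three blocks around `i` are the same in both instances.
    have mv : ∀ a b, (∀ j : Fin p, (i : ℕ) = j ∨ (i : ℕ) = j + 1 ∨ (i : ℕ) + 1 = j →
        Y.blockAt A γ cond m a j = Y.blockAt A γ cond m b j) → ∀ e ∈ monoLive G A γ cond a,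
        (i : ℕ) = Y.block A γ cond m a e ∨ (i : ℕ) = Y.block A γ cond m a e + 1 ∨
          (i : ℕ) + 1 = Y.block A γ cond m a e →
        (e ∈ monoLive G A γ cond b ∧ Y.block A γ cond m b e = Y.block A γ cond m a e) ∧
          Y.head a e.1 = Y.head b e.1 := fun a b h e he hi =>
      R.blockAt_eq (i := ⟨_, Layout.block_lt he⟩) (h ⟨_, Layout.block_lt he⟩ hi) he rfl
    have hh' : Y.Handles A γ cond m b i v := by
      obtain ⟨⟨e, he, h1, h2⟩, h3⟩ := hh
      obtain ⟨⟨h4, h5⟩, -⟩ := mv a b h e he (Or.inl h1.symm)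
      refine ⟨⟨e, h4, h5.trans h1, hγ ▸ h2⟩, fun f hf hfi hfv => ?_⟩
      obtain ⟨⟨h6, h7⟩, -⟩ := mv b a (fun j hj => (h j hj).symm) f hf (Or.inr (Or.inl hfi.symm))
      exact h3 f h6 (h7 ▸ hfi) (hγ ▸ hfv)
    have hcol : ∀ e : Fin n × Fin n, γ a e.1 = γ a v →
        (e ∈ monoLive G A γ cond a ↔ e ∈ monoLive G A γ cond b) := by
      intro e hev
      constructor
      · intro he
        have := hh.block_eq R hload he hev
        exact (mv a b h e he (by omega)).1.1
      · intro he
        have := hh'.block_eq R hload he (hγ ▸ hev)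
        exact (mv b a (fun j hj => (h j hj).symm) e he (by omega)).1.1
    obtain ⟨u, hu⟩ := exists_dart_of_mem_peeled hτ hv
    refine ⟨⟨?_, hh'⟩, ?_⟩
    · obtain ⟨h1, h2⟩ := hv
      have h3 : cond b := hcond ▸ h1
      refine ⟨h3, ?_⟩
      have := (notMem_peel_congr (G := G a) (G' := G b) (γ := γ a) hτ (A := A a) (A' := A b)
        (c := γ a v) ?_ J v rfl).1 h2
      · rwa [hγ] at this
      · intro w z hw hz
        have h4 := hcol (w, z) hw
        rw [mem_monoLive, mem_monoLive] at h4
        have h5 : γ a w = γ a z := hw.trans hz.symm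
        simp only [h1, h3, h5, ← hγ, and_true] at h4
        tauto
    · have := hh.block_eq R hload hu rfl
      rw [← hj]
      exact (mv a b h (v, u) hu (by omega)).2.symm
  change Finset.image _ _ = Finset.image _ _
  congr 1
  ext v
  simp only [Finset.mem_filter, Finset.mem_univ, true_and]
  exact ⟨key a b hγ hcond h v, key b a hγ.symm hcond.symm (fun j hj => (h j hj).symm) v⟩

open Classical in
/-- Each colour class is gathered on a machine, where the peeling process is performed. -/
theorem Env.Know.peelColours {T C : ℕ} (R : Room S Y x q D U Q m ℓ)
    (hγ : Det x fun a (_ : Fin p) => γ a) (hcond : Det x fun a (_ : Fin p) => cond a)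
    (hγC : ∀ a v, γ a v < C) (hCU : C * (m + 1) ^ 4 ≤ U)
    (hload : ∀ a c, #{e ∈ monoLive G A γ cond a | γ a e.1 = c} ≤ L)
    {τ : ℕ → ℕ} (hτ : ∀ j, 1 ≤ τ j) (J : ℕ) (h : S.Know T fun a i => (x a i, Y.own A a i)) :
    S.Know (T + (D + 4) + Q * (D + 33)) fun a i => (x a i,
      Y.own (fun a => if cond a then peel (G a) (γ a) τ (A a) J else A a) a i) := by
  have hLs := R.cap.L_le
  have hls := R.le_s
  have hsm : Small S.W (ℓ + 2 * L) fun a i => (x a i, Y.own A a i) := R.small.pair (R.small_own A)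
  have hblockL : ∀ a i, #(Y.blockAt A γ cond m a i) ≤ L := fun a i =>
    Finset.card_image_le.trans (R.card_block_le a i)
  have hsum : ∀ f : Fin p → Finset ℕ, ∀ i : Fin p, (∀ j, #(f j) ≤ L) →
      ∑ j : Fin p, #(if (j : ℕ) = i ∨ (j : ℕ) = i + 1 ∨ (j : ℕ) + 1 = i then f j else ∅) ≤
        3 * L := by
    intro f i hf
    rw [← Finset.sum_filter_add_sum_filter_not Finset.univ
      (fun j : Fin p => (j : ℕ) = i ∨ (j : ℕ) = i + 1 ∨ (j : ℕ) + 1 = i)]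
    rw [Finset.sum_eq_zero (s := Finset.univ.filter fun j : Fin p => ¬ _) fun j hj => by
      rw [if_neg (Finset.mem_filter.1 hj).2, Finset.card_empty], add_zero]
    refine (Finset.sum_le_card_nsmul _ _ L fun j hj => ?_).trans ?_
    · rw [if_pos (Finset.mem_filter.1 hj).2]; exact hf j
    · rw [smul_eq_mul]
      exact Nat.mul_le_mul_right _ (card_filter_adjacent_le i)
  -- Every machine sends its block to itself and to both neighbours; in the next round the
  -- responsible machines report the removed vertices.
  have h1 := (h.sortColours R hγ hcond hγC hCU).round (ℓ := ℓ + 2 * L)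
    (y := fun a i => (x a i, Y.own A a i)) (out := fun a i j =>
      if (j : ℕ) = i ∨ (j : ℕ) = i + 1 ∨ (j : ℕ) + 1 = i then Y.blockAt A γ cond m a i else ∅)
    Det.fst ?_ hsm ?_ ?_ ?_
  rotate_left
  · intro i a b hab
    have e2 : Y.blockAt A γ cond m a i = Y.blockAt A γ cond m b i := congrArg (fun z => z.2) hab
    funext j
    simp only [e2]
  · intro a i j w hw
    split_ifs at hw
    · obtain ⟨e, _, rfl⟩ := Finset.mem_image.1 hw
      have := R.key_lt (Y := Y) hγC hCU a e
      have := R.cap.two_mul_add_one_lt (w := U) (by nlinarith)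
      omega
    · exact absurd hw (Finset.notMem_empty _)
  · intro a i
    have := hsum (fun _ => Y.blockAt A γ cond m a i) i fun _ => hblockL a i
    omega
  · intro a i
    have := hsum (fun j => Y.blockAt A γ cond m a j) i fun j => hblockL a j
    have e : ∀ j : Fin p, (if (i : ℕ) = j ∨ (i : ℕ) = j + 1 ∨ (i : ℕ) + 1 = j then
        Y.blockAt A γ cond m a j else ∅) = if (j : ℕ) = i ∨ (j : ℕ) = i + 1 ∨ (j : ℕ) + 1 = i then
        Y.blockAt A γ cond m a j else ∅ := by
      intro j
      congr 1
      exact propext (by omega)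
    simp only [e]
    omega
  have h2 := h1.round (ℓ := ℓ + 2 * L) (y := fun a i => (x a i, Y.own A a i))
    (out := Y.report A γ cond m τ J) Det.fst ?_ hsm ?_ ?_ ?_
  rotate_left
  · intro i a b hab
    have e1 : x a i = x b i := congrArg (fun z => z.1.1) hab
    refine R.report_eq hτ hload (hγ i a b e1) (hcond i a b e1) fun j hj => ?_
    have := congrFun (congrArg (fun z => z.2) hab) j
    simpa only [if_pos hj] using this
  · intro a i j w hw
    obtain ⟨v, _, rfl⟩ := Finset.mem_image.1 hw
    have := R.cap.two_mul_add_one_lt (w := U) (by nlinarith)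
    have := R.lt_U
    have := R.n_le
    omega
  · intro a i
    -- A reported vertex is the first vertex of a dart in block `i` or `i + 1`.
    have : ∑ j, #(Y.report A γ cond m τ J a i j) ≤ L + L := by
      refine (Finset.sum_le_sum fun j _ => Finset.card_image_le).trans ?_
      simp only [← Finset.filter_filter (fun v : Fin n => v ∈ peeled G A γ cond τ J a ∧
        Y.Handles A γ cond m a i v)]
      refine (sum_card_filter_eq_le _ (Y.head a)).trans (le_trans (Finset.card_le_card
        (t := ({e ∈ monoLive G A γ cond a | Y.block A γ cond m a e = i} ∪
          {e ∈ monoLive G A γ cond a | Y.block A γ cond m a e = i + 1}).image Prod.fst) ?_)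
        (Finset.card_image_le.trans ((Finset.card_union_le _ _).trans
          (add_le_add (R.card_block_le a i) (R.card_block_le a (i + 1))))))
      intro v hv
      obtain ⟨hv, hh⟩ := (Finset.mem_filter.1 hv).2
      obtain ⟨u, hu⟩ := exists_dart_of_mem_peeled hτ hv
      refine Finset.mem_image.2 ⟨(v, u), ?_, rfl⟩
      rcases hh.block_eq R hload hu rfl with h | h
      · exact Finset.mem_union_left _ (Finset.mem_filter.2 ⟨hu, h⟩)
      · exact Finset.mem_union_right _ (Finset.mem_filter.2 ⟨hu, h⟩)
    omega
  · intro a j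
    have : ∑ i, #(Y.report A γ cond m τ J a i j) ≤ L := by
      refine le_trans ?_ (Y.card_head a j)
      refine (Finset.sum_le_sum fun j _ => Finset.card_image_le).trans ?_
      rw [← Finset.card_biUnion]
      · refine Finset.card_le_card fun v hv => ?_
        obtain ⟨i, _, hv⟩ := Finset.mem_biUnion.1 hv
        exact Finset.mem_filter.2 ⟨Finset.mem_univ _, (Finset.mem_filter.1 hv).2.2⟩
      · intro i _ i' _ hii
        refine Finset.disjoint_filter.2 fun v _ h1 h2 => hii (Fin.ext ?_)
        exact h1.1.2.unique R hload h2.1.2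
    omega
  refine (h2.det ?_).mono (by omega)
  intro i a b hab
  have e1 : x a i = x b i := congrArg (fun z => z.1.1) hab
  have e2 : Y.own A a i = Y.own A b i := congrArg (fun z => z.1.2) hab
  have e3 : (fun j => Y.report A γ cond m τ J a j i) = fun j => Y.report A γ cond m τ J b j i :=
    congrArg (fun z => z.2) hab
  refine Prod.ext e1 ?_
  -- A removed vertex has a monochromatic dart, so some machine deals with its colour; without any
  -- report the vertex stays.
  have hrep : ∀ a v, Y.head a v = i → (v ∈ peeled G A γ cond τ J a ↔
      ∃ j, (v : ℕ) ∈ Y.report A γ cond m τ J a j i) := by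
    intro a v hv
    constructor
    · intro hp
      obtain ⟨u, hu⟩ := exists_dart_of_mem_peeled hτ hp
      obtain ⟨k, ⟨f, hf, rfl⟩, hk⟩ := Layout.exists_handles (Y := Y) (m := m) hu
      exact ⟨⟨_, Layout.block_lt hf⟩, Finset.mem_image_of_mem _
        (Finset.mem_filter.2 ⟨Finset.mem_univ _, ⟨hp, hk⟩, hv⟩)⟩
    · rintro ⟨j, hj⟩
      obtain ⟨w, hw, e⟩ := Finset.mem_image.1 hj
      obtain rfl := Fin.ext e
      exact (Finset.mem_filter.1 hw).2.1.1
  have hmem : ∀ a v, v ∈ (if cond a then peel (G a) (γ a) τ (A a) J else A a) ↔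
      v ∈ A a ∧ v ∉ peeled G A γ cond τ J a := by
    intro a v
    have hsub : v ∈ peel (G a) (γ a) τ (A a) J → v ∈ A a := fun h => peel_subset _ _ _ _ h
    simp only [peeled, Set.mem_ofPred_eq]
    split_ifs with hc
    · tauto
    · tauto
  ext v
  simp only [Layout.own, Finset.mem_filter, hmem]
  have h3 := Layout.own_eq e2 (v := v)
  have h4 := hrep a v
  have h5 := hrep b v
  have h6 : (∃ j, (v : ℕ) ∈ Y.report A γ cond m τ J a j i) ↔
      ∃ j, (v : ℕ) ∈ Y.report A γ cond m τ J b j i :=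
    exists_congr fun j => by rw [congrFun e3 j]
  tauto

end Colour

end MPC

/-! ### Phases and exact peeling steps as MPC computations. -/

namespace MPC

variable {I δ α : Type} {p n : ℕ}

section Phases

variable {S : Env I p δ} {G : I → SimpleGraph (Fin n)} {L q D U Q m ℓ : ℕ} {Y : Layout G p L}
  {x : I → Fin p → α} {A : I → Finset (Fin n)} {γ : I → Fin n → ℕ} {cond : I → Prop}

open Classical in
theorem card_live_filter (a : I) {v : Fin n} (hv : v ∈ A a) (f : Fin n → ℕ) :
    #{e ∈ live G A a | f e.1 = f e.2 ∧ e.1 = v} = #(monoNbrs (G a) f (A a) v) := by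
  refine Finset.card_bij' (fun e _ => e.2) (fun u _ => (v, u)) ?_ ?_ ?_ ?_
  · rintro ⟨w, u⟩ he
    obtain ⟨hl, h1, rfl⟩ := Finset.mem_filter.1 he
    obtain ⟨hd, h2, h3⟩ := Finset.mem_filter.1 hl
    exact mem_monoNbrs.2 ⟨⟨h3, mem_darts.1 hd⟩, h1.symm⟩
  · intro u hu
    obtain ⟨⟨h1, h2⟩, h3⟩ := mem_monoNbrs.1 hu
    exact Finset.mem_filter.2 ⟨Finset.mem_filter.2 ⟨mem_darts.2 h2, hv, h1⟩, h3.symm, rfl⟩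
  · rintro ⟨w, u⟩ he
    obtain ⟨he, h1, rfl⟩ := Finset.mem_filter.1 he
    rfl
  · intro u hu
    rfl

theorem Env.Know.thresh {T : ℕ} (R : Room S Y x q D U Q m ℓ) (θ : ℕ)
    (h : S.Know T fun a i => (x a i, Y.own A a i)) :
    S.Know (T + (2 * D + 3)) fun a i => (x a i,
      Y.own (fun a => _root_.thresh (G a) θ (A a)) a i) := by
  classical
  have h1 := h.prune R (fun _ e => (0 : ℕ) = 0) (fun _ _ _ _ => rfl) θ
  have e : (fun a => {v ∈ A a | #{e ∈ live G A a | (0 : ℕ) = 0 ∧ e.1 = v} < θ}) =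
      fun a => _root_.thresh (G a) θ (A a) := by
    funext a
    refine Finset.filter_congr fun v hv => ?_
    rw [card_live_filter a hv fun _ => 0]
    simp [monoNbrs]
  rwa [e] at h1

theorem Env.Know.trimMono {T : ℕ} (R : Room S Y x q D U Q m ℓ)
    (hγ : Det x fun a (_ : Fin p) => γ a) (b : ℕ)
    (h : S.Know T fun a i => (x a i, Y.own A a i)) :
    S.Know (T + (2 * D + 3)) fun a i => (x a i,
      Y.own (fun a => _root_.trimMono (G a) (γ a) b (A a)) a i) := by
  classical
  have h1 := h.prune R (fun a e => γ a e.1 = γ a e.2) (fun i a c hac => by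
    have : γ a = γ c := hγ i a c hac
    change (fun e : Fin n × Fin n => γ a e.1 = γ a e.2) = fun e => γ c e.1 = γ c e.2
    rw [this]) (b + 1)
  have e : (fun a => {v ∈ A a | #{e ∈ live G A a | γ a e.1 = γ a e.2 ∧ e.1 = v} < b + 1}) =
      fun a => _root_.trimMono (G a) (γ a) b (A a) := by
    funext a
    refine Finset.filter_congr fun v hv => ?_
    rw [card_live_filter a hv (γ a), Nat.lt_succ_iff]
  rwa [e] at h1

theorem card_monoNbrs_trimMono_le {H : SimpleGraph (Fin n)} {f : Fin n → ℕ} {b : ℕ}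
    {B : Finset (Fin n)} {v : Fin n} (hv : v ∈ _root_.trimMono H f b B) :
    #(monoNbrs H f (_root_.trimMono H f b B) v) ≤ b := by
  refine le_trans (Finset.card_le_card fun u hu => ?_) (Finset.mem_filter.1 hv).2
  obtain ⟨⟨h1, h2⟩, h3⟩ := mem_monoNbrs.1 hu
  exact mem_monoNbrs.2 ⟨⟨trimMono_subset f b B h1, h2⟩, h3⟩

/-- At most `z` vertices of the colour with at most `b` neighbours each; if `cond` fails, the set is
empty by definition. -/
theorem card_monoLive_le {z b K : ℕ} (hK : ∀ a v, γ a v < K) (a : I) (c : ℕ)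
    (hb : ∀ v ∈ A a, #(monoNbrs (G a) (γ a) (A a) v) ≤ b)
    (hcond : cond a → ∀ c < K, #{u | γ a u = c} ≤ z) :
    #{e ∈ monoLive G A γ cond a | γ a e.1 = c} ≤ z * b := by
  classical
  by_cases hc : cond a ∧ c < K
  · have hz := hcond hc.1 c hc.2
    refine le_trans ?_ (Nat.mul_le_mul_right b hz)
    have hmap : ∀ e ∈ ({e ∈ monoLive G A γ cond a | γ a e.1 = c} : Finset (Fin n × Fin n)),
        e.1 ∈ ({u | γ a u = c} : Finset (Fin n)) := by
      intro e he
      simpa using (Finset.mem_filter.1 he).2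
    rw [mul_comm]
    refine Finset.card_le_mul_card_image_of_maps_to hmap b ?_
    intro v _
    by_cases hv : v ∈ A a
    · refine le_trans ?_ (hb v hv)
      refine Finset.card_le_card_of_injOn Prod.snd ?_ ?_
      · rintro ⟨w, u⟩ he
        obtain ⟨hm, rfl⟩ := Finset.mem_filter.1 (Finset.mem_coe.1 he)
        obtain ⟨⟨h1, h2, h3⟩, h4, h5⟩ := mem_monoLive.1 (Finset.mem_filter.1 hm).1
        have h6 : u ∈ monoNbrs (G a) (γ a) (A a) w := mem_monoNbrs.2 ⟨⟨h3, h1⟩, h5.symm⟩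
        exact h6
      · rintro ⟨w, u⟩ he ⟨w', u'⟩ he' h
        have h1 := (Finset.mem_filter.1 (Finset.mem_coe.1 he)).2
        have h2 := (Finset.mem_filter.1 (Finset.mem_coe.1 he')).2
        exact Prod.ext (h1.trans h2.symm) h
    · rw [Finset.card_eq_zero.2]
      · exact Nat.zero_le _
      · refine Finset.filter_false_of_mem fun e he hev => hv ?_
        rw [← hev]
        exact (mem_monoLive.1 (Finset.mem_filter.1 he).1).1.2.1
  · rw [Finset.card_eq_zero.2]
    · exact Nat.zero_le _
    · refine Finset.filter_false_of_mem fun e he hec => hc ⟨(mem_monoLive.1 he).2.1, ?_⟩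
      rw [← hec]
      exact hK a e.1

/-- The load of a colour class is bounded for every colouring, good or not: trimming limits the
monochromatic degrees, and the size test, used as `cond`, suppresses the gathering when a class is
too large. Therefore the memory is never exceeded. -/
theorem Env.Know.phase {T a κ J z : ℕ} (R : Room S Y x q D U Q m ℓ)
    (hγ : Det x fun a (_ : Fin p) => γ a) (hκ : ∀ a v, γ a v < 2 ^ κ)
    (hU : 2 ^ κ * (m + 1) ^ 4 ≤ U) (hL : z * (2 * 2 ^ (a - κ)) ≤ L)
    (h : S.Know T fun a i => (x a i, Y.own A a i)) :
    S.Know (T + (5 * D + 10 + Q * (D + 33))) fun b i => (x b i,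
      Y.own (fun b => _root_.phase (G b) a κ J z (γ b) (A b)) b i) := by
  classical
  have h1 := (h.trimMono R hγ (2 * 2 ^ (a - κ))).peelColours R hγ
    (cond := fun b => ∀ c < 2 ^ κ, #{u | γ b u = c} ≤ z)
    (fun i b c hbc => by
      have : γ b = γ c := hγ i b c hbc
      change (∀ k < 2 ^ κ, #{u | γ b u = k} ≤ z) = ∀ k < 2 ^ κ, #{u | γ c u = k} ≤ z
      rw [this]) hκ hU
    (fun b c => (card_monoLive_le hκ b c (fun v hv => card_monoNbrs_trimMono_le hv)
      fun hc => hc).trans hL)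
    (τ := fun j => 2 ^ (a - j - 2 - κ)) (fun j => Nat.one_le_two_pow) J
  refine ((h1.thresh R (2 ^ (a - J))).mono (by omega)).det ?_
  intro i b c hbc
  have key : ∀ b, _root_.phase (G b) a κ J z (γ b) (A b) = _root_.thresh (G b) (2 ^ (a - J))
      (@ite _ (∀ c < 2 ^ κ, #{u | γ b u = c} ≤ z) (Classical.propDecidable _)
        (peel (G b) (γ b) (fun j => 2 ^ (a - j - 2 - κ))
          (_root_.trimMono (G b) (γ b) (2 * 2 ^ (a - κ)) (A b)) J)
        (_root_.trimMono (G b) (γ b) (2 * 2 ^ (a - κ)) (A b))) := by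
    intro b
    unfold _root_.phase
    congr
  simp only [key]
  exact hbc

theorem Env.Know.aliveAt {T a₀ d l : ℕ} (R : Room S Y x q D U Q m ℓ) {Γ : I → ℕ → Fin n → ℕ}
    (hΓ : Det x fun a (_ : Fin p) => Γ a)
    (hlt : ∀ a i v, Γ a i v < 2 ^ colorExp d (degExp a₀ d l i))
    (hU : 2 ^ (a₀ + d + 11) * (m + 1) ^ 4 ≤ U) (hL : 2 ^ a₀ ≤ 2 ^ (d + 8) * L)
    (h : S.Know T x) (k : ℕ) :
    S.Know (T + k * (5 * D + 10 + Q * (D + 33))) fun a i => (x a i,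
      Y.own (fun a => _root_.aliveAt (G a) a₀ d l (Γ a) k) a i) := by
  induction k with
  | zero =>
    rw [Nat.zero_mul]
    refine h.det ?_
    intro i a b hab
    refine Prod.ext hab ?_
    exact R.headsAt i a b hab
  | succ k ih =>
    by_cases hk : colorExp d (degExp a₀ d l k) + l < degExp a₀ d l k
    · have h1 := ih.phase (γ := fun a => Γ a k) (a := degExp a₀ d l k)
        (κ := colorExp d (degExp a₀ d l k)) (J := degExp a₀ d l k - colorExp d (degExp a₀ d l k) - l)
        (z := 2 * 2 ^ (a₀ - colorExp d (degExp a₀ d l k))) R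
        (fun i a b hab => congrFun (hΓ i a b hab) k) (fun a v => hlt a k v) ?_ ?_
      · simp only [_root_.aliveAt, if_pos hk]
        exact h1.mono (le_of_eq (by ring))
      · refine le_trans (Nat.mul_le_mul_right _ (Nat.pow_le_pow_right (by norm_num) ?_)) hU
        have := degExp_le a₀ d l k
        unfold colorExp
        omega
      · have h2 := degExp_le a₀ d l k
        set e := degExp a₀ d l k
        -- Class size times trimmed degree is `2 ^ (a₀ - κ + (e - κ) + 2)`. Since `2 * κ ≥ e + d +
        -- 10`, this is at most `2 ^ a₀ / 2 ^ (d + 8) ≤ L`; the `11` in `colorExp` is chosen for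
        -- this, with one unit lost to rounding.
        have h3 : e + d + 10 ≤ 2 * colorExp d e := by unfold colorExp; omega
        set κ := colorExp d e
        have h4 : a₀ - κ + (e - κ) + 2 + (d + 8) ≤ a₀ := by omega
        have h5 : 2 ^ (a₀ - κ + (e - κ) + 2) * 2 ^ (d + 8) ≤ 2 ^ (d + 8) * L := by
          rw [← pow_add]
          exact (Nat.pow_le_pow_right (by norm_num) h4).trans hL
        have h6 : 2 ^ (a₀ - κ + (e - κ) + 2) ≤ L := by
          rw [mul_comm] at h5
          exact Nat.le_of_mul_le_mul_left h5 (by positivity)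
        refine le_trans (le_of_eq ?_) h6
        rw [pow_add, pow_add]
        ring
    · simp only [_root_.aliveAt, if_neg hk]
      exact ih.mono (Nat.add_le_add_left (Nat.mul_le_mul_right _ (Nat.le_succ k)) _)

theorem Env.Know.survivors {T a₀ d l : ℕ} (R : Room S Y x q D U Q m ℓ) {Γ : I → ℕ → Fin n → ℕ}
    (hΓ : Det x fun a (_ : Fin p) => Γ a)
    (hlt : ∀ a i v, Γ a i v < 2 ^ colorExp d (degExp a₀ d l i))
    (hU : 2 ^ (a₀ + d + 11) * (m + 1) ^ 4 ≤ U) (hL : 2 ^ a₀ ≤ 2 ^ (d + 8) * L)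
    (h : S.Know T x) (k : ℕ) :
    S.Know (T + k * (5 * D + 10 + Q * (D + 33)) + degExp a₀ d l k * (2 * D + 3)) fun a i => (x a i,
      Y.own (fun a => _root_.survivors (G a) a₀ d l k (Γ a)) a i) := by
  have key : ∀ j, S.Know (T + k * (5 * D + 10 + Q * (D + 33)) + j * (2 * D + 3)) fun a i => (x a i,
      Y.own (fun a => directAt (G a) (degExp a₀ d l k) (_root_.aliveAt (G a) a₀ d l (Γ a) k) j)
        a i) := by
    intro j
    induction j with
    | zero => exact (h.aliveAt R hΓ hlt hU hL k).mono (by omega)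
    | succ j ih => exact (ih.thresh R _).mono (le_of_eq (by ring))
  exact key _

end Phases

end MPC

/-! ### From arbitrarily distributed edges to the sorted layout. -/

namespace MPC

variable {I δ α : Type} {p n : ℕ}

section Items

/-- The item of a vertex. -/
def vertexItem (v : Fin n) : ℕ := v * (n + 1)

/-- The item of a dart. It comes after the item of the first vertex of the dart and before the item of
the next vertex. -/
def dartItem (e : Fin n × Fin n) : ℕ := e.1 * (n + 1) + (e.2 + 1)

/-- The item of the reversed dart. -/
def reverseItem (n k : ℕ) : ℕ :=
  if k % (n + 1) = 0 then k else (k % (n + 1) - 1) * (n + 1) + (k / (n + 1) + 1)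

theorem vertexItem_div (v : Fin n) : vertexItem v / (n + 1) = v := Nat.mul_div_cancel _ n.succ_pos

theorem vertexItem_mod (v : Fin n) : vertexItem v % (n + 1) = 0 := Nat.mul_mod_left _ _

theorem dartItem_div (e : Fin n × Fin n) : dartItem e / (n + 1) = e.1 := by
  rw [dartItem, mul_comm, Nat.mul_add_div n.succ_pos, Nat.div_eq_of_lt (by omega), Nat.add_zero]

theorem dartItem_mod (e : Fin n × Fin n) : dartItem e % (n + 1) = e.2 + 1 := by
  rw [dartItem, Nat.mul_add_mod_self_right, Nat.mod_eq_of_lt (by omega)]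

theorem reverseItem_vertexItem (v : Fin n) : reverseItem n (vertexItem v) = vertexItem v := by
  rw [reverseItem, if_pos (vertexItem_mod v)]

theorem reverseItem_dartItem (e : Fin n × Fin n) :
    reverseItem n (dartItem e) = dartItem e.swap := by
  rw [reverseItem, dartItem_mod, dartItem_div, if_neg (Nat.succ_ne_zero _)]
  rfl

theorem vertexItem_injective : Function.Injective (vertexItem (n := n)) := fun v w h =>
  Fin.ext (by rw [← vertexItem_div, h, vertexItem_div])

theorem dartItem_injective : Function.Injective (dartItem (n := n)) := fun e f h => by
  have h1 : (e.1 : ℕ) = f.1 := by rw [← dartItem_div, h, dartItem_div]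
  have h2 : (e.2 : ℕ) + 1 = f.2 + 1 := by rw [← dartItem_mod, h, dartItem_mod]
  exact Prod.ext (Fin.ext h1) (Fin.ext (by omega))

theorem vertexItem_ne_dartItem (v : Fin n) (e : Fin n × Fin n) : vertexItem v ≠ dartItem e := by
  intro h
  have h1 := vertexItem_mod v
  rw [h, dartItem_mod] at h1
  omega

theorem vertexItem_mono {v w : Fin n} (h : v ≤ w) : vertexItem v ≤ vertexItem w :=
  Nat.mul_le_mul_right _ h

theorem dartItem_le_vertexItem {e : Fin n × Fin n} {w : Fin n} (h : e.1 < w) :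
    dartItem e ≤ vertexItem w := by
  have h1 : ((e.1 : ℕ) + 1) * (n + 1) ≤ w * (n + 1) := Nat.mul_le_mul_right _ h
  rw [Nat.succ_mul] at h1
  unfold dartItem vertexItem
  omega

theorem vertexItem_le_dartItem {e : Fin n × Fin n} {w : Fin n} (h : w ≤ e.1) :
    vertexItem w ≤ dartItem e :=
  (vertexItem_mono h).trans (Nat.le_add_right _ _)

theorem dartItem_lt (e : Fin n × Fin n) : dartItem e < (n + 1) ^ 2 := by
  rw [sq, ← Nat.div_lt_iff_lt_mul n.succ_pos, dartItem_div]
  omega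

theorem vertexItem_lt (v : Fin n) : vertexItem v < (n + 1) ^ 2 := by
  rw [sq, ← Nat.div_lt_iff_lt_mul n.succ_pos, vertexItem_div]
  omega

/-- The items of the vertices and the darts of a graph. -/
noncomputable def items (G : SimpleGraph (Fin n)) : Finset ℕ :=
  (Finset.univ : Finset (Fin n)).image vertexItem ∪ (darts G).image dartItem

variable {G : SimpleGraph (Fin n)}

theorem vertexItem_mem_items (v : Fin n) : vertexItem v ∈ items G :=
  Finset.mem_union_left _ (Finset.mem_image_of_mem _ (Finset.mem_univ _))

theorem dartItem_mem_items {e : Fin n × Fin n} : dartItem e ∈ items G ↔ G.Adj e.1 e.2 := by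
  rw [items, Finset.mem_union, Finset.mem_image, Finset.mem_image]
  constructor
  · rintro (⟨v, _, h⟩ | ⟨f, hf, h⟩)
    · exact absurd h (vertexItem_ne_dartItem v e)
    · rw [← dartItem_injective h]
      exact mem_darts.1 hf
  · exact fun h => Or.inr ⟨e, mem_darts.2 h, rfl⟩

theorem items_cases {k : ℕ} (hk : k ∈ items G) :
    (∃ v : Fin n, k = vertexItem v) ∨ ∃ e : Fin n × Fin n, G.Adj e.1 e.2 ∧ k = dartItem e := by
  rcases Finset.mem_union.1 hk with h | h
  · obtain ⟨v, _, rfl⟩ := Finset.mem_image.1 h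
    exact Or.inl ⟨v, rfl⟩
  · obtain ⟨e, he, rfl⟩ := Finset.mem_image.1 h
    exact Or.inr ⟨e, mem_darts.1 he, rfl⟩

theorem items_lt {k : ℕ} (hk : k ∈ items G) : k < (n + 1) ^ 2 := by
  rcases items_cases hk with ⟨v, rfl⟩ | ⟨e, _, rfl⟩
  · exact vertexItem_lt v
  · exact dartItem_lt e

theorem reverseItem_mem {k : ℕ} (hk : k ∈ items G) : reverseItem n k ∈ items G := by
  rcases items_cases hk with ⟨v, rfl⟩ | ⟨e, he, rfl⟩
  · rwa [reverseItem_vertexItem]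
  · rw [reverseItem_dartItem]
    exact dartItem_mem_items.2 he.symm

theorem reverseItem_reverseItem {k : ℕ} (hk : k ∈ items G) :
    reverseItem n (reverseItem n k) = k := by
  rcases items_cases hk with ⟨v, rfl⟩ | ⟨e, _, rfl⟩
  · rw [reverseItem_vertexItem, reverseItem_vertexItem]
  · rw [reverseItem_dartItem, reverseItem_dartItem, Prod.swap_swap]

theorem card_items_le : #(items G) ≤ n + #(darts G) := by
  refine (Finset.card_union_le _ _).trans (add_le_add ?_ Finset.card_image_le)
  exact Finset.card_image_le.trans (by simp)

theorem rank_lt {k : ℕ} (hk : k ∈ items G) : rankBy id (items G) k < (n + 1) ^ 2 := by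
  refine (rankBy_lt_card hk).trans_le ?_
  rw [← Finset.card_range ((n + 1) ^ 2)]
  exact Finset.card_le_card fun k hk => Finset.mem_range.2 (items_lt hk)

/-- An item together with the rank of the item of the reversed dart. -/
noncomputable def pairedItem (G : SimpleGraph (Fin n)) (k : ℕ) : ℕ :=
  k * (n + 1) ^ 2 + rankBy id (items G) (reverseItem n k)

theorem pairedItem_div {k : ℕ} (hk : k ∈ items G) : pairedItem G k / (n + 1) ^ 2 = k := by
  rw [pairedItem, mul_comm, Nat.mul_add_div (by positivity),
    Nat.div_eq_of_lt (rank_lt (reverseItem_mem hk)), Nat.add_zero]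

theorem pairedItem_mod {k : ℕ} (hk : k ∈ items G) :
    pairedItem G k % (n + 1) ^ 2 = rankBy id (items G) (reverseItem n k) := by
  rw [pairedItem, Nat.mul_add_mod_self_right, Nat.mod_eq_of_lt (rank_lt (reverseItem_mem hk))]

theorem pairedItem_lt {k : ℕ} (hk : k ∈ items G) : pairedItem G k < (n + 1) ^ 4 := by
  rw [show (n + 1) ^ 4 = (n + 1) ^ 2 * (n + 1) ^ 2 by ring,
    ← Nat.div_lt_iff_lt_mul (by positivity), pairedItem_div hk]
  exact items_lt hk

theorem pairedItem_lt_iff {k k' : ℕ} (hk : k ∈ items G) (hk' : k' ∈ items G) :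
    pairedItem G k < pairedItem G k' ↔ k < k' := by
  constructor
  · intro h
    have h1 := Nat.div_le_div_right (c := (n + 1) ^ 2) h.le
    rw [pairedItem_div hk, pairedItem_div hk'] at h1
    refine h1.lt_of_ne fun h2 => ?_
    rw [h2] at h
    exact lt_irrefl _ h
  · intro h
    by_contra hle
    have h1 := Nat.div_le_div_right (c := (n + 1) ^ 2) (not_lt.1 hle)
    rw [pairedItem_div hk, pairedItem_div hk'] at h1
    omega

/-- The payload occupies the low-order part of the paired item, so it does not affect the order. -/
theorem rankBy_pairedItem {k : ℕ} (hk : k ∈ items G) :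
    rankBy id ((items G).image (pairedItem G)) (pairedItem G k) = rankBy id (items G) k := by
  unfold rankBy
  rw [Finset.filter_image, Finset.card_image_of_injOn]
  · congr 1
    exact Finset.filter_congr fun k' hk' => pairedItem_lt_iff hk' hk
  · intro a ha b hb hab
    have ha := (Finset.mem_filter.1 (Finset.mem_coe.1 ha)).1
    have hb := (Finset.mem_filter.1 (Finset.mem_coe.1 hb)).1
    rw [← pairedItem_div ha, hab, pairedItem_div hb]

end Items

section Layout

variable {S : Env I p δ} {G : I → SimpleGraph (Fin n)} {L : ℕ}

/-- The vertices and darts in the order of their items, `L` on each machine. -/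
noncomputable def sortedLayout (G : I → SimpleGraph (Fin n)) (hL : 1 ≤ L)
    (hp : ∀ a, n + #(darts (G a)) ≤ p * L) : Layout G p L where
  mach a v u := rankBy id (items (G a)) (dartItem (v, u)) / L
  head a v := rankBy id (items (G a)) (vertexItem v) / L
  mach_lt a v u h := by
    refine Nat.div_lt_of_lt_mul ?_
    rw [mul_comm]
    exact (rankBy_lt_card (dartItem_mem_items.2 h)).trans_le (card_items_le.trans (hp a))
  head_lt a v := by
    refine Nat.div_lt_of_lt_mul ?_
    rw [mul_comm]
    exact (rankBy_lt_card (vertexItem_mem_items v)).trans_le (card_items_le.trans (hp a))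
  head_mono a v v' h := Nat.div_le_div_right (rankBy_le_rankBy (f := id) (vertexItem_mono h))
  mach_le_head a v u v' _ h :=
    Nat.div_le_div_right (rankBy_le_rankBy (f := id) (dartItem_le_vertexItem (e := (v, u)) h))
  head_le_mach a v v' u' _ h :=
    Nat.div_le_div_right (rankBy_le_rankBy (f := id) (vertexItem_le_dartItem (e := (v', u')) h))
  card_mach a i := by
    have hinj : Set.InjOn (rankBy id (items (G a))) (items (G a) : Finset ℕ) :=
      rankBy_injOn fun _ _ _ _ h => h
    refine le_trans (Finset.card_le_card_of_injOn dartItem (fun e he => ?_)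
      dartItem_injective.injOn) (card_filter_div_le hinj hL i)
    obtain ⟨h1, h2⟩ := Finset.mem_filter.1 (Finset.mem_coe.1 he)
    exact Finset.mem_coe.2 (Finset.mem_filter.2 ⟨dartItem_mem_items.2 (mem_darts.1 h1), h2⟩)
  card_head a i := by
    have hinj : Set.InjOn (rankBy id (items (G a))) (items (G a) : Finset ℕ) :=
      rankBy_injOn fun _ _ _ _ h => h
    refine le_trans (Finset.card_le_card_of_injOn vertexItem (fun v hv => ?_)
      vertexItem_injective.injOn) (card_filter_div_le hinj hL i)
    exact Finset.mem_coe.2 (Finset.mem_filter.2 ⟨vertexItem_mem_items v,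
      (Finset.mem_filter.1 (Finset.mem_coe.1 hv)).2⟩)

/-- The items on a machine, with the ranks of the items of the reversed darts. -/
noncomputable def pairedAt (G : I → SimpleGraph (Fin n)) (L : ℕ) (a : I) (i : Fin p) : Finset ℕ :=
  {k ∈ items (G a) | rankBy id (items (G a)) k / L = i}.image (pairedItem (G a))

theorem pairedAt_eq {a b : I} {i : Fin p} (h : pairedAt G L a i = pairedAt G L b i) {k : ℕ}
    (hk : k ∈ items (G a)) (hi : rankBy id (items (G a)) k / L = i) :
    (k ∈ items (G b) ∧ rankBy id (items (G b)) k / L = i) ∧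
      rankBy id (items (G a)) (reverseItem n k) = rankBy id (items (G b)) (reverseItem n k) := by
  have h1 : pairedItem (G a) k ∈ pairedAt G L b i := by
    rw [← h]
    exact Finset.mem_image_of_mem _ (Finset.mem_filter.2 ⟨hk, hi⟩)
  obtain ⟨k', hk', e⟩ := Finset.mem_image.1 h1
  obtain ⟨hk', hi'⟩ := Finset.mem_filter.1 hk'
  have h2 : k' = k := by rw [← pairedItem_div hk', e, pairedItem_div hk]
  subst h2
  exact ⟨⟨hk', hi'⟩, by rw [← pairedItem_mod hk, ← e, pairedItem_mod hk']⟩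

theorem det_headsAt (hL : 1 ≤ L) (hp : ∀ a, n + #(darts (G a)) ≤ p * L) :
    Det (pairedAt G L) (sortedLayout G hL hp).headsAt := by
  intro i a b hab
  ext v
  simp only [Layout.headsAt, Finset.mem_filter, Finset.mem_univ, true_and]
  exact ⟨fun h => (pairedAt_eq hab (vertexItem_mem_items v) h).1.2,
    fun h => (pairedAt_eq hab.symm (vertexItem_mem_items v) h).1.2⟩

theorem det_dartsAt (hL : 1 ≤ L) (hp : ∀ a, n + #(darts (G a)) ≤ p * L) :
    Det (pairedAt G L) (sortedLayout G hL hp).dartsAt := by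
  intro i a b hab
  have key : ∀ a b, pairedAt G L a i = pairedAt G L b i → ∀ e : Fin n × Fin n, e ∈ darts (G a) →
      (sortedLayout G hL hp).mach a e.1 e.2 = i → (e ∈ darts (G b) ∧
        (sortedLayout G hL hp).mach b e.1 e.2 = i) ∧
        (sortedLayout G hL hp).mach a e.2 e.1 = (sortedLayout G hL hp).mach b e.2 e.1 := by
    intro a b hab e he hi
    obtain ⟨⟨h1, h2⟩, h3⟩ := pairedAt_eq hab (dartItem_mem_items.2 (mem_darts.1 he)) hi
    rw [reverseItem_dartItem] at h3
    exact ⟨⟨mem_darts.2 (dartItem_mem_items.1 h1), h2⟩, congrArg (· / L) h3⟩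
  have h1 : ({e ∈ darts (G a) | (sortedLayout G hL hp).mach a e.1 e.2 = i} : Finset _) =
      {e ∈ darts (G b) | (sortedLayout G hL hp).mach b e.1 e.2 = i} := by
    ext e
    simp only [Finset.mem_filter]
    exact ⟨fun h => (key a b hab e h.1 h.2).1, fun h => (key b a hab.symm e h.1 h.2).1⟩
  unfold Layout.dartsAt
  rw [← h1]
  refine Finset.image_congr fun e he => ?_
  obtain ⟨he, hi⟩ := Finset.mem_filter.1 (Finset.mem_coe.1 he)
  simp only [(key a b hab e he hi).2]

/-- The initial items of a machine: the darts of its edges, and a share of the vertices. -/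
noncomputable def initialItems (F : Finset (Sym2 (Fin n))) (i : Fin p) : Finset ℕ :=
  ({v | (v : ℕ) % p = i} : Finset (Fin n)).image vertexItem ∪
    ({e | s(e.1, e.2) ∈ F} : Finset (Fin n × Fin n)).image dartItem

/-- Vertices are dealt out modulo `p`, and each edge yields two darts. -/
theorem card_initialItems_le (F : Finset (Sym2 (Fin n))) (i : Fin p) :
    #(initialItems F i) ≤ n / p + 1 + 2 * #F := by
  have hp : 0 < p := i.pos
  refine (Finset.card_union_le _ _).trans (add_le_add (Finset.card_image_le.trans ?_)
    (Finset.card_image_le.trans ?_))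
  · rw [← Finset.card_range (n / p + 1)]
    refine Finset.card_le_card_of_injOn (fun v => (v : ℕ) / p) (fun v _ => ?_) ?_
    · exact Finset.mem_coe.2 (Finset.mem_range.2 (Nat.lt_succ_of_le
        (Nat.div_le_div_right v.2.le)))
    · intro v hv w hw h
      have h1 := (Finset.mem_filter.1 (Finset.mem_coe.1 hv)).2
      have h2 := (Finset.mem_filter.1 (Finset.mem_coe.1 hw)).2
      refine Fin.ext ?_
      rw [← Nat.div_add_mod (v : ℕ) p, ← Nat.div_add_mod (w : ℕ) p, h1, h2]
      simp only at h
      rw [h]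
  · refine Finset.card_le_mul_card_image_of_maps_to (f := fun e : Fin n × Fin n => s(e.1, e.2))
      (t := F) (fun e he => (Finset.mem_filter.1 he).2) 2 fun z _ => ?_
    induction z using Sym2.inductionOn with
    | hf v w =>
      refine le_trans (Finset.card_le_card (t := {(v, w), (w, v)}) ?_) Finset.card_le_two
      rintro ⟨v', w'⟩ he
      have := (Finset.mem_filter.1 he).2
      rw [Sym2.eq_iff] at this
      simp only [Finset.mem_insert, Finset.mem_singleton, Prod.mk.injEq]
      exact this

end Layout

section Broadcast

variable {S : Env I p δ} {x : I → Fin p → α}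

/-- The first machine sends a word to all machines. -/
theorem Env.Know.broadcast {T ℓ q D : ℕ} (h : S.Know T x) (hsmall : Small S.W ℓ x) (y : I → ℕ)
    (hy : ∀ a b (i : Fin p), (i : ℕ) = 0 → x a i = x b i → y a = y b)
    (hword : ∀ a, 2 * y a + 1 < S.W) (hq : 1 ≤ q) (hp : p ≤ q ^ D) (hs : ℓ + 4 * q ≤ S.s) :
    S.Know (T + (D + 1)) fun a i => (x a i, y a) := by
  -- A prefix scan in which only intervals containing machine `0` carry the word.
  let F : I → ℕ → ℕ → Finset ℕ := fun a l r => if l = 0 ∧ 0 < r then {y a} else ∅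
  have hcat : ∀ a l m r, l ≤ m → m ≤ r → F a l r = F a l m ∪ F a m r := by
    intro a l m r h1 h2
    simp only [F]
    split_ifs <;> first | omega | simp
  refine (h.scan (B := 1) hsmall F id ?_ ?_ ?_ ?_ ?_ ?_ hq hp (by omega)).det ?_
  · intro i a b hab
    change (if _ then _ else _) = if _ then _ else _
    split_ifs with hi
    · rw [hy a b i hi.1 hab]
    · rfl
  · intro a b l
    simp only [F]
    rw [if_neg (by omega), if_neg (by omega)]
  · intro a b l m r h1 h2 _ h3 h4
    rw [hcat a l m r h1 h2, hcat b l m r h1 h2, h3, h4]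
  · exact fun _ _ _ _ _ h => h
  · intro a l r _
    change #(if _ then _ else _) ≤ 1
    split_ifs <;> simp
  · intro a l r _ w hw
    change w ∈ (if _ then _ else _) at hw
    split_ifs at hw
    · rw [Finset.mem_singleton.1 hw]; exact hword a
    · exact absurd hw (Finset.notMem_empty _)
  · intro i a b hab
    have e1 : x a i = x b i := congrArg (fun z => z.1) hab
    have e2 : F a 0 i = F b 0 i := congrArg (fun z => z.2.1) hab
    refine Prod.ext e1 ?_
    change y a = y b
    rcases Nat.eq_zero_or_pos i with h0 | h0
    · exact hy a b i h0 e1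
    · simp only [F, if_pos (⟨rfl, h0⟩ : (0 = 0 ∧ 0 < (i : ℕ)))] at e2
      exact Finset.singleton_injective e2

end Broadcast

end MPC

namespace MPC

variable {I δ α : Type} {p n : ℕ}

section Items

variable {S : Env I p δ} {G : I → SimpleGraph (Fin n)} {L q D U Q ℓ : ℕ} {x : I → Fin p → α}
  {F : I → Fin p → Finset (Sym2 (Fin n))}

theorem mem_initialItems_iff {s : ℕ} {H : SimpleGraph (Fin n)} {f : Fin p → Finset (Sym2 (Fin n))}
    (hf : IsInputDistribution H s f) (hp : 0 < p) (k : ℕ) :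
    k ∈ items H ↔ ∃ i, k ∈ initialItems (f i) i := by
  constructor
  · intro hk
    rcases items_cases hk with ⟨v, rfl⟩ | ⟨e, he, rfl⟩
    · exact ⟨⟨v % p, Nat.mod_lt _ hp⟩, Finset.mem_union_left _ (Finset.mem_image_of_mem _
        (Finset.mem_filter.2 ⟨Finset.mem_univ _, rfl⟩))⟩
    · obtain ⟨i, hi, -⟩ := hf.2.1 s(e.1, e.2) he
      exact ⟨i, Finset.mem_union_right _ (Finset.mem_image_of_mem _
        (Finset.mem_filter.2 ⟨Finset.mem_univ _, hi⟩))⟩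
  · rintro ⟨i, hi⟩
    rcases Finset.mem_union.1 hi with h | h
    · obtain ⟨v, _, rfl⟩ := Finset.mem_image.1 h
      exact vertexItem_mem_items v
    · obtain ⟨e, he, rfl⟩ := Finset.mem_image.1 h
      exact dartItem_mem_items.2 (hf.1 i _ (Finset.mem_filter.1 he).2)

theorem initialItems_disjoint {s : ℕ} {H : SimpleGraph (Fin n)}
    {f : Fin p → Finset (Sym2 (Fin n))} (hf : IsInputDistribution H s f) {i j : Fin p} {k : ℕ}
    (hi : k ∈ initialItems (f i) i) (hj : k ∈ initialItems (f j) j) : i = j := by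
  rcases Finset.mem_union.1 hi with h | h <;> rcases Finset.mem_union.1 hj with h' | h' <;>
    obtain ⟨v, hv, rfl⟩ := Finset.mem_image.1 h <;>
    obtain ⟨w, hw, e⟩ := Finset.mem_image.1 h'
  · obtain rfl := vertexItem_injective e
    exact Fin.ext ((Finset.mem_filter.1 hv).2.symm.trans (Finset.mem_filter.1 hw).2)
  · exact absurd e.symm (vertexItem_ne_dartItem _ _)
  · exact absurd e (vertexItem_ne_dartItem _ _)
  · obtain rfl := dartItem_injective e
    have h1 := (Finset.mem_filter.1 hv).2
    have h2 := (Finset.mem_filter.1 hw).2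
    exact (hf.2.1 _ (hf.1 i _ h1)).unique h1 h2

/-- From any distribution of the edges to the sorted layout. -/
theorem Env.Know.sortItems {T : ℕ} (cap : Capacity S q D U Q L)
    (h : S.Know T fun a i => (x a i, F a i)) (hsmall : Small S.W ℓ fun a i => (x a i, F a i))
    (hl : 4 * (ℓ + 2 * L) ≤ S.s) (hF : ∀ a, IsInputDistribution (G a) S.s (F a))
    (hnp : n / p + 1 ≤ S.s) (hp : 0 < p) (hpL : ∀ a, n + #(darts (G a)) ≤ p * L)
    (hU : (n + 1) ^ 4 ≤ U) :
    S.Know (T + (Q * (D + 33) + Q * (D + 33))) fun a i => (x a i, pairedAt G L a i) := by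
  have hL := cap.one_le_L
  have hUB : ∀ {k}, k < (n + 1) ^ 2 → k < U := fun hk => hk.trans_le
    ((Nat.pow_le_pow_right n.succ_pos (by norm_num)).trans hU)
  have hinit : Det (fun a i => (x a i, F a i)) fun a i => (x a i, initialItems (F a i) i) := by
    intro i a b hab
    have e1 : x a i = x b i := congrArg (fun z => z.1) hab
    have e2 : F a i = F b i := congrArg (fun z => z.2) hab
    refine Prod.ext e1 ?_
    change initialItems (F a i) i = initialItems (F b i) i
    rw [e2]
  have hcardp : ∀ a, #(items (G a)) ≤ p * L := fun a => card_items_le.trans (hpL a)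
  have h1 := (h.det hinit).sort cap (hsmall.of_det hinit) (by omega)
    (fun a i j k hi hj => initialItems_disjoint (hF a) hi hj) (fun a => items (G a))
    (fun a k => mem_initialItems_iff (hF a) hp k) (fun a k hk => hUB (items_lt hk))
    (fun a i => (card_initialItems_le (F a i) i).trans (by
      have := (hF a).2.2 i
      omega)) hcardp
  -- After the first sort the machine of `k` knows the rank of `k`. It attaches this rank to the
  -- reversed item, and a second sort brings the pair to the machine of the reversed item, which
  -- thus learns where its partner is.
  let X : I → Fin p → Finset ℕ := fun a i =>
    {k ∈ items (G a) | rankBy id (items (G a)) k / L = i}.image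
      fun k => pairedItem (G a) (reverseItem n k)
  have hXcard : ∀ a i, #(X a i) ≤ L := fun a i => Finset.card_image_le.trans
    (card_filter_div_le (rankBy_injOn fun _ _ _ _ h => h) hL i)
  have hX : Det (fun a i => (x a i, labelled (fun a => items (G a))
      (fun a k => rankBy id (items (G a)) k / L) (fun a => rankBy id (items (G a))) a i))
      fun a i => (x a i, X a i) := by
    intro i a b hab
    have e1 : x a i = x b i := congrArg (fun z => z.1) hab
    obtain ⟨e2, e3⟩ := labelled_eq (H := fun a => items (G a))
      (loc := fun a k => rankBy id (items (G a)) k / L) (σ := fun a => rankBy id (items (G a)))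
      (congrArg (fun z => z.2) hab)
    refine Prod.ext e1 ?_
    change Finset.image _ _ = Finset.image _ _
    rw [← e2]
    refine Finset.image_congr fun k hk => ?_
    have hkb := Finset.mem_coe.1 hk
    rw [e2] at hkb
    have hkb := (Finset.mem_filter.1 hkb).1
    obtain ⟨hka, hi⟩ := Finset.mem_filter.1 (Finset.mem_coe.1 hk)
    have h3 := e3 k hka hi
    simp only [pairedItem, reverseItem_reverseItem hka] at h3 ⊢
    rw [h3]
  have hsmx : Small S.W ℓ x := hsmall.of_det Det.fst
  have hword : ∀ k, k < U → k < S.W := fun k hk => by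
    have := cap.two_mul_add_one_lt (w := k) (by nlinarith)
    omega
  have hXU : ∀ a i, ∀ k ∈ X a i, k < U := by
    intro a i k hk
    obtain ⟨k', hk', rfl⟩ := Finset.mem_image.1 hk
    exact (pairedItem_lt (reverseItem_mem (Finset.mem_filter.1 hk').1)).trans_le hU
  have hmem : ∀ a k, k ∈ (items (G a)).image (pairedItem (G a)) ↔ ∃ i, k ∈ X a i := by
    intro a k
    simp only [X, Finset.mem_image, Finset.mem_filter]
    constructor
    · rintro ⟨k', hk', rfl⟩
      have hr := reverseItem_mem hk'
      refine ⟨⟨rankBy id (items (G a)) (reverseItem n k') / L, ?_⟩, reverseItem n k', ⟨hr, rfl⟩,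
        by rw [reverseItem_reverseItem hk']⟩
      refine Nat.div_lt_of_lt_mul ?_
      rw [mul_comm]
      exact (rankBy_lt_card hr).trans_le (hcardp a)
    · rintro ⟨i, k', ⟨hk', _⟩, rfl⟩
      exact ⟨_, reverseItem_mem hk', rfl⟩
  have h2 := (h1.det hX).sort cap (hsmx.pair (Small.of_words cap.two_le_W
    (fun a i k hk => hword k (hXU a i k hk)) hXcard)) (by omega) ?_
    (fun a => (items (G a)).image (pairedItem (G a))) hmem
    (fun a k hk => by obtain ⟨i, hi⟩ := (hmem a k).1 hk; exact hXU a i k hi)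
    (fun a i => (hXcard a i).trans (by omega))
    (fun a => Finset.card_image_le.trans (hcardp a))
  · refine (h2.det ?_).mono (by omega)
    intro i a b hab
    have e1 : x a i = x b i := congrArg (fun z => z.1) hab
    have e2 := (labelled_eq (H := fun a => (items (G a)).image (pairedItem (G a)))
      (loc := fun a k => rankBy id ((items (G a)).image (pairedItem (G a))) k / L)
      (σ := fun a => rankBy id ((items (G a)).image (pairedItem (G a))))
      (congrArg (fun z => z.2) hab)).1
    have h3 : ∀ a, pairedAt G L a i = {k ∈ (items (G a)).image (pairedItem (G a)) |
        rankBy id ((items (G a)).image (pairedItem (G a))) k / L = i} := by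
      intro a
      rw [Finset.filter_image, pairedAt]
      congr 1
      exact Finset.filter_congr fun k hk => by rw [rankBy_pairedItem hk]
    exact Prod.ext e1 ((h3 a).trans (e2.trans (h3 b).symm))
  · intro a i j k hi hj
    obtain ⟨u, hu, rfl⟩ := Finset.mem_image.1 hi
    obtain ⟨w, hw, e⟩ := Finset.mem_image.1 hj
    obtain ⟨hu, hui⟩ := Finset.mem_filter.1 hu
    obtain ⟨hw, hwj⟩ := Finset.mem_filter.1 hw
    have h3 : reverseItem n w = reverseItem n u := by
      rw [← pairedItem_div (reverseItem_mem hu), ← e, pairedItem_div (reverseItem_mem hw)]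
    have h4 : w = u := by
      rw [← reverseItem_reverseItem hw, h3, reverseItem_reverseItem hu]
    subst h4
    exact Fin.ext (hui.symm.trans hwj)

theorem small_pairedAt (cap : Capacity S q D U Q L) (hU : (n + 1) ^ 4 ≤ U) :
    Small S.W (2 * L) (pairedAt (p := p) G L) := by
  refine Small.of_words cap.two_le_W (fun a i k hk => ?_) fun a i => Finset.card_image_le.trans
    (card_filter_div_le (rankBy_injOn fun _ _ _ _ h => h) cap.one_le_L i)
  obtain ⟨k', hk', rfl⟩ := Finset.mem_image.1 hk
  have h1 := (pairedItem_lt (Finset.mem_filter.1 hk').1).trans_le hU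
  have := cap.two_mul_add_one_lt (w := pairedItem (G a) k') (by nlinarith)
  omega

end Items

end MPC

/-! ### The algorithm for a given list of colourings. -/

namespace MPC

/-- The inputs and the random draws of the first round. -/
structure Instance (n p s N L : ℕ) where
  graph : SimpleGraph (Fin n)
  input : Fin p → Finset (Sym2 (Fin n))
  draw : Fin p → Fin (N + 1)
  isInput : IsInputDistribution graph s input
  card_le : n + #(darts graph) ≤ p * L

/-- The protocol has to deal with all instances. -/
def env (n p s N L W : ℕ) : Env (Instance n p s N L) p (Finset (Sym2 (Fin n)) × Fin (N + 1)) :=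
  ⟨W, s, fun a i => (a.input i, a.draw i)⟩

/-- There is an algorithm that computes the complement of the survivors, for colourings that depend
on the random draw of the first machine. -/
theorem exists_algorithm {n p s N L W q D U Q m a₀ d l k : ℕ}
    (cap : Capacity (env n p s N L W) q D U Q L) (hp : 0 < p) (hn : n ≤ m) (hpm : p ≤ m)
    (hm : (m + 1) ^ 4 ≤ U) (hU : 2 ^ (a₀ + d + 11) * (m + 1) ^ 4 ≤ U)
    (hL : 2 ^ a₀ ≤ 2 ^ (d + 8) * L) (hnp : n / p + 1 ≤ s)
    (hin : (n * n + 1) ^ s ≤ W ^ (s / 100)) (hN : N < U) (hs : 1000 ≤ s)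
    (Γ : ℕ → ℕ → Fin n → ℕ) (hΓ : ∀ σ i v, Γ σ i v < 2 ^ colorExp d (degExp a₀ d l i)) :
    ∃ A : MPCAlgorithm n p W,
      A.rounds ≤ D + 1 + (Q * (D + 33) + Q * (D + 33)) + k * (5 * D + 10 + Q * (D + 33)) +
        degExp a₀ d l k * (2 * D + 3) + 1 ∧
      A.coin = N ∧ ∀ (G : SimpleGraph (Fin n)) (input : Fin p → Finset (Sym2 (Fin n))),
        IsInputDistribution G s input → n + #(darts G) ≤ p * L → ∀ ω : A.Randomness,
          A.FitsMemory s input ω ∧ A.solution input ω =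
            (survivors G a₀ d l k (Γ (ω ⟨0, Nat.succ_pos _⟩ ⟨0, hp⟩)))ᶜ := by
  classical
  set S := env n p s N L W
  let G : Instance n p s N L → SimpleGraph (Fin n) := fun a => a.graph
  let seed : Instance n p s N L → ℕ := fun a => a.draw ⟨0, hp⟩
  have hLs : 1000 * L ≤ s := cap.L_le
  have hqs : 1000 * (q * q) ≤ s := cap.q_le
  have hqq : q ≤ q * q := Nat.le_mul_self q
  have hL1 := cap.one_le_L
  have hUW : ∀ {w}, w ≤ U → 2 * w + 1 < W := fun {w} hw =>
    cap.two_mul_add_one_lt (w := w) (by nlinarith)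
  have hW0 : 0 < W := by have := hUW (Nat.zero_le U); omega
  have hnU : (n + 1) ^ 4 ≤ U := (Nat.pow_le_pow_left (by omega) 4).trans hm
  -- By counting, `s` edges need only `s / 100` large words, which frees the memory for everything
  -- else; one more word holds the random draw.
  have hsmall : Small W (s / 100 + 1) S.given := by
    refine Small.pair (x := fun (a : Instance n p s N L) i => a.input i)
      (y := fun (a : Instance n p s N L) i => a.draw i) ?_ ?_
    · refine Small.of_finset Finset.univ s (fun _ _ => Finset.subset_univ _)
        (fun a i => a.isInput.2.2 i) (le_trans (Nat.pow_le_pow_left (Nat.succ_le_succ ?_) s) hin)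
      have h1 : Fintype.card (Sym2 (Fin n)) ≤ Fintype.card (Fin n × Fin n) :=
        Fintype.card_le_of_surjective (fun e => s(e.1, e.2)) (fun z => by
          induction z using Sym2.inductionOn with
          | hf v w => exact ⟨(v, w), rfl⟩)
      simpa using h1
    · refine Small.of_card_le Finset.univ (fun _ _ => Finset.mem_univ _) ?_
      have := hUW (w := N) hN.le
      simp only [Finset.card_univ, Fintype.card_fin, pow_one]
      omega
  have hseed : ∀ a, seed a < U := fun a => lt_of_le_of_lt (Nat.le_of_lt_succ (a.draw ⟨0, hp⟩).2) hN
  have hsmallseed : Small W 1 fun (a : Instance n p s N L) (_ : Fin p) => seed a :=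
    Small.of_lt fun a _ => by have := hUW (hseed a).le; omega
  -- Only the draw of the first machine in round `0` is used. Every machine turns it into the same
  -- colourings through `Γ`.
  have h1 := (Env.Know.of_given (Det.refl S.given)).broadcast (q := q) (D := D) hsmall seed
    (fun a b i hi hab => by
      have h2 : (⟨0, hp⟩ : Fin p) = i := Fin.ext hi.symm
      have h3 := congrArg (fun z => ((z.2 : Fin (N + 1)) : ℕ)) hab
      simp only [seed, h2]
      exact h3)
    (fun a => hUW (hseed a).le) (by have := cap.two_le_q; omega) cap.p_le_pow (by
      change s / 100 + 1 + 4 * q ≤ s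
      omega)
  have hdet : Det (fun a i => (S.given a i, seed a))
      fun (a : Instance n p s N L) (i : Fin p) => (seed a, a.input i) := by
    intro i a b hab
    exact Prod.ext (congrArg (fun z => z.2) hab) (congrArg (fun z => z.1.1) hab)
  have h2 := (h1.det hdet).sortItems (G := G) (F := fun (a : Instance n p s N L) i => a.input i)
    cap ((hsmall.pair hsmallseed).of_det hdet) (by
      change 4 * (s / 100 + 1 + 1 + 2 * L) ≤ s
      omega) (fun a => a.isInput) hnp hp
    (fun a => a.card_le) hnU
  let Y : Layout G p L := sortedLayout G hL1 fun a => a.card_le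
  have R : Room S Y (fun a i => (seed a, pairedAt G L a i)) q D U Q m (1 + 2 * L) :=
    { cap := cap
      n_le := hn
      p_le := hpm
      pow_le := hm
      dartsAt := Det.snd.trans (det_dartsAt hL1 _)
      headsAt := Det.snd.trans (det_headsAt hL1 _)
      small := hsmallseed.pair (small_pairedAt cap hnU)
      le_s := by
        change 100 * (1 + 2 * L) ≤ s
        omega }
  have h3 := h2.survivors R (Γ := fun a => Γ (seed a)) (a₀ := a₀) (d := d) (l := l)
    (fun i a b hab => by
      have : seed a = seed b := congrArg (fun z => z.1) hab
      change Γ (seed a) = Γ (seed b)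
      rw [this]) (fun a => hΓ (seed a)) hU hL k
  let out : Instance n p s N L → Fin p → Finset (Fin n) := fun a i =>
    {v | v ∉ survivors a.graph a₀ d l k (Γ (seed a)) ∧ Y.head a v = i}
  have h4 : S.Know _ out := h3.det (by
    intro i a b hab
    have e1 : (seed a, pairedAt G L a i) = (seed b, pairedAt G L b i) :=
      congrArg (fun z => z.1) hab
    have e2 := congrArg (fun z => z.2) hab
    ext v
    have h5 := Layout.headsAt_eq (R.headsAt i a b e1) (v := v)
    have h6 := Layout.own_eq (Y := Y)
      (A := fun a => survivors (G a) a₀ d l k (Γ (seed a))) e2 (v := v)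
    simp only [out, Finset.mem_filter, Finset.mem_univ, true_and]
    simp only [G] at h6
    tauto)
  obtain ⟨A, hA, hc, hrun⟩ := h4.exists_algorithm (fun a i => (Finset.card_le_card fun v hv =>
    Finset.mem_filter.2 ⟨Finset.mem_univ v, (Finset.mem_filter.1 hv).2.2⟩).trans
      ((Y.card_head a i).trans (by change L ≤ s; omega))) (by
      have := hUW hnU
      have : n + 1 ≤ (n + 1) ^ 4 := Nat.le_self_pow (by norm_num) _
      change n + 1 ≤ W
      omega)
  refine ⟨A, hA.trans (by omega), hc, fun H input hH hcard ω => ?_⟩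
  let a : Instance n p s N L := ⟨H, input, fun i => Fin.cast (by rw [hc]) (ω ⟨0, Nat.succ_pos _⟩ i),
    hH, hcard⟩
  obtain ⟨h5, h6⟩ := hrun a input ω fun i => rfl
  refine ⟨h5, ?_⟩
  ext v
  change v ∈ Finset.univ.biUnion (A.machineOutput input ω) ↔ _
  rw [h6, Finset.mem_biUnion, Finset.mem_compl]
  constructor
  · rintro ⟨i, _, hv⟩
    exact (Finset.mem_filter.1 hv).2.1
  · intro hv
    exact ⟨⟨Y.head a v, Y.head_lt a v⟩, Finset.mem_univ _,
      Finset.mem_filter.2 ⟨Finset.mem_univ _, hv, rfl⟩⟩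

end MPC

/-! ### Probability and numerical estimates. -/

namespace MPC

theorem card_darts_le_two_mul {n : ℕ} (G : SimpleGraph (Fin n)) :
    #(darts G) ≤ 2 * G.edgeSet.ncard := by
  classical
  rw [Set.ncard_eq_toFinset_card']
  refine Finset.card_le_mul_card_image_of_maps_to (f := fun e : Fin n × Fin n => s(e.1, e.2))
    (fun e he => ?_) 2 fun z _ => ?_
  · rw [Set.mem_toFinset]
    exact mem_darts.1 he
  · induction z using Sym2.inductionOn with
    | hf v w =>
      refine le_trans (Finset.card_le_card (t := {(v, w), (w, v)}) ?_) Finset.card_le_two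
      rintro ⟨v', w'⟩ he
      have := (Finset.mem_filter.1 he).2
      rw [Sym2.eq_iff] at this
      simp only [Finset.mem_insert, Finset.mem_singleton, Prod.mk.injEq]
      exact this

theorem graphSize_le {n : ℕ} (G : SimpleGraph (Fin n)) : graphSize G ≤ n + n * n := by
  classical
  refine Nat.add_le_add_left ?_ n
  rw [Set.ncard_eq_toFinset_card']
  refine (Finset.card_le_univ _).trans ?_
  have h1 : Fintype.card (Sym2 (Fin n)) ≤ Fintype.card (Fin n × Fin n) :=
    Fintype.card_le_of_surjective (fun e => s(e.1, e.2)) (fun z => by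
      induction z using Sym2.inductionOn with
      | hf v w => exact ⟨(v, w), rfl⟩)
  simpa using h1

open Classical in
/-- The probability of an event that depends on one random draw. -/
theorem le_prob_of_card_le {n p W N : ℕ} (A : MPCAlgorithm n p W) (hN : A.coin = N)
    (S : Set A.Randomness) (i : Fin A.rounds) (j : Fin p) (bad : ℕ → Prop) (hn : 0 < n)
    (hbad : n * #{x : Fin (N + 1) | bad x} ≤ N + 1) (hS : ∀ ω, ¬ bad (ω i j) → ω ∈ S) :
    1 - 1 / (n : ℝ) ≤ A.prob S := by
  subst hN
  have h1 : n * #{ω : A.Randomness | bad (ω i j)} ≤ Fintype.card A.Randomness := by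
    refine card_pi_le_of_update (fun ω : A.Randomness => bad (ω i j)) i n fun ω => ?_
    simp only [Function.update_self]
    refine card_pi_le_of_update (fun x : Fin p → Fin (A.coin + 1) => bad (x j)) j n fun x => ?_
    simp only [Function.update_self, Fintype.card_fin]
    exact hbad
  have h2 : Fintype.card A.Randomness ≤ #{ω : A.Randomness | bad (ω i j)} + S.ncard := by
    rw [Set.ncard_eq_toFinset_card', ← Finset.card_univ]
    refine (Finset.card_le_card fun ω _ => ?_).trans (Finset.card_union_le _ _)
    by_cases hb : bad (ω i j)
    · exact Finset.mem_union_left _ (Finset.mem_filter.2 ⟨Finset.mem_univ _, hb⟩)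
    · exact Finset.mem_union_right _ (Set.mem_toFinset.2 (hS ω hb))
  have h3 : (0 : ℝ) < Fintype.card A.Randomness := by
    exact_mod_cast Fintype.card_pos
  have hn' : (0 : ℝ) < n := by exact_mod_cast hn
  have h1' : (n : ℝ) * #{ω : A.Randomness | bad (ω i j)} ≤ Fintype.card A.Randomness := by
    exact_mod_cast h1
  have h2' : (Fintype.card A.Randomness : ℝ) ≤ #{ω : A.Randomness | bad (ω i j)} + S.ncard := by
    exact_mod_cast h2
  rw [MPCAlgorithm.prob, le_div_iff₀ h3]
  have h4 : (#{ω : A.Randomness | bad (ω i j)} : ℝ) ≤ 1 / n * Fintype.card A.Randomness := by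
    rw [one_div, ← div_eq_inv_mul, le_div_iff₀ hn', mul_comm]
    exact h1'
  linarith

section Numbers

theorem clog_le_log {x : ℕ} (hx : 1 ≤ x) : (Nat.clog 2 x : ℝ) ≤ 1 + 3 / 2 * Real.log x := by
  have hlog : 0 ≤ Real.log x := Real.log_nonneg (by exact_mod_cast hx)
  rcases hx.eq_or_lt with rfl | hx
  · simp
  · have h1 := Nat.pow_pred_clog_lt_self (b := 2) (by norm_num) hx
    have h2 : ((2 : ℝ)) ^ (Nat.clog 2 x).pred ≤ x := by exact_mod_cast h1.le
    have h3 := Real.log_le_log (by positivity) h2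
    rw [Real.log_pow] at h3
    have h4 : ((Nat.clog 2 x : ℕ) : ℝ) ≤ (Nat.clog 2 x).pred + 1 := by
      exact_mod_cast Nat.le_succ_of_pred_le le_rfl
    have h5 := Real.log_two_gt_d9
    have h6 : (0 : ℝ) ≤ (Nat.clog 2 x).pred := Nat.cast_nonneg _
    nlinarith

theorem two_pow_clog_le {x : ℕ} (hx : 1 ≤ x) : 2 ^ Nat.clog 2 x ≤ 2 * x := by
  rcases hx.eq_or_lt with rfl | hx
  · simp
  · have h1 := Nat.pow_pred_clog_lt_self (b := 2) (by norm_num) hx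
    have h2 : Nat.clog 2 x ≤ (Nat.clog 2 x).pred + 1 := Nat.le_succ_of_pred_le le_rfl
    calc 2 ^ Nat.clog 2 x ≤ 2 ^ ((Nat.clog 2 x).pred + 1) := Nat.pow_le_pow_right (by norm_num) h2
      _ ≤ 2 * x := by rw [pow_succ]; omega

theorem clog_le_self (x : ℕ) : Nat.clog 2 x ≤ x :=
  Nat.clog_le_of_le_pow Nat.lt_two_pow_self.le

/-- With `X = 2 ^ a₀`, the tail exponent is at least `24 * a₀`, and `(5 / 6) ^ 4 ≤ 1 / 2` makes the
tail at most `X ^ (-6)`. The remaining factors are at most `8 * X ^ 5`, and `X ≥ 8`. -/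
theorem failure_bound {n a₀ k : ℕ} (hn : n ≤ 2 ^ a₀) (ha : 3 ≤ a₀) (hk : a₀ ≤ 2 ^ k)
    (hka : k ≤ a₀) :
    (2 * n * k : ℝ) * (2 ^ a₀ * (1 + n * (2 * a₀ + 1)) * (5 / 6) ^ 2 ^ (k + 6 - 1)) ≤ 1 := by
  have h1 : 24 * a₀ ≤ 2 ^ (k + 6 - 1) := by
    rw [show k + 6 - 1 = k + 5 by omega, pow_add]
    omega
  have h2 : ((5 : ℝ) / 6) ^ 2 ^ (k + 6 - 1) ≤ (1 / 2) ^ (6 * a₀) := by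
    calc ((5 : ℝ) / 6) ^ 2 ^ (k + 6 - 1) ≤ (5 / 6) ^ (24 * a₀) :=
          pow_le_pow_of_le_one (by norm_num) (by norm_num) h1
      _ = ((5 / 6) ^ 4) ^ (6 * a₀) := by rw [← pow_mul]; congr 1; ring
      _ ≤ (1 / 2) ^ (6 * a₀) := by gcongr; norm_num
  set X : ℝ := 2 ^ a₀ with hX
  have h3 : ((1 : ℝ) / 2) ^ (6 * a₀) = 1 / X ^ 6 := by
    rw [hX, ← pow_mul, one_div_pow, mul_comm]
  have hX8 : 8 ≤ X := by
    calc (8 : ℝ) = 2 ^ 3 := by norm_num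
      _ ≤ X := pow_le_pow_right₀ (by norm_num) ha
  have haX : (a₀ : ℝ) ≤ X := by
    rw [hX]; exact_mod_cast Nat.lt_two_pow_self.le
  have hkX : (k : ℝ) ≤ X := le_trans (by exact_mod_cast hka) haX
  have hnX : (n : ℝ) ≤ X := by rw [hX]; exact_mod_cast hn
  rw [h3] at h2
  have hX0 : 0 < X := by linarith
  have h4 : 1 + (n : ℝ) * (2 * a₀ + 1) ≤ 4 * X ^ 2 := by
    have : (n : ℝ) * (2 * a₀ + 1) ≤ X * (2 * X + 1) := by gcongr
    nlinarith
  calc (2 * n * k : ℝ) * (X * (1 + n * (2 * a₀ + 1)) * (5 / 6) ^ 2 ^ (k + 6 - 1))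
      ≤ (2 * X * X) * (X * (4 * X ^ 2) * (1 / X ^ 6)) := by gcongr
    _ = 8 / X := by field_simp; ring
    _ ≤ 1 := by rw [div_le_one hX0]; exact hX8

theorem seeds_bound {n : ℕ} (hn : 1 ≤ n) :
    (2 : ℝ) ^ (n * n) * (5 / 6) ^ (4 * (n * n)) < 1 := by
  rw [pow_mul (5 / 6 : ℝ) 4, ← mul_pow]
  exact pow_lt_one₀ (by norm_num) (by norm_num) (by nlinarith)

end Numbers

end MPC

namespace MPC

/-- The algorithm computes small vertex covers in few rounds. -/
def Solves (n s p c C K : ℕ) (B : ℝ) (A : MPCAlgorithm n p (n ^ c)) : Prop :=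
  (A.rounds : ℝ) ≤ B ∧ ∀ G : SimpleGraph (Fin n), p = ⌈(C : ℝ) * (graphSize G : ℝ) / (s : ℝ)⌉₊ →
    ∀ input : Fin p → Finset (Sym2 (Fin n)), IsInputDistribution G s input →
      (∀ ω, A.FitsMemory s input ω) ∧ 1 - 1 / (n : ℝ) ≤ A.prob
        {ω | G.IsVertexCover (A.solution input ω : Set (Fin n)) ∧
          ((A.solution input ω).card : ℝ) ≤ K * Real.log n * (G.vertexCoverNum.toNat : ℝ)}

/-- The base of the scans. -/
structure IsBase (n s q t : ℕ) : Prop where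
  two_le : 2 ≤ q
  le_self : q ≤ n
  le_pow : n ≤ q ^ t
  sq_le : 1000 * (q * q) ≤ s

/-- The base is `q = ⌈n ^ (ε / 4)⌉`. Then `q ^ ⌈4 / ε⌉ ≥ n`, and `1000 * q ^ 2 ≤ 4000 * n ^ (ε / 2)
≤ n ^ ε` for large `n`. -/
theorem exists_isBase {ε : ℝ} (h0 : 0 < ε) (h1 : ε ≤ 1) :
    ∃ n₀ : ℕ, ∀ n s : ℕ, n₀ ≤ n → (n : ℝ) ^ ε ≤ s → ∃ q, IsBase n s q ⌈4 / ε⌉₊ := by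
  have hlim := (tendsto_rpow_atTop (half_pos h0)).comp tendsto_natCast_atTop_atTop
  obtain ⟨n₁, hn₁⟩ := Filter.eventually_atTop.1 (hlim.eventually_ge_atTop 4000)
  refine ⟨max n₁ 16, fun n s hn hs => ⟨⌈(n : ℝ) ^ (ε / 4)⌉₊, ?_⟩⟩
  have hn16 : 16 ≤ n := (le_max_right _ _).trans hn
  have hn0 : (0 : ℝ) < n := by exact_mod_cast (by omega : 0 < n)
  have hn1 : (1 : ℝ) < n := by exact_mod_cast (by omega : 1 < n)
  have h4000 : 4000 ≤ (n : ℝ) ^ (ε / 2) := hn₁ n ((le_max_left _ _).trans hn)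
  set y : ℝ := (n : ℝ) ^ (ε / 4) with hy
  have hy1 : 1 < y := Real.one_lt_rpow hn1 (by positivity)
  have hyy : y * y = (n : ℝ) ^ (ε / 2) := by
    rw [hy, ← Real.rpow_add hn0]; congr 1; ring
  have hy4 : (n : ℝ) ^ (ε / 2) * (n : ℝ) ^ (ε / 2) = (n : ℝ) ^ ε := by
    rw [← Real.rpow_add hn0]; congr 1; ring
  have hq : (⌈y⌉₊ : ℝ) ≤ 2 * y := (Nat.ceil_lt_add_one (by linarith)).le.trans (by linarith)
  refine ⟨?_, ?_, ?_, ?_⟩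
  · have : 1 < ⌈y⌉₊ := Nat.lt_ceil.2 (by simpa using hy1)
    omega
  · have h2 : y ≤ (n : ℝ) ^ (1 / 4 : ℝ) :=
      Real.rpow_le_rpow_of_exponent_le hn1.le (by linarith)
    have h3 : (n : ℝ) ^ (1 / 4 : ℝ) * 2 ≤ n := by
      have h4 : (2 : ℝ) ≤ (n : ℝ) ^ (1 / 4 : ℝ) := by
        have h5 : ((16 : ℝ)) ^ (1 / 4 : ℝ) = 2 := by
          rw [show (16 : ℝ) = 2 ^ (4 : ℝ) by norm_num, ← Real.rpow_mul (by norm_num)]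
          norm_num
        rw [← h5]
        exact Real.rpow_le_rpow (by norm_num) (by exact_mod_cast hn16) (by norm_num)
      have h6 : (n : ℝ) ^ (1 / 4 : ℝ) * (n : ℝ) ^ (1 / 4 : ℝ) ≤ n := by
        rw [← Real.rpow_add hn0]
        calc (n : ℝ) ^ (1 / 4 + 1 / 4 : ℝ) ≤ (n : ℝ) ^ (1 : ℝ) :=
              Real.rpow_le_rpow_of_exponent_le hn1.le (by norm_num)
          _ = n := Real.rpow_one _
      nlinarith
    exact_mod_cast (show (⌈y⌉₊ : ℝ) ≤ n by linarith)
  · have h2 : (n : ℝ) ≤ (⌈y⌉₊ : ℝ) ^ ⌈4 / ε⌉₊ := by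
      calc (n : ℝ) = (n : ℝ) ^ (1 : ℝ) := (Real.rpow_one _).symm
        _ ≤ (n : ℝ) ^ (ε / 4 * ⌈4 / ε⌉₊) := by
          refine Real.rpow_le_rpow_of_exponent_le hn1.le ?_
          have h3 := Nat.le_ceil (4 / ε)
          rw [div_le_iff₀ h0] at h3
          linarith
        _ = y ^ ⌈4 / ε⌉₊ := by rw [Real.rpow_mul hn0.le, Real.rpow_natCast]
        _ ≤ (⌈y⌉₊ : ℝ) ^ ⌈4 / ε⌉₊ := by
          gcongr
          exact Nat.le_ceil y
    exact_mod_cast h2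
  · have h2 : (1000 * (⌈y⌉₊ * ⌈y⌉₊) : ℝ) ≤ s := by
      have h3 : (⌈y⌉₊ * ⌈y⌉₊ : ℝ) ≤ 2 * y * (2 * y) := by gcongr
      nlinarith
    exact_mod_cast h2

/-- The binary logarithm of the density of the colourings. -/
def densityExp (n s : ℕ) : ℕ := Nat.clog 2 (n / (s / 1000) + 1)

/-- The graph `G₀` only witnesses that `p` has the required form; the algorithm serves all graphs
that lead to this `p`. The number of phases is `k = ⌈log ⌈log n⌉⌉` to base two, and `l = k + 6`
makes the tail bounds beat the union bound. -/
theorem exists_solves {n s p q t : ℕ} (hn : 5000 ≤ n) (hb : IsBase n s q t)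
    {G₀ : SimpleGraph (Fin n)} (hp : p = ⌈((4000 : ℕ) : ℝ) * (graphSize G₀ : ℝ) / (s : ℝ)⌉₊) :
    ∃ A, Solves n s p 600 4000 28 ((27 * (15 * t + 10 + 20 * t * (3 * t + 33)) *
      (1 + Nat.clog 2 (Nat.clog 2 n) + densityExp n s) : ℕ) : ℝ) A := by
  classical
  set a₀ := Nat.clog 2 n with ha₀
  set k := Nat.clog 2 a₀ with hk
  set d := densityExp n s with hd
  set L := s / 1000 with hL
  have hs4000 : 4000 ≤ s := by
    have h1 := hb.sq_le
    have h2 := Nat.mul_le_mul hb.two_le hb.two_le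
    omega
  have hL1 : 1 ≤ L := by omega
  have hLs : 1000 * L ≤ s := by omega
  have hsL : s ≤ 2000 * L := by omega
  have hn_le : n ≤ 2 ^ a₀ := Nat.le_pow_clog (by norm_num) n
  have hle_n : 2 ^ a₀ ≤ 2 * n := two_pow_clog_le (by omega)
  have ha₀3 : 3 ≤ a₀ := by
    by_contra h
    have := Nat.pow_le_pow_right (show 0 < 2 by norm_num) (show a₀ ≤ 2 by omega)
    omega
  have hak : a₀ ≤ 2 ^ k := Nat.le_pow_clog (by norm_num) a₀
  have hka : k ≤ a₀ := clog_le_self a₀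
  have hs0 : (0 : ℝ) < s := by exact_mod_cast (by omega : 0 < s)
  have hpG : ∀ G : SimpleGraph (Fin n), p = ⌈((4000 : ℕ) : ℝ) * (graphSize G : ℝ) / (s : ℝ)⌉₊ →
      4000 * graphSize G ≤ p * s := by
    intro G hG
    have h1 := Nat.le_ceil (((4000 : ℕ) : ℝ) * (graphSize G : ℝ) / (s : ℝ))
    rw [← hG, div_le_iff₀ hs0] at h1
    exact_mod_cast h1
  have hnG : ∀ G : SimpleGraph (Fin n), n ≤ graphSize G := fun G => Nat.le_add_right _ _
  have hp0 : 0 < p := by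
    have h1 := hpG G₀ hp
    have h2 := hnG G₀
    by_contra h0
    have : p = 0 := by omega
    rw [this, zero_mul] at h1
    omega
  have hpn : p ≤ n ^ 3 := by
    rw [hp]
    refine Nat.ceil_le.2 ?_
    rw [div_le_iff₀ hs0]
    have h1 := graphSize_le G₀
    have h2 : 4000 * graphSize G₀ ≤ n ^ 3 * s := by
      have h3 : n ^ 3 = n * n * n := by ring
      have h4 : 5000 * (n * n) ≤ n ^ 3 := by rw [h3, mul_comm]; exact Nat.mul_le_mul_left _ hn
      have h5 : n ≤ n * n := Nat.le_mul_self n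
      have h6 : n ^ 3 * 2 ≤ n ^ 3 * s := Nat.mul_le_mul_left _ (by omega)
      omega
    exact_mod_cast h2
  have hnp : n / p + 1 ≤ s := by
    have h1 := hpG G₀ hp
    have h2 := hnG G₀
    have h3 : n / p ≤ s / 4000 := by
      rw [Nat.le_div_iff_mul_le (by norm_num)]
      rw [mul_comm]
      refine (Nat.mul_div_le_mul_div_assoc 4000 n p).trans (Nat.div_le_of_le_mul ?_)
      omega
    omega
  have hd_le : 2 ^ d ≤ 2 * (n + 1) := by
    refine (two_pow_clog_le (Nat.succ_le_succ (Nat.zero_le _))).trans ?_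
    have : n / (s / 1000) ≤ n := Nat.div_le_self _ _
    omega
  have hm : (n ^ 3 + 1) ^ 4 ≤ n ^ 16 := by
    calc (n ^ 3 + 1) ^ 4 ≤ (n ^ 4) ^ 4 := by
          refine Nat.pow_le_pow_left ?_ 4
          have h1 : n ^ 4 = n ^ 3 * n := by ring
          have h2 : n ^ 3 * 2 ≤ n ^ 3 * n := Nat.mul_le_mul_left _ (by omega)
          have h3 : 0 < n ^ 3 := by positivity
          omega
      _ = n ^ 16 := by ring
  have hU : 2 ^ (a₀ + d + 11) * (n ^ 3 + 1) ^ 4 ≤ n ^ 20 := by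
    have h1 : 2 ^ (a₀ + d + 11) ≤ n ^ 4 := by
      rw [pow_add, pow_add]
      calc 2 ^ a₀ * 2 ^ d * 2 ^ 11 ≤ 2 * n * (2 * (n + 1)) * 2 ^ 11 := by gcongr
        _ ≤ n * n * (5000 * 5000) := by nlinarith
        _ ≤ n * n * (n * n) := by gcongr
        _ = n ^ 4 := by ring
    calc 2 ^ (a₀ + d + 11) * (n ^ 3 + 1) ^ 4 ≤ n ^ 4 * n ^ 16 := Nat.mul_le_mul h1 hm
      _ = n ^ 20 := by ring
  have hdL : 2 ^ a₀ ≤ 2 ^ (d + 8) * L := by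
    have h1 : n / L + 1 ≤ 2 ^ d := Nat.le_pow_clog (by norm_num) _
    have h2 : n < (n / L + 1) * L := by
      rw [mul_comm]
      exact Nat.lt_mul_div_succ n hL1
    have h3 : (n / L + 1) * L ≤ 2 ^ d * L := Nat.mul_le_mul_right _ h1
    rw [pow_add, mul_right_comm]
    omega
  -- An edge is worth three factors `n`, so words below `n ^ 600` compress the input as needed even
  -- after the rounding in `s / 100`.
  have hin : (n * n + 1) ^ s ≤ (n ^ 600) ^ (s / 100) := by
    calc (n * n + 1) ^ s ≤ (n ^ 3) ^ s := by
          refine Nat.pow_le_pow_left ?_ s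
          have h1 : n ^ 3 = n * n * n := by ring
          have h2 : n * n * 2 ≤ n * n * n := Nat.mul_le_mul_left _ (by omega)
          have h3 : 0 < n * n := by positivity
          omega
      _ = n ^ (3 * s) := (pow_mul n 3 s).symm
      _ ≤ n ^ (600 * (s / 100)) := Nat.pow_le_pow_right (by omega) (by omega)
      _ = (n ^ 600) ^ (s / 100) := pow_mul n 600 _
  obtain ⟨h, hh⟩ := exists_coloring_seeds (n := n) (a₀ := a₀) (d := d) (l := k + 6) (T := k)
    (τ := 4 * (n * n)) (by omega) hn_le (failure_bound hn_le ha₀3 hak hka)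
    (seeds_bound (by omega))
  -- A draw is uniform on `Fin (N + 1)`, which is exactly the index set of the list of colourings.
  set N := 4 * (n * n) * n - 1 with hN
  have hn2 : 0 < n * n := by positivity
  have hNs : N + 1 = 4 * (n * n) * n := by
    have : 0 < 4 * (n * n) * n := by positivity
    omega
  let Γ : ℕ → ℕ → Fin n → ℕ := fun σ =>
    if hσ : σ < 4 * (n * n) * n then (h ⟨σ, hσ⟩).nat else fun _ _ => 0
  have hΓ : ∀ σ i v, Γ σ i v < 2 ^ colorExp d (degExp a₀ d (k + 6) i) := by
    intro σ i v
    simp only [Γ]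
    split_ifs
    · exact Colorings.nat_lt _ i v
    · positivity
  -- From `n ≤ q ^ t`, the bound `p ≤ n ^ 3` gives scan depth `3 * t`, and items below `n ^ 20` have
  -- `20 * t` digits.
  have hcap : Capacity (env n p s N L (n ^ 600)) q (3 * t) (n ^ 20) (20 * t) L :=
    { two_le_q := hb.two_le
      q_le_U := hb.le_self.trans (Nat.le_self_pow (by norm_num) n)
      four_le_U := (show 4 ≤ n by omega).trans (Nat.le_self_pow (by norm_num) n)
      p_le_pow := hpn.trans (by
        rw [mul_comm, pow_mul]
        exact Nat.pow_le_pow_left hb.le_pow 3)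
      U_le_pow := by
        rw [mul_comm, pow_mul]
        exact Nat.pow_le_pow_left hb.le_pow 20
      one_le_Q := by
        have : t ≠ 0 := by
          rintro rfl
          have := hb.le_pow
          rw [pow_zero] at this
          omega
        omega
      pow_le_W := (pow_mul n 20 8).symm.trans_le
        (Nat.pow_le_pow_right (by omega) (Nat.le_of_ble_eq_true rfl))
      one_le_L := hL1
      L_le := hLs
      q_le := hb.sq_le }
  obtain ⟨A, hA, hc, hrun⟩ := exists_algorithm hcap hp0
    (Nat.le_self_pow (by norm_num) n : n ≤ n ^ 3) hpn
    (hm.trans (Nat.pow_le_pow_right (by omega) (by norm_num))) hU hdL hnp hin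
    (by
      have h1 : N < n ^ 4 := by
        have h2 : n ^ 4 = n * n * n * n := by ring
        have h3 : n * n * n * 4 ≤ n * n * n * n := Nat.mul_le_mul_left _ (by omega)
        have h4 : 4 * (n * n) * n = n * n * n * 4 := by ring
        omega
      exact h1.trans_le (Nat.pow_le_pow_right (by omega) (by norm_num))) (by omega) Γ hΓ (k := k)
  refine ⟨A, ?_, fun G hG input hinput => ?_⟩
  · refine Nat.cast_le.2 (hA.trans ?_)
    have h1 : degExp a₀ d (k + 6) k ≤ d + 2 * k + 24 := by
      have h2 := degExp_le_add_div a₀ d (k + 6) k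
      have h3 : a₀ / 2 ^ k ≤ 1 := Nat.div_le_of_le_mul (by omega)
      omega
    have h2 := Nat.mul_le_mul_right (2 * (3 * t) + 3) h1
    generalize 20 * t * (3 * t + 33) = Z at *
    nlinarith
  -- The constant `4000` in the number of machines is used here: `s ≤ 2000 * L` leaves `p * L ≥ 2 *
  -- graphSize G`, which is room for the vertices and two darts per edge.
  · have hcard : n + #(darts G) ≤ p * L := by
      have h1 := hpG G hG
      have h2 := card_darts_le_two_mul G
      have h3 : graphSize G = n + G.edgeSet.ncard := rfl
      have h4 : p * s ≤ p * (2000 * L) := Nat.mul_le_mul_left _ hsL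
      have h5 : p * (2000 * L) = 2000 * (p * L) := by ring
      omega
    refine ⟨fun ω => (hrun G input hinput hcard ω).1, ?_⟩
    refine le_prob_of_card_le A hc _ ⟨0, Nat.succ_pos _⟩ ⟨0, hp0⟩
      (fun σ => ¬ #(survivors G a₀ d (k + 6) k (Γ σ))ᶜ ≤
        (8 * a₀ + k + 1) * G.vertexCoverNum.toNat) (by omega) ?_ fun ω hω => ?_
    · have h1 : #{x : Fin (N + 1) | ¬ #(survivors G a₀ d (k + 6) k (Γ x))ᶜ ≤
          (8 * a₀ + k + 1) * G.vertexCoverNum.toNat} ≤ 4 * (n * n) := by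
        refine le_trans ?_ (hh G).le
        refine Finset.card_le_card_of_injOn (fun x => Fin.cast hNs x) (fun x hx => ?_)
          (Fin.cast_injective hNs).injOn
        have hx := (Finset.mem_filter.1 (Finset.mem_coe.1 hx)).2
        have hlt : (x : ℕ) < 4 * (n * n) * n := x.2.trans_eq hNs
        simp only [Γ, dif_pos hlt] at hx
        exact Finset.mem_coe.2 (Finset.mem_filter.2 ⟨Finset.mem_univ _, hx⟩)
      have h2 := Nat.mul_le_mul_left n h1
      rw [mul_comm n (4 * (n * n)), ← hNs] at h2
      convert h2
    · have hω := not_not.1 hω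
      have hsol := (hrun G input hinput hcard ω).2
      refine ⟨fun v w hvw => ?_, ?_⟩
      · rw [hsol]
        by_contra hno
        simp only [Finset.coe_compl, Set.mem_compl_iff, Finset.mem_coe, not_or, not_not] at hno
        exact survivors_no_edges (by simpa using hn_le) k _ hno.1 hno.2 hvw
      · rw [hsol]
        have h1 : ((#(survivors G a₀ d (k + 6) k
            (Γ (ω ⟨0, Nat.succ_pos _⟩ ⟨0, hp0⟩)))ᶜ : ℕ) : ℝ) ≤
            ((8 * a₀ + k + 1 : ℕ) : ℝ) * G.vertexCoverNum.toNat := by exact_mod_cast hω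
        refine h1.trans (mul_le_mul_of_nonneg_right ?_ (Nat.cast_nonneg _))
        have h2 := clog_le_log (x := n) (by omega)
        rw [← ha₀] at h2
        have h3 : (k : ℝ) ≤ a₀ := by exact_mod_cast hka
        have h4 : 1 ≤ Real.log n := by
          rw [Real.le_log_iff_exp_le (by positivity)]
          have h5 := Real.exp_one_lt_d9
          have h6 : (5000 : ℝ) ≤ n := by exact_mod_cast hn
          linarith
        push_cast
        linarith

/-- The additive constants, among them a crude bound on `log 2001`, are absorbed because `log (log
n) ≥ 1`. -/
theorem rounds_le {n s : ℕ} (hn : 5000 ≤ n) (hs : 1000 ≤ s) :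
    ((1 + Nat.clog 2 (Nat.clog 2 n) + densityExp n s : ℕ) : ℝ) ≤
      4000 * (Real.log (Real.log n) + max 0 (Real.log ((n : ℝ) / (s : ℝ)))) := by
  have hn' : (5000 : ℝ) ≤ n := by exact_mod_cast hn
  have hs' : (1000 : ℝ) ≤ s := by exact_mod_cast hs
  have h3 : 3 ≤ Real.log n := by
    rw [Real.le_log_iff_exp_le (by linarith)]
    have h5 := Real.exp_one_lt_d9
    have h6 : Real.exp 3 = Real.exp 1 ^ 3 := by rw [← Real.exp_nat_mul]; norm_num
    rw [h6]
    have h7 : Real.exp 1 ^ 3 ≤ 3 ^ 3 := by gcongr; linarith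
    linarith
  have h1 : 1 ≤ Real.log (Real.log n) := by
    rw [Real.le_log_iff_exp_le (by linarith)]
    have h5 := Real.exp_one_lt_d9
    linarith
  have ha : 1 ≤ Nat.clog 2 n := Nat.clog_pos (by norm_num) (by omega)
  have h4 : (Nat.clog 2 (Nat.clog 2 n) : ℝ) ≤ 4 + 3 / 2 * Real.log (Real.log n) := by
    have h5 := clog_le_log ha
    have h6 := clog_le_log (x := n) (by omega)
    have h7 : (Nat.clog 2 n : ℝ) ≤ 3 * Real.log n := by linarith
    have h8 : Real.log (Nat.clog 2 n) ≤ Real.log (3 * Real.log n) :=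
      Real.log_le_log (by exact_mod_cast ha) h7
    rw [Real.log_mul (by norm_num) (by linarith)] at h8
    have h9 := Real.log_le_sub_one_of_pos (show (0 : ℝ) < 3 by norm_num)
    linarith
  set M : ℝ := max 0 (Real.log ((n : ℝ) / (s : ℝ))) with hM
  have h5 : (densityExp n s : ℝ) ≤ 1 + 3 / 2 * (2000 + M) := by
    refine (clog_le_log (Nat.succ_le_succ (Nat.zero_le _))).trans ?_
    have hL : s ≤ 2000 * (s / 1000) := by omega
    have hL' : (s : ℝ) ≤ 2000 * ((s / 1000 : ℕ) : ℝ) := by exact_mod_cast hL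
    have h6 : ((n / (s / 1000) + 1 : ℕ) : ℝ) ≤ 2001 * max 1 ((n : ℝ) / s) := by
      have h7 : ((n / (s / 1000) : ℕ) : ℝ) ≤ n / ((s / 1000 : ℕ) : ℝ) := Nat.cast_div_le
      have h8 : (n : ℝ) / ((s / 1000 : ℕ) : ℝ) ≤ 2000 * (n / s) := by
        rw [← mul_div_assoc, div_le_div_iff₀ (by linarith) (by linarith)]
        nlinarith
      push_cast
      have h9 := le_max_left 1 ((n : ℝ) / s)
      have h10 := le_max_right 1 ((n : ℝ) / s)
      linarith
    have h7 := Real.log_le_log (by positivity) h6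
    rw [Real.log_mul (by norm_num) (by positivity)] at h7
    have h8 := Real.log_le_sub_one_of_pos (show (0 : ℝ) < 2001 by norm_num)
    have h9 : Real.log (max 1 ((n : ℝ) / s)) ≤ M := by
      rcases le_total ((n : ℝ) / s) 1 with h | h
      · rw [max_eq_left h, Real.log_one]
        exact le_max_left _ _
      · rw [max_eq_right h]
        exact le_max_right _ _
    linarith
  have hM0 : 0 ≤ M := le_max_left _ _
  push_cast
  linarith

end MPC

open MPC in
theorem theorem3 :
    ∃ K : ℝ, ∀ ε : ℝ, 0 < ε →
      ∃ (c C n₀ : ℕ) (R : ℝ) (A : (n s p : ℕ) → MPCAlgorithm n p (n ^ c)), 1 ≤ C ∧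
        ∀ n s : ℕ, n₀ ≤ n → (n : ℝ) ^ ε ≤ (s : ℝ) →
          ∀ (G : SimpleGraph (Fin n)) (p : ℕ),
            p = ⌈(C : ℝ) * (graphSize G : ℝ) / (s : ℝ)⌉₊ →
            ((A n s p).rounds : ℝ) ≤
                R * (Real.log (Real.log n) + max 0 (Real.log ((n : ℝ) / (s : ℝ)))) ∧
            ∀ input : Fin p → Finset (Sym2 (Fin n)), IsInputDistribution G s input →
              (∀ ω, (A n s p).FitsMemory s input ω) ∧
              1 - 1 / (n : ℝ) ≤ (A n s p).prob
                {ω | G.IsVertexCover ((A n s p).solution input ω : Set (Fin n)) ∧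
                  (((A n s p).solution input ω).card : ℝ) ≤
                    K * Real.log n * (G.vertexCoverNum.toNat : ℝ)} := by
  classical
  refine ⟨(28 : ℕ), fun ε hε => ?_⟩
  -- Large `ε` is replaced by `1`, which only weakens the assumption on `s`.
  obtain ⟨n₁, hn₁⟩ := exists_isBase (lt_min hε one_pos) (min_le_right ε 1)
  set t := ⌈4 / min ε 1⌉₊
  set M : ℕ := 27 * (15 * t + 10 + 20 * t * (3 * t + 33))
  let B : ℕ → ℕ → ℝ := fun n s =>
    ((M * (1 + Nat.clog 2 (Nat.clog 2 n) + densityExp n s) : ℕ) : ℝ)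
  -- The algorithm has to be chosen before the graph and from `n`, `s`, `p` alone; when no solution
  -- exists for these parameters, a dummy is used.
  let A : (n s p : ℕ) → MPCAlgorithm n p (n ^ 600) := fun n s p =>
    if h : ∃ A, Solves n s p 600 4000 28 (B n s) A then h.choose
    else ⟨0, 0, fun _ _ _ _ => [], fun _ _ _ _ _ => [], fun _ _ => ∅⟩
  refine ⟨600, 4000, max n₁ 5000, M * 4000, A, by norm_num, fun n s hn hs G p hp => ?_⟩
  have hn5 : 5000 ≤ n := (le_max_right _ _).trans hn
  have hs' : (n : ℝ) ^ min ε 1 ≤ s := le_trans (Real.rpow_le_rpow_of_exponent_le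
    (by exact_mod_cast (by omega : 1 ≤ n)) (min_le_left _ _)) hs
  obtain ⟨q, hq⟩ := hn₁ n s ((le_max_left _ _).trans hn) hs'
  have hex : ∃ A, Solves n s p 600 4000 28 (B n s) A := exists_solves hn5 hq hp
  have hA : Solves n s p 600 4000 28 (B n s) (A n s p) := by
    simp only [A, dif_pos hex]
    exact hex.choose_spec
  refine ⟨hA.1.trans ?_, fun input hinput => hA.2 G hp input hinput⟩
  have hs1 : 1000 ≤ s := by
    have h1 := hq.sq_le
    have h2 := Nat.mul_le_mul hq.two_le hq.two_le
    omega
  change ((M * (1 + Nat.clog 2 (Nat.clog 2 n) + densityExp n s) : ℕ) : ℝ) ≤ _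
  rw [Nat.cast_mul, mul_assoc]
  exact mul_le_mul_of_nonneg_left (rounds_le hn5 hs1) (Nat.cast_nonneg _)
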